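/- **Theorem (uniform rates of the efficient weighted principal components estimators).** *Model.* Let $r$ be a fixed number of factors. For each $N$ let $Y_t=\Lambda f_t+u_t$, where $Y_t,u_t\in\mathbb R^N$, $f_t\in\mathbb R^r$ and $\Lambda=(\lambda_1,\dots,\lambda_N)'$ is a deterministic $N\times r$ matrix; $\{(f_t,u_t)\}_{t\in\mathbb Z}$ are random vectors on a probability space, and $Y_1,\dots,Y_T$ are observed. ($u_{it}$ and $\lambda_i$ may depend on $N$.) Put $Y=(Y_1,\dots,Y_T)$, $F=(f_1,\dots,f_T)'$, $\Sigma_u=\mathrm{cov}(u_t)$, $W=\Sigma_u^{-1}$, $\Lambda'\Sigma_u^{-1}=(\xi_1,\dots,\xi_N)$, $e_t=\Sigma_u^{-1}u_t$, $\omega_T=\sqrt{\log N/T}+1/\sqrt N$, and, for $q\in[0,1/2)$, $m_N=\max_{i\le N}\sum_{j\le N}|\Sigma_{u,ij}|^q$, where for $q=0$ the summand is $\mathbf 1\{\Sigma_{u,ij}\ne0\}$. $\|\cdot\|$ is the Euclidean norm. All limits are along a sequence of sample sizes $(N,T)$ with $N,T\to\infty$. *Assumptions.* (A1) $\{(f_t,u_t)\}_{t\in\mathbb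 Z}$ is strictly stationary; $Eu_{it}=Eu_{it}f_{kt}=0$ for all $i,k,t$. There are constants $c_1,c_2>0$ such that the eigenvalues of $\Sigma_u$ and of $\mathrm{cov}(f_t)$ lie in $(c_2,c_1)$ and $\max_{j\le N}\|\lambda_j\|<c_1$. There are $r_1,r_2,b_1,b_2>0$ with $P(|u_{it}|>s)\le\exp(-(s/b_1)^{r_1})$ and $P(|f_{kt}|>s)\le\exp(-(s/b_2)^{r_2})$ for all $s>0$ and all $i,k$. There are $r_3,c>0$ such that for every integer $k\ge1$, $\sup|P(A)P(B)-P(A\cap B)|\le\exp(-ck^{r_3})$, the supremum over $A\in\sigma\{(f_t,u_t):t\le0\}$ and $B\in\sigma\{(f_t,u_t):t\ge k\}$. No constant depends on $N$. (A2) The eigenvalues of $\Lambda'\Lambda/N$ are bounded away from $0$ and $\infty$ as $N\to\infty$, and $\max_i\sum_j|(\Sigma_u^{-1})_{ij}|=O(1)$. (A3) $E\big\|\frac1{\sqrt{NT}}\sum_{s\le T}f_s(u_s'Wu_t-Eu_s'Wu_t)\big\|^2=O(1)$ for each $t\ge1$; $E\big\|\frac1{\sqrt{NT}}\sum_{t\le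 T}\sum_{j\le N}\xi_j(u_{jt}u_{it}-Eu_{jt}u_{it})\big\|=O(1)$ for each $i$; $E\big\|\frac1{\sqrt{NT}}\sum_{t\le T}\sum_{j\le N}\xi_ju_{jt}f_{kt}\big\|=O(1)$ for each $k\le r$; and for some $\delta\ge4$, $E\big|\frac1{\sqrt N}(u_s'Wu_t-Eu_s'Wu_t)\big|^\delta$ and $E\big\|\frac1{\sqrt N}\Lambda'Wu_t\big\|^\delta$ are bounded uniformly in $s,t\le T$ and all large sample sizes. (A4) $\Lambda'\Sigma_u^{-1}\Lambda/N$ converges to a matrix $\Sigma_\Lambda$ such that $\Sigma_\Lambda\,\mathrm{cov}(f_t)$ has $r$ distinct eigenvalues; and $(\Lambda'W\Sigma_uW\Lambda)^{-1/2}\Lambda'Wu_t\to\mathcal N(0,I_r)$ in distribution for each $t\ge1$. (A5) $m_N=o\big(\min\{N^{-1/4}(T/\log N)^{(1-q)/2},\,N^{1/4-q/2}\}\big)$, and there is a partition $\{1,\dots,N\}^2=S_L\cup S_U$ with $(i,i)\in S_U$ for all $i$, $\#\{(i,j)\in S_U:i\ne j\}=O(N)$, $\sum_{(i,j)\in S_L}|\Sigma_{u,ij}|=O(1)$,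 $\max_{(i,j)\in S_L}|\Sigma_{u,ij}|=O(\omega_T)$ and $\omega_T=O(\min_{(i,j)\in S_U}|\Sigma_{u,ij}|)$. (A6) For each $t\ge1$ and $k\le r$, the following are $o_p(1)$, with $v_{ij,s}=u_{is}u_{js}-Eu_{is}u_{js}$: $\frac1{T\sqrt N}\sum_{i}\sum_{s}v_{ii,s}\xi_ie_{it}$; $\ \frac1{NT\sqrt N}\sum_{i}\sum_{s}\sum_{j}v_{ij,s}\lambda_j\lambda_i'e_{it}\xi_{ik}$; $\ \frac1{T\sqrt N}\sum_{i\ne j,(i,j)\in S_U}\sum_{s}v_{ij,s}\xi_ie_{jt}$; $\ \frac1{NT\sqrt N}\sum_{i\ne j,(i,j)\in S_U}\sum_{l\le N}\sum_{s}v_{il,s}\xi_{ik}e_{jt}\lambda_l\lambda_j'$. (A7) $\sqrt N\,m_N^2\,\omega_T^{2-2q}=o(1)$, $\ N^{1/(2-2q)}\log N=o(T)$ and $T=o(N^2)$. *Estimators.* Let $\nu_1\ge\nu_2\ge\cdots$ and $\zeta_1,\zeta_2,\dots$ be the eigenvalues and orthonormal eigenvectors of $S_y=T^{-1}\sum_{t\le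 T}Y_tY_t'$, and $R=S_y-\sum_{i\le r}\nu_i\zeta_i\zeta_i'$. For a constant $C>0$ put $\tau_{ij}=C\sqrt{R_{ii}R_{jj}}\,\omega_T$, $\widehat\Sigma_{u,ii}=R_{ii}$ and $\widehat\Sigma_{u,ij}=s_{ij}(R_{ij})$ for $i\ne j$, where $s_{ij}=s_{ji}$ are thresholding functions: $s_{ij}(z)=0$ if $|z|<\tau_{ij}$; $|s_{ij}(z)-z|\le\tau_{ij}$; and, for some constants $a>0,b>1$, $|s_{ij}(z)-z|\le a\tau_{ij}^2$ if $|z|>b\tau_{ij}$. Let the columns of the $T\times r$ matrix $\widehat F^e/\sqrt T=(\widehat f_1^e,\dots,\widehat f_T^e)'/\sqrt T$ be orthonormal eigenvectors for the $r$ largest eigenvalues of $Y'\widehat\Sigma_u^{-1}Y$, let $\widehat\Lambda^e=T^{-1}Y\widehat F^e=(\widehat\lambda_1^e,\dots,\widehat\lambda_N^e)'$, let $\widehat V$ be the diagonal matrix of the $r$ largest eigenvalues of $Y'\widehat\Sigma_u^{-1}Y/(NT)$, and $$H_e=\widehat V^{-1}\widehat F^{e\prime}F\Lambda'\widehat\Sigma_u^{-1}\Lambda/(NT).$$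 *Conclusion.* There is $C_0>0$ such that for every threshold constant $C\ge C_0$, all thresholding functions as above and any choice of the eigenvectors, the $r\times r$ matrix $H_e$ is invertible with probability tending to one and, with $\alpha=\max\{1/r_1,1/r_2\}$, $$\max_{t\le T}\|\widehat f_t^e-H_ef_t\|=O_p\Big(\frac{T^{1/\delta}}{\sqrt N}+(\log T)^\alpha m_N\omega_T^{1-q}\Big),\qquad \max_{j\le N}\|\widehat\lambda_j^e-(H_e')^{-1}\lambda_j\|=O_p\big(m_N\omega_T^{1-q}\big).$$ -/

import Mathlib

open MeasureTheory ProbabilityTheory Filter Topology Matrix Asymptotics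

noncomputable section

namespace WPC

/-! ### Stochastic orders and norms -/

/-- The Euclidean norm of a vector given by its coordinates. -/
def vnorm {k : ℕ} (v : Fin k → ℝ) : ℝ := ‖(WithLp.toLp 2 v : EuclideanSpace ℝ (Fin k))‖

/-- `X n = O_p(g n)` for real-valued `X n`: for every `ε > 0` there is a constant `K` such that
`P(|X n| > K g n) ≤ ε` for all large `n`. (No measurability of `X n` is required: `μ` of a set that
is not measurable is its outer measure.) -/
def IsBigOInProb {Ω : Type*} [MeasurableSpace Ω] (μ : Measure Ω) (X : ℕ → Ω → ℝ) (g : ℕ → ℝ) :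
    Prop :=
  ∀ ε : ℝ, 0 < ε → ∃ K : ℝ, 0 < K ∧ ∀ᶠ n in atTop, μ {ω | K * g n < |X n ω|} ≤ ENNReal.ofReal ε

/-- `X n = o_p(1)`. -/
def IsLittleOOneInProb {Ω : Type*} [MeasurableSpace Ω] (μ : Measure Ω) (X : ℕ → Ω → ℝ) : Prop :=
  TendstoInMeasure μ X atTop (fun _ => 0)

/-! ### The approximate factor model -/

/-- The ingredients of the factor model `Y_t = Λ f_t + u_t` with `r` factors: the factors `f_t`,
and for each cross-sectional dimension `N` the idiosyncratic vectors `u_t` in `ℝ^N` and the `N × r`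
matrix `Λ` whose rows are the loadings `λ_1', …, λ_N'`. -/
structure FactorModel (Ω : Type*) [MeasurableSpace Ω] (r : ℕ) where
  f : ℤ → Ω → Fin r → ℝ
  u : (N : ℕ) → ℤ → Ω → Fin N → ℝ
  Λ : (N : ℕ) → Matrix (Fin N) (Fin r) ℝ
  measurable_f : ∀ t, Measurable (f t)
  measurable_u : ∀ N t, Measurable (u N t)

/-- The calendar time of the observation with index `s : Fin T`; the sample is `t = 1, …, T`. -/
def time {T : ℕ} (s : Fin T) : ℤ := (s : ℤ) + 1

namespace FactorModel

variable {Ω : Type*} [MeasurableSpace Ω] {r : ℕ}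

/-- The `N × T` data matrix `Y = (Y_1, …, Y_T)`, `y_{it} = λ_i' f_t + u_{it}`. -/
def Y (M : FactorModel Ω r) (N T : ℕ) (ω : Ω) : Matrix (Fin N) (Fin T) ℝ :=
  Matrix.of fun i t => M.Λ N i ⬝ᵥ M.f (time t) ω + M.u N (time t) ω i

/-- The `T × r` matrix `F = (f_1, …, f_T)'`. -/
def F (M : FactorModel Ω r) (T : ℕ) (ω : Ω) : Matrix (Fin T) (Fin r) ℝ :=
  Matrix.of fun t k => M.f (time t) ω k

/-- `Σ_u = cov(u_t)` (which does not depend on `t` by stationarity). -/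
def covU (M : FactorModel Ω r) (μ : Measure Ω) (N : ℕ) : Matrix (Fin N) (Fin N) ℝ :=
  Matrix.of fun i j => cov[fun ω => M.u N 1 ω i, fun ω => M.u N 1 ω j; μ]

/-- `cov(f_t)`. -/
def covF (M : FactorModel Ω r) (μ : Measure Ω) : Matrix (Fin r) (Fin r) ℝ :=
  Matrix.of fun i j => cov[fun ω => M.f 1 ω i, fun ω => M.f 1 ω j; μ]

/-- The σ-algebra generated by `{(f_t, u_t) : t ≤ 0}`. -/
abbrev past (M : FactorModel Ω r) (N : ℕ) : MeasurableSpace Ω :=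
  ⨆ t : {t : ℤ // t ≤ 0},
    MeasurableSpace.comap (fun ω => (M.f t ω, M.u N t ω)) inferInstance

/-- The σ-algebra generated by `{(f_t, u_t) : t ≥ k}`. -/
abbrev future (M : FactorModel Ω r) (N k : ℕ) : MeasurableSpace Ω :=
  ⨆ t : {t : ℤ // (k : ℤ) ≤ t},
    MeasurableSpace.comap (fun ω => (M.f t ω, M.u N t ω)) inferInstance

/-- The strong mixing coefficient
`α(k) = sup {|P(A) P(B) - P(A ∩ B)| : A in the past up to 0, B in the future from k}`. -/
def mixingCoeff (M : FactorModel Ω r) (μ : Measure Ω) (N k : ℕ) : ℝ :=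
  sSup {x : ℝ | ∃ A B : Set Ω, MeasurableSet[M.past N] A ∧ MeasurableSet[M.future N k] B ∧
    x = |μ.real A * μ.real B - μ.real (A ∩ B)|}

/-- `u_{is} u_{jt} - E u_{is} u_{jt}`. -/
def uuc (M : FactorModel Ω r) (μ : Measure Ω) (N : ℕ) (i : Fin N) (s : ℤ) (j : Fin N) (t : ℤ)
    (ω : Ω) : ℝ :=
  M.u N s ω i * M.u N t ω j - ∫ ω', M.u N s ω' i * M.u N t ω' j ∂μ

/-- `u_s' W u_t - E u_s' W u_t`. -/
def uWuc (M : FactorModel Ω r) (μ : Measure Ω) (N : ℕ) (W : Matrix (Fin N) (Fin N) ℝ) (s t : ℤ)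
    (ω : Ω) : ℝ :=
  M.u N s ω ⬝ᵥ (W *ᵥ M.u N t ω) - ∫ ω', M.u N s ω' ⬝ᵥ (W *ᵥ M.u N t ω') ∂μ

/-- The vectors `d_1, …, d_N` of `ℝ^r` with `Λ' W = (d_1, …, d_N)`. -/
def d (M : FactorModel Ω r) (N : ℕ) (W : Matrix (Fin N) (Fin N) ℝ) (j : Fin N) : Fin r → ℝ :=
  fun k => ((M.Λ N)ᵀ * W) k j

/-! ### Assumptions on the data generating process -/

/-- Stationarity and orthogonality, bounded second moments and loadings, exponential tails with
exponents `r₁` (for `u`) and `r₂` (for `f`), and strong mixing at an exponential rate. The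
constants do not depend on `N`. -/
structure Regular (M : FactorModel Ω r) (μ : Measure Ω) (r₁ r₂ : ℝ) : Prop where
  stationary : ∀ N, IdentDistrib (fun ω (t : ℤ) => (M.f t ω, M.u N t ω))
    (fun ω (t : ℤ) => (M.f (t + 1) ω, M.u N (t + 1) ω)) μ μ
  mean_u : ∀ N t i, ∫ ω, M.u N t ω i ∂μ = 0
  mean_uf : ∀ N t i k, ∫ ω, M.u N t ω i * M.f t ω k ∂μ = 0
  bounds : ∃ c₁ c₂ : ℝ, 0 < c₁ ∧ 0 < c₂ ∧
    (∀ N, ∀ κ ∈ spectrum ℝ (M.covU μ N), c₂ < κ ∧ κ < c₁) ∧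
    (∀ N j, vnorm (M.Λ N j) < c₁) ∧
    (∀ κ ∈ spectrum ℝ (M.covF μ), c₂ < κ ∧ κ < c₁)
  r₁_pos : 0 < r₁
  r₂_pos : 0 < r₂
  tails : ∃ b₁ b₂ : ℝ, 0 < b₁ ∧ 0 < b₂ ∧ ∀ s : ℝ, 0 < s →
    (∀ N t i, μ.real {ω | s < |M.u N t ω i|} ≤ Real.exp (-(s / b₁) ^ r₁)) ∧
    (∀ t k, μ.real {ω | s < |M.f t ω k|} ≤ Real.exp (-(s / b₂) ^ r₂))
  mixing : ∃ r₃ C : ℝ, 0 < r₃ ∧ 0 < C ∧ ∀ N k : ℕ, 1 ≤ k →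
    M.mixingCoeff μ N k ≤ Real.exp (-C * (k : ℝ) ^ r₃)

/-- Pervasive factors: the eigenvalues of `Λ'Λ/N` are bounded away from zero and infinity as
`N → ∞`. -/
def Pervasive (M : FactorModel Ω r) : Prop :=
  ∃ c C : ℝ, 0 < c ∧ ∀ᶠ N : ℕ in atTop,
    ∀ κ ∈ spectrum ℝ ((N : ℝ)⁻¹ • ((M.Λ N)ᵀ * M.Λ N)), c ≤ κ ∧ κ ≤ C

/-- Bounded row sums of the weight matrix, `‖W‖₁ = O(1)`. -/
def BoundedRowSums (W : (N : ℕ) → Matrix (Fin N) (Fin N) ℝ) : Prop :=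
  ∃ K : ℝ, ∀ᶠ N : ℕ in atTop, ∀ i : Fin N, ∑ j, |W N i j| ≤ K

/-- Moment bounds for the weight matrix `W` along the sample sizes `(N n, T n)`, with exponent
`δ ≥ 4`. -/
structure MomentBounds (M : FactorModel Ω r) (μ : Measure Ω)
    (W : (N : ℕ) → Matrix (Fin N) (Fin N) ℝ) (N T : ℕ → ℕ) (δ : ℝ) : Prop where
  fuu : ∀ t : ℤ, 1 ≤ t → ∃ K : ℝ, ∀ᶠ n in atTop,
    ∫ ω, vnorm ((√((N n : ℝ) * T n))⁻¹ • ∑ s : Fin (T n),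
      M.uWuc μ (N n) (W (N n)) (time s) t ω • M.f (time s) ω) ^ 2 ∂μ ≤ K
  duu : ∀ i : ℕ, ∃ K : ℝ, ∀ᶠ n in atTop, ∀ hi : i < N n,
    ∫ ω, vnorm ((√((N n : ℝ) * T n))⁻¹ • ∑ t : Fin (T n), ∑ j : Fin (N n),
      M.uuc μ (N n) j (time t) ⟨i, hi⟩ (time t) ω • M.d (N n) (W (N n)) j) ∂μ ≤ K
  duf : ∀ k : Fin r, ∃ K : ℝ, ∀ᶠ n in atTop,
    ∫ ω, vnorm ((√((N n : ℝ) * T n))⁻¹ • ∑ t : Fin (T n), ∑ j : Fin (N n),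
      (M.u (N n) (time t) ω j * M.f (time t) ω k) • M.d (N n) (W (N n)) j) ∂μ ≤ K
  four_le : 4 ≤ δ
  delta : ∃ K : ℝ, ∀ᶠ n in atTop, ∀ s t : Fin (T n),
    ∫ ω, |(√(N n : ℝ))⁻¹ * M.uWuc μ (N n) (W (N n)) (time s) (time t) ω| ^ δ ∂μ < K ∧
    ∫ ω, vnorm ((√(N n : ℝ))⁻¹ • (((M.Λ (N n))ᵀ * W (N n)) *ᵥ M.u (N n) (time t) ω)) ^ δ ∂μ < K

/-- `Λ'WΛ/N` has a limit `Σ_Λ` such that the `r` eigenvalues of `Σ_Λ cov(f_t)` are distinct. -/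
def LoadingLimit (M : FactorModel Ω r) (μ : Measure Ω)
    (W : (N : ℕ) → Matrix (Fin N) (Fin N) ℝ) : Prop :=
  ∃ L : Matrix (Fin r) (Fin r) ℝ,
    Tendsto (fun N : ℕ => (N : ℝ)⁻¹ • ((M.Λ N)ᵀ * W N * M.Λ N)) atTop (𝓝 L) ∧
    (spectrum ℝ (L * M.covF μ)).ncard = r

open scoped MatrixOrder in
/-- `A^{-1/2}`, for a positive definite matrix `A`. -/
def invSqrt {k : ℕ} (A : Matrix (Fin k) (Fin k) ℝ) : Matrix (Fin k) (Fin k) ℝ := (CFC.sqrt A)⁻¹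

/-- The cross-sectional central limit theorem
`(Λ'W Σ_u W Λ)^{-1/2} Λ' W u_t → N(0, I_r)` in distribution, for each `t ≥ 1`. -/
def CrossSectionalCLT (M : FactorModel Ω r) (μ : Measure Ω) [IsProbabilityMeasure μ]
    (W : (N : ℕ) → Matrix (Fin N) (Fin N) ℝ) : Prop :=
  ∀ t : ℤ, 1 ≤ t → TendstoInDistribution
    (fun (N : ℕ) ω => (WithLp.toLp 2 ((invSqrt ((M.Λ N)ᵀ * W N * M.covU μ N * W N * M.Λ N) *
      (M.Λ N)ᵀ * W N) *ᵥ M.u N t ω) : EuclideanSpace ℝ (Fin r)))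
    atTop (fun x : EuclideanSpace ℝ (Fin r) => x) (fun _ => μ)
    (stdGaussian (EuclideanSpace ℝ (Fin r)))

/-- The sparsity level `m_N = max_i ∑_j |Σ_{u,ij}|^q`, where for `q = 0` the summand is the
indicator of `Σ_{u,ij} ≠ 0`. -/
def m (M : FactorModel Ω r) (μ : Measure Ω) (q : ℝ) (N : ℕ) : ℝ :=
  ⨆ i : Fin N, ∑ j : Fin N,
    if q = 0 then (if M.covU μ N i j = 0 then 0 else 1) else |M.covU μ N i j| ^ q

end FactorModel

/-- `ω_T = √(log N / T) + 1/√N`. -/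
def rate (N T : ℕ) : ℝ := √(Real.log N / T) + 1 / √(N : ℝ)

namespace FactorModel

variable {Ω : Type*} [MeasurableSpace Ω] {r : ℕ}

/-- Conditional sparsity of `Σ_u` with exponent `q`, along the sample sizes `(N n, T n)`. The set
`S n` holds the indices of the large entries, its complement those of the small entries. -/
structure ConditionallySparse (M : FactorModel Ω r) (μ : Measure Ω) (N T : ℕ → ℕ) (q : ℝ)
    (S : (n : ℕ) → Finset (Fin (N n) × Fin (N n))) : Prop where
  q_nonneg : 0 ≤ q
  q_lt : q < 1 / 2
  m_small : (fun n => M.m μ q (N n)) =o[atTop] (fun n =>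
    min (1 / (N n : ℝ) ^ (1 / 4 : ℝ) * ((T n : ℝ) / Real.log (N n)) ^ ((1 - q) / 2))
      ((N n : ℝ) ^ (1 / 4 - q / 2)))
  diag_mem : ∀ n i, (i, i) ∈ S n
  card_large : (fun n => (((S n).filter fun p => p.1 ≠ p.2).card : ℝ)) =O[atTop]
    (fun n => (N n : ℝ))
  sum_small : (fun n => ∑ p ∈ (S n)ᶜ, |M.covU μ (N n) p.1 p.2|) =O[atTop] (fun _ => (1 : ℝ))
  max_small : ∃ K : ℝ, ∀ᶠ n in atTop, ∀ p ∈ (S n)ᶜ, |M.covU μ (N n) p.1 p.2| ≤ K * rate (N n) (T n)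
  min_large : ∃ K : ℝ, ∀ᶠ n in atTop, ∀ p ∈ S n, rate (N n) (T n) ≤ K * |M.covU μ (N n) p.1 p.2|

/-- The averages of `u_{is} u_{js} - E u_{is} u_{js}` with weights built from the loadings,
`ξ_i = ` the `i`-th column of `Λ' Σ_u^{-1}` and `e_t = Σ_u^{-1} u_t` are negligible, for each
`t ≥ 1`. Vectors and matrices of fixed dimension are `o_p(1)` when their entries are. -/
structure WeightedAverages (M : FactorModel Ω r) (μ : Measure Ω) (N T : ℕ → ℕ)
    (S : (n : ℕ) → Finset (Fin (N n) × Fin (N n))) : Prop where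
  diag : ∀ t : ℤ, 1 ≤ t → ∀ k : Fin r, IsLittleOOneInProb μ fun n ω =>
    1 / (T n * √(N n : ℝ)) * ∑ i : Fin (N n), ∑ s : Fin (T n),
      M.uuc μ (N n) i (time s) i (time s) ω * M.d (N n) (M.covU μ (N n))⁻¹ i k *
        ((M.covU μ (N n))⁻¹ *ᵥ M.u (N n) t ω) i
  diag_loading : ∀ t : ℤ, 1 ≤ t → ∀ k a b : Fin r, IsLittleOOneInProb μ fun n ω =>
    1 / (N n * T n * √(N n : ℝ)) * ∑ i : Fin (N n), ∑ s : Fin (T n), ∑ j : Fin (N n),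
      M.uuc μ (N n) j (time s) i (time s) ω * (M.Λ (N n) j a * M.Λ (N n) i b) *
        ((M.covU μ (N n))⁻¹ *ᵥ M.u (N n) t ω) i * M.d (N n) (M.covU μ (N n))⁻¹ i k
  offdiag : ∀ t : ℤ, 1 ≤ t → ∀ k : Fin r, IsLittleOOneInProb μ fun n ω =>
    1 / (T n * √(N n : ℝ)) * ∑ p ∈ (S n).filter (fun p => p.1 ≠ p.2), ∑ s : Fin (T n),
      M.uuc μ (N n) p.1 (time s) p.2 (time s) ω * M.d (N n) (M.covU μ (N n))⁻¹ p.1 k *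
        ((M.covU μ (N n))⁻¹ *ᵥ M.u (N n) t ω) p.2
  offdiag_loading : ∀ t : ℤ, 1 ≤ t → ∀ k a b : Fin r, IsLittleOOneInProb μ fun n ω =>
    1 / (N n * T n * √(N n : ℝ)) * ∑ p ∈ (S n).filter (fun p => p.1 ≠ p.2),
      ∑ v : Fin (N n), ∑ s : Fin (T n),
      M.uuc μ (N n) p.1 (time s) v (time s) ω * M.d (N n) (M.covU μ (N n))⁻¹ p.1 k *
        ((M.covU μ (N n))⁻¹ *ᵥ M.u (N n) t ω) p.2 * (M.Λ (N n) v a * M.Λ (N n) p.2 b)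

end FactorModel

/-! ### The estimators -/

/-- The columns of `V` are orthonormal eigenvectors of the symmetric matrix `A` for its `r` largest
eigenvalues (with multiplicity) `ν 0 ≥ ν 1 ≥ …`: every eigenvector orthogonal to the
columns of `V` belongs to an eigenvalue that is at most each `ν k`. -/
structure IsLeadingEigensystem {k r : ℕ} (A : Matrix (Fin k) (Fin k) ℝ) (ν : Fin r → ℝ)
    (V : Matrix (Fin k) (Fin r) ℝ) : Prop where
  orthonormal : Vᵀ * V = 1
  eigen : A * V = V * Matrix.diagonal ν
  sorted : Antitone ν
  largest : ∀ (κ : ℝ) (x : Fin k → ℝ), x ≠ 0 → A *ᵥ x = κ • x → Vᵀ *ᵥ x = 0 → ∀ l, κ ≤ ν l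

/-- A generalized thresholding function; `s τ z` is the value at `z` for the threshold `τ`. -/
def IsThresholding (a b : ℝ) (s : ℝ → ℝ → ℝ) : Prop :=
  ∀ τ z : ℝ, 0 ≤ τ → (|z| < τ → s τ z = 0) ∧ |s τ z - z| ≤ τ ∧
    (b * τ < |z| → |s τ z - z| ≤ a * τ ^ 2)

/-- The sample covariance matrix `S_y = T⁻¹ ∑_t Y_t Y_t'`. -/
def sampleCov {N T : ℕ} (Y : Matrix (Fin N) (Fin T) ℝ) : Matrix (Fin N) (Fin N) ℝ :=
  (T : ℝ)⁻¹ • (Y * Yᵀ)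

/-- `R = S_y - ∑_{i ≤ r} ν_i ξ_i ξ_i'`, where the `ξ_i` are the columns of `Ξ`. -/
def residualCov {N T r : ℕ} (Y : Matrix (Fin N) (Fin T) ℝ) (ν : Fin r → ℝ)
    (Ξ : Matrix (Fin N) (Fin r) ℝ) : Matrix (Fin N) (Fin N) ℝ :=
  sampleCov Y - ∑ i : Fin r, ν i • Matrix.vecMulVec (fun a => Ξ a i) (fun a => Ξ a i)

/-- The thresholded covariance estimator obtained from `R`: the diagonal is kept, and the entry
`(i, j)` is thresholded at `τ_{ij} = C √(R_ii R_jj) ω_T`, where `w = ω_T`. -/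
def thresholdCov {N : ℕ} (C w : ℝ) (s : Fin N → Fin N → ℝ → ℝ → ℝ)
    (R : Matrix (Fin N) (Fin N) ℝ) : Matrix (Fin N) (Fin N) ℝ :=
  Matrix.of fun i j => if i = j then R i i else s i j (C * √(R i i * R j j) * w) (R i j)

/-- The estimated loadings `Λ̂ = T⁻¹ Y F̂`, whose `j`-th row is `λ̂_j'`. -/
def loadingEst {N T r : ℕ} (Y : Matrix (Fin N) (Fin T) ℝ) (Fhat : Matrix (Fin T) (Fin r) ℝ) :
    Matrix (Fin N) (Fin r) ℝ :=
  (T : ℝ)⁻¹ • (Y * Fhat)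

/-- The rotation matrix `H = V̂⁻¹ F̂' F Λ' W Λ / (N T)`, where `V̂` is the diagonal matrix of the `r`
largest eigenvalues of `Y' W Y / (N T)`, and `v` lists those of `Y' W Y`. -/
def rotationMatrix {N T r : ℕ} (v : Fin r → ℝ) (Fhat F : Matrix (Fin T) (Fin r) ℝ)
    (Λ : Matrix (Fin N) (Fin r) ℝ) (W : Matrix (Fin N) (Fin N) ℝ) : Matrix (Fin r) (Fin r) ℝ :=
  (Matrix.diagonal fun k => v k / ((N : ℝ) * T))⁻¹ *
    (((N : ℝ) * T)⁻¹ • (Fhatᵀ * F * Λᵀ * W * Λ))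

end WPC

end

open WPC

/-! Write Y = ΛF' + U, ε = √(log N / T), w = ε + 1/√N = ω_T and ρ = m_N w^(1-q). The argument splits
into linear algebra, valid on every sample that satisfies the inequalities `SampleBounds` and
`ScoreBounds`, and probability, which shows that such samples have probability close to one.

Linear algebra, first step. The leading eigenvalues of S_y are at least of order N, so the
eigenvector equation divided by them reads Ξ = ΛA + E, where A is invertible of order 1/√N and the
rows of E are of order w/√N. Hence the column space of Ξ reproduces every row of Λ up to O(w), and R
agrees with Σ_u up to O(w) in each entry (`residualCov_close`). Under sparsity, thresholding turns
this into an error O(ρ) in absolute row sums (`thresholdCov_close`), and inversion preserves that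
order (`weightBounds_of_close`).

Linear algebra, second step. With Ŵ the inverse of Σ̂_u, H is defined so that the pure signal part
of the second eigenvector equation is exactly FH'. The rest of F̂ is built from U'ŴΛ and U'ŴU
(`factorEst_sub_eq`). Replacing Ŵ by W = Σ_u⁻¹ costs ρ times the largest |u_it| in a single row, and
the largest ‖f_t‖ enters in the same way; these give the power of log T. With W itself only δ-th
moments are available, and a maximum over T of them costs T^(1/δ). Averaged over t neither loss
occurs (`factorEst_sub_le`). Since F̂'F̂ = T·1, smallness of F̂ - FH' forces H to be invertible
(`isUnit_rotation_of_close`), so no limit of H has to be identified, and the loadings inherit the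
averaged rate (`loadingEst_sub_le`).

Probability. The entries of UU'/T, UF/T and F'F/T concentrate at rate √(log T / T) by an exponential
inequality for mixing sequences: truncate, sum over alternate blocks of length about T^(1/16), and
compare conditional with unconditional means of the block exponentials (`measure_prod_ge_le`,
`exists_concentration`). The failure probability T⁻⁶ survives a union over all pairs of coordinates
because N ≤ T² eventually. The weighted scores are handled by Markov's inequality and the
summability of autocovariances (`FactorModel.Regular.exists_scoreBounds`). The growth conditions
also give ρ → 0, which makes all smallness requirements of the linear algebra hold eventually. -/

namespace WPC

/-! ### Euclidean and Frobenius norms, and Schur's test -/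

section MatrixNorms

open scoped Matrix.Norms.Frobenius

variable {a b c : ℕ}

theorem vnorm_sq (v : Fin a → ℝ) : vnorm v ^ 2 = ∑ i, v i ^ 2 := by
  simp [vnorm, EuclideanSpace.norm_sq_eq]

theorem vnorm_sq_eq_dotProduct (v : Fin a → ℝ) : vnorm v ^ 2 = v ⬝ᵥ v := by
  rw [vnorm_sq]; simp [dotProduct, sq]

theorem vnorm_nonneg (v : Fin a → ℝ) : 0 ≤ vnorm v := norm_nonneg _

theorem vnorm_add_le (v w : Fin a → ℝ) : vnorm (v + w) ≤ vnorm v + vnorm w :=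
  norm_add_le (WithLp.toLp 2 v : EuclideanSpace ℝ (Fin a)) (WithLp.toLp 2 w)

theorem vnorm_sub_le (v w : Fin a → ℝ) : vnorm (v - w) ≤ vnorm v + vnorm w :=
  norm_sub_le (WithLp.toLp 2 v : EuclideanSpace ℝ (Fin a)) (WithLp.toLp 2 w)

theorem vnorm_neg (v : Fin a → ℝ) : vnorm (-v) = vnorm v :=
  norm_neg (WithLp.toLp 2 v : EuclideanSpace ℝ (Fin a))

theorem vnorm_smul (x : ℝ) (v : Fin a → ℝ) : vnorm (x • v) = |x| * vnorm v :=
  norm_smul x (WithLp.toLp 2 v : EuclideanSpace ℝ (Fin a))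

theorem vnorm_eq_zero {v : Fin a → ℝ} : vnorm v = 0 ↔ v = 0 := by
  simp [vnorm]

theorem vnorm_zero : vnorm (0 : Fin a → ℝ) = 0 := vnorm_eq_zero.2 rfl

theorem abs_dotProduct_le (v w : Fin a → ℝ) : |v ⬝ᵥ w| ≤ vnorm v * vnorm w := by
  have h := abs_real_inner_le_norm (WithLp.toLp 2 v : EuclideanSpace ℝ (Fin a)) (WithLp.toLp 2 w)
  have e : inner ℝ (WithLp.toLp 2 v : EuclideanSpace ℝ (Fin a)) (WithLp.toLp 2 w) = v ⬝ᵥ w := by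
    simp [PiLp.inner_apply, dotProduct, mul_comm]
  rwa [e] at h

theorem abs_le_vnorm (v : Fin a → ℝ) (i : Fin a) : |v i| ≤ vnorm v := by
  have := PiLp.norm_apply_le (WithLp.toLp 2 v : EuclideanSpace ℝ (Fin a)) i
  simpa [vnorm] using this

theorem vnorm_le_of_abs_le {v : Fin a → ℝ} {K : ℝ} (hK : 0 ≤ K) (h : ∀ i, |v i| ≤ K) :
    vnorm v ≤ √a * K := by
  apply le_of_sq_le_sq _ (by positivity)
  rw [vnorm_sq, mul_pow, Real.sq_sqrt (by positivity)]
  calc ∑ i, v i ^ 2 ≤ ∑ _i : Fin a, K ^ 2 :=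
        Finset.sum_le_sum fun i _ => by rw [← sq_abs]; gcongr; exact h i
    _ = _ := by simp

theorem frob_sq (A : Matrix (Fin a) (Fin b) ℝ) : ‖A‖ ^ 2 = ∑ i, vnorm (A i) ^ 2 := by
  rw [frobenius_norm_def, ← Real.sqrt_eq_rpow, Real.sq_sqrt (by positivity)]
  simp [vnorm_sq]

theorem frob_sq_sum (A : Matrix (Fin a) (Fin b) ℝ) : ‖A‖ ^ 2 = ∑ i, ∑ j, A i j ^ 2 := by
  simp [frob_sq, vnorm_sq]

theorem frob_sq_cols (A : Matrix (Fin a) (Fin b) ℝ) : ‖A‖ ^ 2 = ∑ j, vnorm (fun i => A i j) ^ 2 := by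
  rw [frob_sq_sum, Finset.sum_comm]; simp [vnorm_sq]

theorem vnorm_row_le (A : Matrix (Fin a) (Fin b) ℝ) (i : Fin a) : vnorm (A i) ≤ ‖A‖ := by
  apply le_of_sq_le_sq _ (norm_nonneg _)
  rw [frob_sq]
  exact Finset.single_le_sum (f := fun i => vnorm (A i) ^ 2) (fun _ _ => sq_nonneg _)
    (Finset.mem_univ i)

theorem abs_entry_le (A : Matrix (Fin a) (Fin b) ℝ) (i : Fin a) (j : Fin b) : |A i j| ≤ ‖A‖ :=
  (abs_le_vnorm (A i) j).trans (vnorm_row_le A i)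

theorem vnorm_mulVec_le (A : Matrix (Fin a) (Fin b) ℝ) (x : Fin b → ℝ) :
    vnorm (A *ᵥ x) ≤ ‖A‖ * vnorm x := by
  apply le_of_sq_le_sq _ (mul_nonneg (norm_nonneg _) (vnorm_nonneg _))
  rw [mul_pow, frob_sq, vnorm_sq, Finset.sum_mul]
  refine Finset.sum_le_sum fun i _ => ?_
  rw [← mul_pow, ← sq_abs]
  gcongr
  exact abs_dotProduct_le _ _

theorem vnorm_vecMul_le (x : Fin a → ℝ) (A : Matrix (Fin a) (Fin b) ℝ) :
    vnorm (x ᵥ* A) ≤ vnorm x * ‖A‖ := by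
  rw [← mulVec_transpose, mul_comm, ← frobenius_norm_transpose A]
  exact vnorm_mulVec_le _ _

theorem vnorm_mul_row_le (A : Matrix (Fin a) (Fin b) ℝ) (B : Matrix (Fin b) (Fin c) ℝ)
    (i : Fin a) : vnorm ((A * B) i) ≤ vnorm (A i) * ‖B‖ := by
  rw [mul_apply_eq_vecMul]; exact vnorm_vecMul_le _ _

theorem frob_le_of_rows {A : Matrix (Fin a) (Fin b) ℝ} {K : ℝ} (hK : 0 ≤ K)
    (h : ∀ i, vnorm (A i) ≤ K) : ‖A‖ ≤ √a * K := by
  apply le_of_sq_le_sq _ (by positivity)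
  rw [frob_sq, mul_pow, Real.sq_sqrt (by positivity)]
  calc ∑ i, vnorm (A i) ^ 2 ≤ ∑ _i : Fin a, K ^ 2 :=
        Finset.sum_le_sum fun i _ => by gcongr; exacts [vnorm_nonneg _, h i]
    _ = _ := by simp

/-- Passing from the operator norm to the Frobenius norm costs the square root of the number of
columns, which is harmless for the fixed number `r` of factors. -/
theorem frob_le_of_mulVec {A : Matrix (Fin a) (Fin b) ℝ} {K : ℝ} (hK : 0 ≤ K)
    (h : ∀ x, vnorm (A *ᵥ x) ≤ K * vnorm x) : ‖A‖ ≤ √b * K := by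
  rw [← frobenius_norm_transpose]
  refine frob_le_of_rows hK fun j => ?_
  have := h (Pi.single j 1)
  have e : vnorm (Pi.single j 1 : Fin b → ℝ) = 1 := by
    have : vnorm (Pi.single j 1 : Fin b → ℝ) ^ 2 = 1 := by
      rw [vnorm_sq_eq_dotProduct]; simp
    nlinarith [vnorm_nonneg (Pi.single j 1 : Fin b → ℝ)]
  rw [e, mul_one, mulVec_single_one] at this
  exact this

theorem frob_le_of_entries {A : Matrix (Fin a) (Fin b) ℝ} {K : ℝ} (hK : 0 ≤ K)
    (h : ∀ i j, |A i j| ≤ K) : ‖A‖ ≤ √a * (√b * K) :=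
  frob_le_of_rows (by positivity) fun i => vnorm_le_of_abs_le hK (h i)

theorem frob_of_orthonormal {V : Matrix (Fin a) (Fin b) ℝ} (h : Vᵀ * V = 1) : ‖V‖ = √b := by
  rw [eq_comm, Real.sqrt_eq_iff_mul_self_eq (by positivity) (norm_nonneg _), ← sq, frob_sq_cols]
  have : ∀ j, vnorm (fun i => V i j) ^ 2 = 1 := fun j => by
    have := congrFun (congrFun h j) j
    rw [vnorm_sq_eq_dotProduct]
    simpa [Matrix.mul_apply, dotProduct] using this
  simp [this]

/-- Schur's test: a matrix whose absolute row and column sums are at most `ρ` is bounded by `ρ` on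
Euclidean space. -/
theorem vnorm_mulVec_le_of_sums {E : Matrix (Fin a) (Fin b) ℝ} {ρ : ℝ} (hρ : 0 ≤ ρ)
    (hr : ∀ i, ∑ j, |E i j| ≤ ρ) (hc : ∀ j, ∑ i, |E i j| ≤ ρ) (x : Fin b → ℝ) :
    vnorm (E *ᵥ x) ≤ ρ * vnorm x := by
  apply le_of_sq_le_sq _ (mul_nonneg hρ (vnorm_nonneg _))
  rw [mul_pow, vnorm_sq, vnorm_sq]
  have h1 : ∀ i, (E *ᵥ x) i ^ 2 ≤ ρ * ∑ j, |E i j| * x j ^ 2 := fun i => by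
    have h2 : |(E *ᵥ x) i| ≤ ∑ j, |E i j| * |x j| := by
      rw [mulVec, dotProduct]
      refine (Finset.abs_sum_le_sum_abs _ _).trans_eq ?_
      simp [abs_mul]
    -- Cauchy–Schwarz with |E i j| |x j| split as √|E i j| times √|E i j| |x j|; the squares of the
    -- first factors sum to at most ρ.
    have h3 := Finset.sum_sq_le_sum_mul_sum_of_sq_le_mul Finset.univ
      (r := fun j => |E i j| * |x j|) (f := fun j => |E i j|) (g := fun j => |E i j| * x j ^ 2)
      (fun j _ => by positivity) (fun j _ => by positivity)
      (fun j _ => by simp only [mul_pow, sq_abs]; rw [← sq_abs (E i j)]; apply le_of_eq; ring)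
    calc (E *ᵥ x) i ^ 2 = |(E *ᵥ x) i| ^ 2 := (sq_abs _).symm
      _ ≤ (∑ j, |E i j| * |x j|) ^ 2 := by gcongr
      _ ≤ _ := h3
      _ ≤ _ := by
        gcongr
        exact hr i
  calc ∑ i, (E *ᵥ x) i ^ 2 ≤ ∑ i, ρ * ∑ j, |E i j| * x j ^ 2 := Finset.sum_le_sum fun i _ => h1 i
    _ = ρ * ∑ j, (∑ i, |E i j|) * x j ^ 2 := by
      rw [← Finset.mul_sum, Finset.sum_comm]; simp [Finset.sum_mul]
    _ ≤ ρ * ∑ j, ρ * x j ^ 2 := by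
      gcongr with j _
      exact hc j
    _ = _ := by rw [← Finset.mul_sum]; ring

/-- Schur's test column by column. The Frobenius norm of `E` can exceed ρ by a factor of order √N,
so submultiplicativity would be too weak. -/
theorem frob_mul_le_of_sums {E : Matrix (Fin a) (Fin b) ℝ} {ρ : ℝ} (hρ : 0 ≤ ρ)
    (hr : ∀ i, ∑ j, |E i j| ≤ ρ) (hc : ∀ j, ∑ i, |E i j| ≤ ρ) (X : Matrix (Fin b) (Fin c) ℝ) :
    ‖E * X‖ ≤ ρ * ‖X‖ := by
  apply le_of_sq_le_sq _ (mul_nonneg hρ (norm_nonneg _))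
  rw [mul_pow, frob_sq_cols, frob_sq_cols, Finset.mul_sum]
  refine Finset.sum_le_sum fun k _ => ?_
  rw [← mul_pow]
  gcongr
  · exact vnorm_nonneg _
  · exact vnorm_mulVec_le_of_sums hρ hr hc (fun j => X j k)

end MatrixNorms

/-! ### Rayleigh quotients and positive matrices -/

section QuadraticForms

variable {k r : ℕ}

theorem dotProduct_mulVec_symm {A : Matrix (Fin k) (Fin k) ℝ} (hA : Aᵀ = A) (x y : Fin k → ℝ) :
    x ⬝ᵥ (A *ᵥ y) = y ⬝ᵥ (A *ᵥ x) := by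
  rw [dotProduct_mulVec, ← mulVec_transpose, hA, dotProduct_comm]

/-- `A - c` has nonnegative eigenvalues, hence is positive semidefinite. The hypothesis speaks of
eigenpairs because that is the form of `IsLeadingEigensystem.largest`. -/
theorem quadForm_ge_of_eigenvalues {A : Matrix (Fin k) (Fin k) ℝ} (hA : Aᵀ = A) {c : ℝ}
    (h : ∀ (κ : ℝ) (x : Fin k → ℝ), x ≠ 0 → A *ᵥ x = κ • x → c ≤ κ) (x : Fin k → ℝ) :
    c * (x ⬝ᵥ x) ≤ x ⬝ᵥ (A *ᵥ x) := by
  have hB : (A - c • (1 : Matrix (Fin k) (Fin k) ℝ)).IsHermitian := by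
    simp [IsHermitian, hA]
  have hp : (A - c • (1 : Matrix (Fin k) (Fin k) ℝ)).PosSemidef := by
    rw [hB.posSemidef_iff_eigenvalues_nonneg]
    intro i
    have h1 := hB.mulVec_eigenvectorBasis i
    have h2 : ((hB.eigenvectorBasis i : EuclideanSpace ℝ (Fin k)) : Fin k → ℝ) ≠ 0 := by
      intro h0
      have := hB.eigenvectorBasis.orthonormal.ne_zero i
      exact this (by ext j; exact congrFun h0 j)
    have h3 := h (hB.eigenvalues i + c) _ h2 (by
      rw [sub_mulVec, sub_eq_iff_eq_add, smul_mulVec, one_mulVec] at h1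
      rw [h1, add_smul])
    show 0 ≤ hB.eigenvalues i
    linarith
  have := hp.dotProduct_mulVec_nonneg x
  simp only [star_trivial, sub_mulVec, smul_mulVec, one_mulVec, dotProduct_sub,
    dotProduct_smul, smul_eq_mul] at this
  linarith

theorem quadForm_le_of_eigenvalues {A : Matrix (Fin k) (Fin k) ℝ} (hA : Aᵀ = A) {c : ℝ}
    (h : ∀ (κ : ℝ) (x : Fin k → ℝ), x ≠ 0 → A *ᵥ x = κ • x → κ ≤ c) (x : Fin k → ℝ) :
    x ⬝ᵥ (A *ᵥ x) ≤ c * (x ⬝ᵥ x) := by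
  have := quadForm_ge_of_eigenvalues (A := -A) (c := -c) (by simp [hA]) (fun κ y hy hAy => by
    have := h (-κ) y hy (by rw [neg_mulVec] at hAy; rw [neg_smul, ← hAy, neg_neg])
    linarith) x
  simp only [neg_mulVec, dotProduct_neg] at this
  linarith

theorem mem_spectrum_of_mulVec {A : Matrix (Fin k) (Fin k) ℝ} {κ : ℝ} {x : Fin k → ℝ} (hx : x ≠ 0)
    (h : A *ᵥ x = κ • x) : κ ∈ spectrum ℝ A := by
  rw [spectrum.mem_iff]
  intro hu
  refine hx ?_
  have h0 : (algebraMap ℝ (Matrix (Fin k) (Fin k) ℝ) κ - A) *ᵥ x = 0 := by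
    rw [sub_mulVec, h, Algebra.algebraMap_eq_smul_one, smul_mulVec, one_mulVec, sub_self]
  rw [isUnit_iff_isUnit_det] at hu
  have := congrArg (fun y => (algebraMap ℝ (Matrix (Fin k) (Fin k) ℝ) κ - A)⁻¹ *ᵥ y) h0
  simpa [mulVec_mulVec, nonsing_inv_mul _ hu] using this

/-- The leading eigenvalues of `A` dominate the minimum of the Rayleigh quotient of `A` on any
`r`-dimensional subspace. -/
theorem IsLeadingEigensystem.le_of_rayleigh {A : Matrix (Fin k) (Fin k) ℝ} {ν : Fin r → ℝ}
    {V : Matrix (Fin k) (Fin r) ℝ} (h : IsLeadingEigensystem A ν V) (hA : Aᵀ = A)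
    (X : Matrix (Fin k) (Fin r) ℝ) {c : ℝ} (hc : 0 < c) (hX : ∀ z, X *ᵥ z = 0 → z = 0)
    (hR : ∀ z, c * ((X *ᵥ z) ⬝ᵥ (X *ᵥ z)) ≤ (X *ᵥ z) ⬝ᵥ (A *ᵥ (X *ᵥ z))) (l : Fin r) :
    c ≤ ν l := by
  -- Courant–Fischer by deflation: `B` is `A` with all leading eigendirections removed except the
  -- `l`-th, so its quadratic form is at most max 0 (ν l).
  set ν' : Fin r → ℝ := Function.update ν l 0 with hν'
  set B : Matrix (Fin k) (Fin k) ℝ := A - V * diagonal ν' * Vᵀ with hB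
  have hBs : Bᵀ = B := by
    simp [hB, transpose_sub, hA, Matrix.mul_assoc]
  have hVA : Vᵀ * A = diagonal ν * Vᵀ := by
    have := congrArg transpose h.eigen
    simpa [hA] using this
  have hVB : ∀ x, Vᵀ *ᵥ (B *ᵥ x) = diagonal (ν - ν') *ᵥ (Vᵀ *ᵥ x) := fun x => by
    have : Vᵀ * B = diagonal (ν - ν') * Vᵀ := by
      rw [hB, Matrix.mul_sub, hVA, ← Matrix.mul_assoc, ← Matrix.mul_assoc, h.orthonormal,
        Matrix.one_mul, ← Matrix.sub_mul, diagonal_sub]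
      rfl
    rw [mulVec_mulVec, this, ← mulVec_mulVec]
  have hBle : ∀ x, x ⬝ᵥ (B *ᵥ x) ≤ max 0 (ν l) * (x ⬝ᵥ x) := by
    refine quadForm_le_of_eigenvalues hBs fun κ x hx hBx => ?_
    by_contra! hκ
    have hκ0 : 0 < κ := (le_max_left _ _).trans_lt hκ
    have hκl : ν l < κ := (le_max_right _ _).trans_lt hκ
    -- In the coordinates of `V` the matrix `B` is diagonal with entries 0 and `ν l`, both below κ,
    -- so `x` has no component along `V` and `largest` applies to it.
    have hv : Vᵀ *ᵥ x = 0 := by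
      funext j
      have h1 := congrFun (hVB x) j
      rw [hBx, mulVec_smul, mulVec_diagonal] at h1
      simp only [Pi.smul_apply, smul_eq_mul, Pi.sub_apply, hν'] at h1
      by_cases hj : j = l
      · subst hj
        simp only [Function.update_self, sub_zero] at h1
        have : (κ - ν j) * (Vᵀ *ᵥ x) j = 0 := by linarith
        rcases mul_eq_zero.1 this with h2 | h2
        · linarith
        · exact h2
      · simp only [Function.update_of_ne hj, sub_self, zero_mul] at h1
        exact (mul_eq_zero.1 h1).resolve_left hκ0.ne'
    have hAx : A *ᵥ x = κ • x := by
      rw [← hBx, hB, sub_mulVec, ← mulVec_mulVec, hv, mulVec_zero, sub_zero]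
    linarith [h.largest κ x hx hAx hv l]
  -- The r - 1 conditions of orthogonality to the removed directions have a nonzero solution in r
  -- unknowns: zeroing row `l` makes the square matrix singular.
  obtain ⟨z, hz, hz0⟩ : ∃ z, z ≠ 0 ∧ updateRow (Vᵀ * X) l 0 *ᵥ z = 0 := by
    rw [exists_mulVec_eq_zero_iff]
    exact det_eq_zero_of_row_eq_zero l (by simp)
  have hzv : ∀ j, j ≠ l → (Vᵀ *ᵥ (X *ᵥ z)) j = 0 := fun j hj => by
    have h1 := congrFun hz0 j
    rw [mulVec_mulVec]
    simpa [mulVec, updateRow_ne hj] using h1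
  set x := X *ᵥ z with hx
  have hx0 : 0 < x ⬝ᵥ x := by
    have : x ≠ 0 := fun h0 => hz (hX z h0)
    have h1 : 0 ≤ x ⬝ᵥ x := by rw [← vnorm_sq_eq_dotProduct]; positivity
    exact h1.lt_of_ne' (by rwa [ne_eq, dotProduct_self_eq_zero])
  have hAB : A *ᵥ x = B *ᵥ x := by
    have : diagonal ν' *ᵥ (Vᵀ *ᵥ x) = 0 := by
      funext j
      rw [mulVec_diagonal]
      by_cases hj : j = l
      · subst hj; simp [hν']
      · simp [hzv j hj]
    rw [hB, sub_mulVec, Matrix.mul_assoc, ← mulVec_mulVec, ← mulVec_mulVec, this, mulVec_zero,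
      sub_zero]
  have h2 := hR z
  rw [← hx, hAB] at h2
  have h3 : c ≤ max 0 (ν l) := le_of_mul_le_mul_right (h2.trans (hBle x)) hx0
  rcases le_max_iff.1 h3 with h4 | h4
  · linarith
  · exact h4

/-- A symmetric positive semidefinite matrix that is bounded by `c` as a quadratic form is bounded
by `c` on Euclidean space. -/
theorem vnorm_mulVec_le_of_quadForm {A : Matrix (Fin k) (Fin k) ℝ} (hA : Aᵀ = A) {c : ℝ}
    (hc : 0 < c) (h0 : ∀ x, 0 ≤ x ⬝ᵥ (A *ᵥ x)) (h1 : ∀ x, x ⬝ᵥ (A *ᵥ x) ≤ c * (x ⬝ᵥ x))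
    (x : Fin k → ℝ) : vnorm (A *ᵥ x) ≤ c * vnorm x := by
  apply le_of_sq_le_sq _ (mul_nonneg hc.le (vnorm_nonneg _))
  rw [mul_pow, vnorm_sq_eq_dotProduct, vnorm_sq_eq_dotProduct]
  -- Positivity at cx - Ax reads 2c‖Ax‖² ≤ c² x'Ax + (Ax)'A(Ax), and the right side is at most
  -- c³‖x‖² + c‖Ax‖².
  have h2 := h0 (c • x - A *ᵥ x)
  have h3 : (A *ᵥ x) ⬝ᵥ (A *ᵥ x) = x ⬝ᵥ (A *ᵥ (A *ᵥ x)) := by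
    rw [dotProduct_mulVec_symm hA x]
  simp only [mulVec_sub, dotProduct_sub, sub_dotProduct, mulVec_smul, dotProduct_smul,
    smul_dotProduct, smul_eq_mul, ← h3] at h2
  have h4 := h1 x
  have h5 := h1 (A *ᵥ x)
  nlinarith [mul_le_mul_of_nonneg_left h4 (sq_nonneg c)]

/-- If `B` inverts the positive matrix `A ≤ c`, then `B ≥ c⁻¹` as quadratic forms. -/
theorem quadForm_inv_ge {A B : Matrix (Fin k) (Fin k) ℝ} (hA : Aᵀ = A) (hAB : A * B = 1) {c : ℝ}
    (hc : 0 < c) (h0 : ∀ x, 0 ≤ x ⬝ᵥ (A *ᵥ x)) (h1 : ∀ x, x ⬝ᵥ (A *ᵥ x) ≤ c * (x ⬝ᵥ x))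
    (x : Fin k → ℝ) : c⁻¹ * (x ⬝ᵥ x) ≤ x ⬝ᵥ (B *ᵥ x) := by
  -- Positivity at x - cBx reads 2c x'x ≤ x'Ax + c² x'Bx, while x'Ax ≤ c x'x.
  have h2 := h0 (x - c • (B *ᵥ x))
  have h3 : A *ᵥ (B *ᵥ x) = x := by rw [mulVec_mulVec, hAB, one_mulVec]
  have h5 : (B *ᵥ x) ⬝ᵥ (A *ᵥ x) = x ⬝ᵥ x := by
    rw [dotProduct_mulVec_symm hA, h3]
  simp only [mulVec_sub, dotProduct_sub, sub_dotProduct, mulVec_smul, dotProduct_smul,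
    smul_dotProduct, smul_eq_mul, h3, h5] at h2
  have h6 : (B *ᵥ x) ⬝ᵥ x = x ⬝ᵥ (B *ᵥ x) := dotProduct_comm _ _
  rw [h6] at h2
  have h4 := h1 x
  rw [inv_mul_le_iff₀ hc]
  have : c * (x ⬝ᵥ x) ≤ c * (c * (x ⬝ᵥ (B *ᵥ x))) := by nlinarith
  exact le_of_mul_le_mul_left this hc

theorem isUnit_of_quadForm_pos {A : Matrix (Fin k) (Fin k) ℝ} {c : ℝ} (hc : 0 < c)
    (h : ∀ x, c * (x ⬝ᵥ x) ≤ x ⬝ᵥ (A *ᵥ x)) : IsUnit A := by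
  rw [← mulVec_injective_iff_isUnit]
  intro x y hxy
  have h1 : A *ᵥ (x - y) = 0 := by rw [mulVec_sub, sub_eq_zero]; exact hxy
  have h2 := h (x - y)
  rw [h1, dotProduct_zero] at h2
  have h3 : (x - y) ⬝ᵥ (x - y) = 0 := by
    have : 0 ≤ (x - y) ⬝ᵥ (x - y) := by rw [← vnorm_sq_eq_dotProduct]; positivity
    nlinarith
  exact sub_eq_zero.1 (dotProduct_self_eq_zero.1 h3)

end QuadraticForms

/-! ### Principal components residuals are entrywise close to Σ_u -/

section FirstStep

open scoped Matrix.Norms.Frobenius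

variable {N T r : ℕ}

/-- Deterministic bounds for the sample second moments of the factors `F` and the idiosyncratic
terms `U`, where `Sig` is the population covariance matrix of the latter, and for the loadings. -/
structure SampleBounds (K κ ε : ℝ) (Λ : Matrix (Fin N) (Fin r) ℝ) (F : Matrix (Fin T) (Fin r) ℝ)
    (U : Matrix (Fin N) (Fin T) ℝ) (Sig : Matrix (Fin N) (Fin N) ℝ) : Prop where
  N_pos : 0 < N
  T_pos : 0 < T
  one_le : 1 ≤ K
  sqrt_le : √r ≤ K
  κ_pos : 0 < κ
  ε_nonneg : 0 ≤ ε
  ε_le_one : ε ≤ 1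
  loadings : ∀ i, vnorm (Λ i) ≤ K
  pervasive : ∀ z, κ * N * (z ⬝ᵥ z) ≤ (Λ *ᵥ z) ⬝ᵥ (Λ *ᵥ z)
  cov : ∀ i j, |((T : ℝ)⁻¹ • (U * Uᵀ)) i j - Sig i j| ≤ K * ε
  cross : ∀ i, vnorm (((T : ℝ)⁻¹ • (U * F)) i) ≤ K * ε
  factor_lower : ∀ z, κ * (z ⬝ᵥ z) ≤ z ⬝ᵥ (((T : ℝ)⁻¹ • (Fᵀ * F)) *ᵥ z)
  factor_upper : ‖(T : ℝ)⁻¹ • (Fᵀ * F)‖ ≤ K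
  row_le : ∀ i, vnorm (Sig i) ≤ K

theorem abs_mul_transpose_apply_le {a b c : ℕ} (X : Matrix (Fin a) (Fin b) ℝ)
    (Z : Matrix (Fin c) (Fin b) ℝ) (i : Fin a) (j : Fin c) :
    |(X * Zᵀ) i j| ≤ vnorm (X i) * vnorm (Z j) :=
  abs_dotProduct_le (X i) (Z j)

theorem frob_diagonal_le {d : Fin r → ℝ} {c : ℝ} (hc : 0 ≤ c) (h : ∀ l, |d l| ≤ c) :
    ‖diagonal d‖ ≤ √r * c := by
  rw [frobenius_norm_diagonal]
  exact vnorm_le_of_abs_le hc h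

variable {K κ ε : ℝ} {Λ : Matrix (Fin N) (Fin r) ℝ} {F : Matrix (Fin T) (Fin r) ℝ}
  {U : Matrix (Fin N) (Fin T) ℝ} {Sig : Matrix (Fin N) (Fin N) ℝ}

theorem sampleCov_expand (Λ : Matrix (Fin N) (Fin r) ℝ) (F : Matrix (Fin T) (Fin r) ℝ)
    (U : Matrix (Fin N) (Fin T) ℝ) :
    sampleCov (Λ * Fᵀ + U) = Λ * (((T : ℝ)⁻¹ • (Fᵀ * F)) * Λᵀ + ((T : ℝ)⁻¹ • (U * F))ᵀ) +
      ((T : ℝ)⁻¹ • (U * F)) * Λᵀ + (T : ℝ)⁻¹ • (U * Uᵀ) := by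
  simp only [sampleCov, transpose_add, transpose_mul, transpose_transpose, transpose_smul,
    Matrix.add_mul, Matrix.mul_add, smul_add, Matrix.mul_smul, Matrix.smul_mul, Matrix.mul_assoc]
  abel

namespace SampleBounds

theorem K_pos (h : SampleBounds K κ ε Λ F U Sig) : 0 < K := by linarith [h.one_le]

theorem sqrtN_pos (h : SampleBounds K κ ε Λ F U Sig) : 0 < √(N : ℝ) :=
  Real.sqrt_pos.2 (by exact_mod_cast h.N_pos)

theorem norm_loadings (h : SampleBounds K κ ε Λ F U Sig) : ‖Λ‖ ≤ √N * K :=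
  frob_le_of_rows h.K_pos.le h.loadings

theorem norm_cross (h : SampleBounds K κ ε Λ F U Sig) :
    ‖(T : ℝ)⁻¹ • (U * F)‖ ≤ √N * (K * ε) :=
  frob_le_of_rows (mul_nonneg h.K_pos.le h.ε_nonneg) h.cross

/-- A row of Σ_u is bounded in Euclidean norm, whereas `N` entrywise errors of size Kε add up to √N
Kε. Relative to √N this is ε + 1/√N: here 1/√N enters the rate of the first step. -/
theorem row_sampleCov (h : SampleBounds K κ ε Λ F U Sig) (i : Fin N) :
    vnorm (((T : ℝ)⁻¹ • (U * Uᵀ)) i) ≤ √N * K * (ε + 1 / √N) := by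
  have h1 : ((T : ℝ)⁻¹ • (U * Uᵀ)) i =
      (fun j => ((T : ℝ)⁻¹ • (U * Uᵀ)) i j - Sig i j) + Sig i := by
    funext j; simp
  rw [h1]
  refine (vnorm_add_le _ _).trans ?_
  have h2 := vnorm_le_of_abs_le (mul_nonneg h.K_pos.le h.ε_nonneg) (h.cov i)
  have h3 : √(N : ℝ) * K * (ε + 1 / √N) = √N * (K * ε) + K := by
    field_simp [h.sqrtN_pos.ne']
  rw [h3]
  exact add_le_add h2 (h.row_le i)

theorem injective (h : SampleBounds K κ ε Λ F U Sig) {z : Fin r → ℝ} (hz : Λ *ᵥ z = 0) : z = 0 := by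
  have h1 := h.pervasive z
  rw [hz, dotProduct_zero] at h1
  have hN : (0 : ℝ) < N := by exact_mod_cast h.N_pos
  have h2 : 0 ≤ z ⬝ᵥ z := by rw [← vnorm_sq_eq_dotProduct]; positivity
  have h3 : z ⬝ᵥ z = 0 := by
    have := mul_pos h.κ_pos hN
    nlinarith
  exact dotProduct_self_eq_zero.1 h3

/-- The leading eigenvalues of the sample covariance matrix are of order `N`. -/
theorem eigenvalue_ge (h : SampleBounds K κ ε Λ F U Sig) (hε : ε ≤ κ ^ 2 / (4 * K ^ 2))
    {ν : Fin r → ℝ} {Ξ : Matrix (Fin N) (Fin r) ℝ}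
    (hΞ : IsLeadingEigensystem (sampleCov (Λ * Fᵀ + U)) ν Ξ) (l : Fin r) :
    κ ^ 2 / 2 * N ≤ ν l := by
  have hN : (0 : ℝ) < N := by exact_mod_cast h.N_pos
  have hκ := h.κ_pos
  have hK := h.K_pos
  -- The test subspace is the column space of `Λ`, on which the signal is of order `N`.
  refine hΞ.le_of_rayleigh (by simp [sampleCov]) Λ (by positivity) (fun z hz => h.injective hz)
    (fun z => ?_) l
  set x := Λ *ᵥ z with hx
  set y := Λᵀ *ᵥ x with hy
  set D := (T : ℝ)⁻¹ • (U * F) with hD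
  have e1 : x ⬝ᵥ (sampleCov (Λ * Fᵀ + U) *ᵥ x) =
      y ⬝ᵥ (((T : ℝ)⁻¹ • (Fᵀ * F)) *ᵥ y) + 2 * (y ⬝ᵥ (Dᵀ *ᵥ x)) +
        x ⬝ᵥ (((T : ℝ)⁻¹ • (U * Uᵀ)) *ᵥ x) := by
    have e2 : ∀ w, x ⬝ᵥ (Λ *ᵥ w) = y ⬝ᵥ w := fun w => by
      rw [dotProduct_mulVec, ← mulVec_transpose]
    have e3 : x ⬝ᵥ (D *ᵥ y) = y ⬝ᵥ (Dᵀ *ᵥ x) := by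
      rw [dotProduct_mulVec, ← mulVec_transpose, dotProduct_comm]
    rw [sampleCov_expand, add_mulVec, add_mulVec, ← mulVec_mulVec, add_mulVec, ← mulVec_mulVec,
      ← mulVec_mulVec, dotProduct_add, dotProduct_add, e2, dotProduct_add, ← hD, ← hy, e3]
    ring
  -- The pure noise term is dropped by its sign; only the cross term needs an upper bound.
  have h0 : 0 ≤ x ⬝ᵥ (((T : ℝ)⁻¹ • (U * Uᵀ)) *ᵥ x) := by
    rw [smul_mulVec, ← mulVec_mulVec, dotProduct_smul, dotProduct_mulVec, ← mulVec_transpose,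
      ← vnorm_sq_eq_dotProduct]
    simp only [smul_eq_mul]
    positivity
  have h1 := h.factor_lower y
  have h2 := neg_le_of_abs_le (abs_dotProduct_le y (Dᵀ *ᵥ x))
  have h3 : vnorm (Dᵀ *ᵥ x) ≤ √N * (K * ε) * vnorm x := by
    refine (vnorm_mulVec_le _ _).trans ?_
    rw [frobenius_norm_transpose]
    have := vnorm_nonneg x
    gcongr
    exact h.norm_cross
  have h4 : vnorm y ≤ √N * K * vnorm x := by
    refine (vnorm_mulVec_le _ _).trans ?_
    rw [frobenius_norm_transpose]
    have := vnorm_nonneg x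
    gcongr
    exact h.norm_loadings
  -- Combine x'x = z'y ≤ ‖z‖‖y‖ with κN‖z‖² ≤ ‖x‖² after squaring.
  have h5 : κ * N * (x ⬝ᵥ x) ≤ y ⬝ᵥ y := by
    have h6 := h.pervasive z
    have h7 : x ⬝ᵥ x = z ⬝ᵥ y := by
      calc x ⬝ᵥ (Λ *ᵥ z) = y ⬝ᵥ z := by rw [dotProduct_mulVec, ← mulVec_transpose]
        _ = z ⬝ᵥ y := dotProduct_comm _ _
    have h8 := le_of_abs_le (abs_dotProduct_le z y)
    rw [← h7] at h8
    rw [← hx] at h6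
    rw [← vnorm_sq_eq_dotProduct] at h6 h8 ⊢
    rw [← vnorm_sq_eq_dotProduct] at h6 ⊢
    have hx0 := vnorm_nonneg x
    have hz0 := vnorm_nonneg z
    have hy0 := vnorm_nonneg y
    rcases eq_or_lt_of_le hx0 with h9 | h9
    · rw [← h9]; simp only [ne_eq, OfNat.ofNat_ne_zero, not_false_eq_true, zero_pow, mul_zero]
      positivity
    · have h10 : (vnorm x ^ 2) ^ 2 ≤ vnorm z ^ 2 * vnorm y ^ 2 := by
        rw [← mul_pow]; gcongr
      have h11 : κ * N * (vnorm x ^ 2) ^ 2 ≤ vnorm x ^ 2 * vnorm y ^ 2 := by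
        calc κ * N * (vnorm x ^ 2) ^ 2 ≤ κ * N * (vnorm z ^ 2 * vnorm y ^ 2) := by gcongr
          _ = (κ * N * vnorm z ^ 2) * vnorm y ^ 2 := by ring
          _ ≤ _ := by gcongr
      have h12 : vnorm x ^ 2 * (κ * N * vnorm x ^ 2) ≤ vnorm x ^ 2 * vnorm y ^ 2 := by
        linarith
      exact le_of_mul_le_mul_left h12 (by positivity)
  have h6 : vnorm y * vnorm (Dᵀ *ᵥ x) ≤ (√N * K * vnorm x) * (√N * (K * ε) * vnorm x) :=
    mul_le_mul h4 h3 (vnorm_nonneg _) (mul_nonneg (by positivity) (vnorm_nonneg x))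
  have h7 : (√N * K * vnorm x) * (√N * (K * ε) * vnorm x) = N * K ^ 2 * ε * (x ⬝ᵥ x) := by
    rw [← vnorm_sq_eq_dotProduct]
    have : √(N : ℝ) * √N = N := Real.mul_self_sqrt hN.le
    linear_combination (K ^ 2 * ε * vnorm x ^ 2) * this
  -- The smallness of ε makes twice the cross term at most half of the signal κ²N x'x.
  have h8 : K ^ 2 * ε ≤ κ ^ 2 / 4 := by
    calc K ^ 2 * ε ≤ K ^ 2 * (κ ^ 2 / (4 * K ^ 2)) := by gcongr
      _ = _ := by field_simp
  have hxx : 0 ≤ x ⬝ᵥ x := by rw [← vnorm_sq_eq_dotProduct]; positivity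
  have h9 : N * K ^ 2 * ε * (x ⬝ᵥ x) ≤ κ ^ 2 / 4 * (N * (x ⬝ᵥ x)) := by
    calc N * K ^ 2 * ε * (x ⬝ᵥ x) = K ^ 2 * ε * (N * (x ⬝ᵥ x)) := by ring
      _ ≤ _ := by gcongr
  rw [e1]
  nlinarith [mul_le_mul_of_nonneg_left h5 hκ.le]

end SampleBounds

/-- The projection ΞΞ' commutes with S_y, so projecting on one side or on both gives the same
matrix. In the two-sided form the loadings enter only through (1 - ΞΞ')Λ, which is small. -/
theorem residualCov_eq {Y : Matrix (Fin N) (Fin T) ℝ} {ν : Fin r → ℝ}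
    {Ξ : Matrix (Fin N) (Fin r) ℝ} (h : IsLeadingEigensystem (sampleCov Y) ν Ξ) :
    residualCov Y ν Ξ = (1 - Ξ * Ξᵀ) * sampleCov Y * (1 - Ξ * Ξᵀ) := by
  have h1 : ∑ i : Fin r, ν i • vecMulVec (fun a => Ξ a i) (fun a => Ξ a i) =
      Ξ * diagonal ν * Ξᵀ := by
    ext i j
    rw [Matrix.mul_apply]
    simp [Matrix.sum_apply, vecMulVec_apply, mul_diagonal]
    exact Finset.sum_congr rfl fun k _ => by ring
  have h2 : sampleCov Y * (1 - Ξ * Ξᵀ) = residualCov Y ν Ξ := by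
    rw [residualCov, h1, Matrix.mul_sub, Matrix.mul_one, ← Matrix.mul_assoc, h.eigen]
  have h3 : Ξᵀ * sampleCov Y = diagonal ν * Ξᵀ := by
    have := congrArg transpose h.eigen
    simpa [sampleCov] using this
  have h4 : Ξᵀ * residualCov Y ν Ξ = 0 := by
    rw [residualCov, h1, Matrix.mul_sub, h3, ← Matrix.mul_assoc, ← Matrix.mul_assoc,
      h.orthonormal, Matrix.one_mul, sub_self]
  rw [Matrix.mul_assoc, h2, Matrix.sub_mul, Matrix.one_mul, Matrix.mul_assoc, h4, Matrix.mul_zero,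
    sub_zero]

theorem residualCov_expand {ν : Fin r → ℝ} {Ξ : Matrix (Fin N) (Fin r) ℝ}
    (h : IsLeadingEigensystem (sampleCov (Λ * Fᵀ + U)) ν Ξ) :
    residualCov (Λ * Fᵀ + U) ν Ξ =
      ((1 - Ξ * Ξᵀ) * Λ) * ((T : ℝ)⁻¹ • (Fᵀ * F)) * ((1 - Ξ * Ξᵀ) * Λ)ᵀ +
      ((1 - Ξ * Ξᵀ) * Λ) * ((1 - Ξ * Ξᵀ) * ((T : ℝ)⁻¹ • (U * F)))ᵀ +
      ((1 - Ξ * Ξᵀ) * ((T : ℝ)⁻¹ • (U * F))) * ((1 - Ξ * Ξᵀ) * Λ)ᵀ +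
      ((T : ℝ)⁻¹ • (U * Uᵀ) - Ξ * (((T : ℝ)⁻¹ • (U * Uᵀ)) * Ξ)ᵀ -
        (((T : ℝ)⁻¹ • (U * Uᵀ)) * Ξ) * Ξᵀ +
        Ξ * (Ξᵀ * (((T : ℝ)⁻¹ • (U * Uᵀ)) * Ξ)) * Ξᵀ) := by
  rw [residualCov_eq h, sampleCov_expand]
  set D := (T : ℝ)⁻¹ • (U * F)
  set G := (T : ℝ)⁻¹ • (Fᵀ * F)
  have hS : ((T : ℝ)⁻¹ • (U * Uᵀ))ᵀ = (T : ℝ)⁻¹ • (U * Uᵀ) := by simp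
  set S := (T : ℝ)⁻¹ • (U * Uᵀ)
  have hP : (1 - Ξ * Ξᵀ)ᵀ = 1 - Ξ * Ξᵀ := by simp
  have h1 : (1 - Ξ * Ξᵀ) * S * (1 - Ξ * Ξᵀ) = S - Ξ * (S * Ξ)ᵀ - (S * Ξ) * Ξᵀ +
      Ξ * (Ξᵀ * (S * Ξ)) * Ξᵀ := by
    rw [transpose_mul, hS]
    simp only [Matrix.sub_mul, Matrix.mul_sub, Matrix.one_mul, Matrix.mul_one, Matrix.mul_assoc]
    abel
  rw [← h1, transpose_mul, transpose_mul, hP]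
  simp only [Matrix.add_mul, Matrix.mul_add, Matrix.mul_assoc]

set_option maxHeartbeats 1000000 in
/-- The residual covariance matrix of the principal components estimator is close to the
covariance matrix of the idiosyncratic terms in the maximum norm. -/
theorem residualCov_close (r : ℕ) {K κ : ℝ} (hK : 1 ≤ K) (hκ : 0 < κ) :
    ∃ K' : ℝ, 0 < K' ∧ ∃ ω₀ : ℝ, 0 < ω₀ ∧ ∀ (N T : ℕ) (ε : ℝ) (Λ : Matrix (Fin N) (Fin r) ℝ)
      (F : Matrix (Fin T) (Fin r) ℝ) (U : Matrix (Fin N) (Fin T) ℝ)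
      (Sig : Matrix (Fin N) (Fin N) ℝ), SampleBounds K κ ε Λ F U Sig → ε + 1 / √N ≤ ω₀ →
      ∀ (ν : Fin r → ℝ) (Ξ : Matrix (Fin N) (Fin r) ℝ),
        IsLeadingEigensystem (sampleCov (Λ * Fᵀ + U)) ν Ξ →
        ∀ i j, |residualCov (Λ * Fᵀ + U) ν Ξ i j - Sig i j| ≤ K' * (ε + 1 / √N) := by
  have hK0 : 0 < K := by linarith
  -- `J` bounds N / ν_l. Then `KE`, `KX`, `KQ`, `KD` are the constants in the row bounds of `E`, Ξ,
  -- (1 - ΞΞ')Λ and (1 - ΞΞ')UF/T.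
  obtain ⟨J, hJ⟩ : ∃ J, J = (κ ^ 2 / 2)⁻¹ := ⟨_, rfl⟩
  have hJ0 : 0 < J := by rw [hJ]; positivity
  obtain ⟨KE, hKE⟩ : ∃ KE, KE = 2 * K ^ 4 * J := ⟨_, rfl⟩
  have hKE0 : 0 < KE := by rw [hKE]; positivity
  obtain ⟨KX, hKX⟩ : ∃ KX, KX = 2 * K * KE := ⟨_, rfl⟩
  have hKX0 : 0 < KX := by rw [hKX]; positivity
  obtain ⟨KQ, hKQ⟩ : ∃ KQ, KQ = 2 * K ^ 2 * KE + 2 * K ^ 3 * KX * KE := ⟨_, rfl⟩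
  have hKQ0 : 0 < KQ := by rw [hKQ]; positivity
  obtain ⟨KD, hKD⟩ : ∃ KD, KD = K + K ^ 2 * KX := ⟨_, rfl⟩
  have hKD0 : 0 < KD := by rw [hKD]; positivity
  -- The first constant adds up the bounds `b1` to `b7` on the terms of `residualCov_expand`, using
  -- w² ≤ w. The second collects w ≤ 1, the requirement of `eigenvalue_ge`, and KE·w ≤ 1/2, which
  -- makes `A` invertible.
  refine ⟨KQ ^ 2 * K + 2 * KQ * KD + K + 2 * K ^ 2 * KX + KX ^ 2 * K ^ 3, by positivity,
    min 1 (min (κ ^ 2 / (4 * K ^ 2)) (1 / (2 * KE))), by positivity, ?_⟩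
  intro N T ε Λ F U Sig h hω ν Ξ hΞ i j
  obtain ⟨w, hw⟩ : ∃ w, w = ε + 1 / √(N : ℝ) := ⟨_, rfl⟩
  obtain ⟨s, hs⟩ : ∃ s, s = √(N : ℝ) := ⟨_, rfl⟩
  have hs0 : 0 < s := hs ▸ h.sqrtN_pos
  have hε0 := h.ε_nonneg
  have hεw : ε ≤ w := by rw [hw, ← hs]; linarith [one_div_pos.2 hs0]
  have hw0 : 0 ≤ w := hε0.trans hεw
  rw [← hw] at hω ⊢
  have hw1 : w ≤ 1 := hω.trans (min_le_left _ _)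
  have hw2 : w ≤ κ ^ 2 / (4 * K ^ 2) := hω.trans ((min_le_right _ _).trans (min_le_left _ _))
  have hw3 : KE * w ≤ 1 / 2 := by
    have : w ≤ 1 / (2 * KE) := hω.trans ((min_le_right _ _).trans (min_le_right _ _))
    rw [le_div_iff₀ (by positivity)] at this
    linarith
  have hN : (N : ℝ) = s ^ 2 := by rw [hs, Real.sq_sqrt (by positivity)]
  have hν : ∀ l, s ^ 2 / J ≤ ν l := fun l => by
    have := h.eigenvalue_ge (hεw.trans hw2) hΞ l
    rw [hN] at this
    rw [hJ, div_inv_eq_mul, mul_comm]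
    exact this
  set D := (T : ℝ)⁻¹ • (U * F) with hD
  set G := (T : ℝ)⁻¹ • (Fᵀ * F) with hG
  set Su := (T : ℝ)⁻¹ • (U * Uᵀ) with hSu
  have nΛ : ‖Λ‖ ≤ s * K := hs ▸ h.norm_loadings
  have nD : ‖D‖ ≤ s * (K * ε) := hs ▸ h.norm_cross
  have nG : ‖G‖ ≤ K := h.factor_upper
  have nΞ : ‖Ξ‖ ≤ K := (frob_of_orthonormal hΞ.orthonormal).trans_le h.sqrt_le
  have rS : ∀ i, vnorm (Su i) ≤ s * K * w := fun i => by rw [hs, hw]; exact h.row_sampleCov i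
  have νpos : ∀ l, 0 < ν l := fun l => lt_of_lt_of_le (by positivity) (hν l)
  set L : Matrix (Fin r) (Fin r) ℝ := diagonal fun l => (ν l)⁻¹ with hL
  have nL : ‖L‖ ≤ K * (J / s ^ 2) := by
    refine (frob_diagonal_le (c := J / s ^ 2) (by positivity) fun l => ?_).trans ?_
    · rw [abs_of_pos (inv_pos.2 (νpos l)), ← inv_div]
      exact inv_anti₀ (by positivity) (hν l)
    · gcongr
      exact h.sqrt_le
  -- The eigenvector equation divided by the eigenvalues is Ξ = S_y Ξ L. The terms of S_y that begin
  -- with Λ go into `A`, the others into `E`.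
  set A : Matrix (Fin r) (Fin r) ℝ := (G * Λᵀ + Dᵀ) * Ξ * L with hA
  set E : Matrix (Fin N) (Fin r) ℝ := (D * Λᵀ + Su) * Ξ * L with hE
  have eΞ : Ξ = Λ * A + E := by
    have h1 : sampleCov (Λ * Fᵀ + U) * Ξ * L = Ξ := by
      rw [hΞ.eigen, Matrix.mul_assoc, hL, diagonal_mul_diagonal]
      simp [fun l => mul_inv_cancel₀ (νpos l).ne']
    rw [sampleCov_expand] at h1
    conv_lhs => rw [← h1]
    rw [hA, hE]
    simp only [Matrix.add_mul, Matrix.mul_add, Matrix.mul_assoc, ← hD, ← hG, ← hSu]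
    abel
  have nΛt : ‖Λᵀ‖ ≤ s * K := by rw [frobenius_norm_transpose]; exact nΛ
  have rE : ∀ i, vnorm (E i) ≤ KE * w / s := fun i => by
    have h1 : vnorm ((D * Λᵀ + Su) i) ≤ 2 * s * K ^ 2 * w := by
      have h2 : (D * Λᵀ + Su) i = (D * Λᵀ) i + Su i := rfl
      have h3 : vnorm ((D * Λᵀ) i) ≤ K * ε * (s * K) :=
        (vnorm_mul_row_le _ _ _).trans (by gcongr; exact h.cross i)
      rw [h2]
      refine (vnorm_add_le _ _).trans ((add_le_add h3 (rS i)).trans ?_)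
      have h4 : K * ε * (s * K) ≤ K * w * (s * K) := by gcongr
      have h5 : s * K * w ≤ s * K * w * K := le_mul_of_one_le_right (by positivity) hK
      nlinarith
    calc vnorm (E i) ≤ vnorm ((D * Λᵀ + Su) i) * ‖Ξ‖ * ‖L‖ :=
          (vnorm_mul_row_le _ _ _).trans (by gcongr; exact vnorm_mul_row_le _ _ _)
      _ ≤ 2 * s * K ^ 2 * w * K * (K * (J / s ^ 2)) := by gcongr
      _ = KE * w / s := by rw [hKE]; field_simp
  have nE : ‖E‖ ≤ KE * w := by
    refine (frob_le_of_rows (by positivity) rE).trans_eq ?_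
    rw [← hs]; field_simp
  have nA : ‖A‖ ≤ KE / s := by
    have h1 : ‖G * Λᵀ + Dᵀ‖ ≤ 2 * s * K ^ 2 := by
      refine (norm_add_le _ _).trans ?_
      have h2 : ‖G * Λᵀ‖ ≤ K * (s * K) := (frobenius_norm_mul _ _).trans (by gcongr)
      have h3 : ‖Dᵀ‖ ≤ s * (K * 1) := by
        rw [frobenius_norm_transpose]; exact nD.trans (by gcongr; exact h.ε_le_one)
      have h4 : s * K * 1 ≤ s * K * K := by gcongr
      nlinarith
    calc ‖A‖ ≤ ‖G * Λᵀ + Dᵀ‖ * ‖Ξ‖ * ‖L‖ :=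
          (frobenius_norm_mul _ _).trans (by gcongr; exact frobenius_norm_mul _ _)
      _ ≤ 2 * s * K ^ 2 * K * (K * (J / s ^ 2)) := by gcongr
      _ = KE / s := by rw [hKE]; field_simp
  -- Delocalization: every row of Ξ is of order 1/√N, since the rows of Λ are bounded and `A` is of
  -- that order.
  have rΞ : ∀ i, vnorm (Ξ i) ≤ KX / s := fun i => by
    have h1 : vnorm (Ξ i) ≤ vnorm ((Λ * A) i) + vnorm (E i) := by
      conv_lhs => rw [eΞ]
      exact vnorm_add_le _ _
    have h2 : vnorm ((Λ * A) i) ≤ K * (KE / s) :=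
      (vnorm_mul_row_le _ _ _).trans (by gcongr; exact h.loadings i)
    have h3 : KE * w / s ≤ K * (KE / s) := by
      rw [mul_div_assoc', div_le_div_iff_of_pos_right hs0]
      nlinarith
    calc vnorm (Ξ i) ≤ K * (KE / s) + K * (KE / s) := h1.trans (add_le_add h2 ((rE i).trans h3))
      _ = KX / s := by rw [hKX]; ring
  -- Ξ = ΛA + E is an isometry and ‖E‖ ≤ 1/2, so ΛA shrinks no vector by more than half; ‖Λ‖ ≤ K√N
  -- then bounds `A` from below.
  have hAz : ∀ z, vnorm z ≤ 2 * K * s * vnorm (A *ᵥ z) := fun z => by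
    have h1 : vnorm (Ξ *ᵥ z) = vnorm z := by
      rw [← sq_eq_sq₀ (vnorm_nonneg _) (vnorm_nonneg _), vnorm_sq_eq_dotProduct,
        vnorm_sq_eq_dotProduct]
      conv_lhs => rw [dotProduct_mulVec, ← mulVec_transpose, mulVec_mulVec, hΞ.orthonormal,
        one_mulVec]
    have h2 : vnorm z ≤ s * K * vnorm (A *ᵥ z) + KE * w * vnorm z := by
      rw [← h1]
      conv_lhs => rw [eΞ, add_mulVec, ← mulVec_mulVec]
      rw [h1]
      refine (vnorm_add_le _ _).trans (add_le_add ((vnorm_mulVec_le _ _).trans ?_)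
        ((vnorm_mulVec_le _ _).trans ?_)) <;> gcongr <;> exact vnorm_nonneg _
    nlinarith [vnorm_nonneg z]
  have hAu : IsUnit A := by
    rw [← mulVec_injective_iff_isUnit]
    intro x y hxy
    have h1 := hAz (x - y)
    have h2 : A *ᵥ (x - y) = 0 := by rw [mulVec_sub, sub_eq_zero]; exact hxy
    rw [h2, vnorm_zero, mul_zero] at h1
    exact sub_eq_zero.1 (vnorm_eq_zero.1 (le_antisymm h1 (vnorm_nonneg _)))
  have hAd := (isUnit_iff_isUnit_det A).1 hAu
  set B := A⁻¹ with hB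
  have nB : ‖B‖ ≤ 2 * K ^ 2 * s := by
    refine (frob_le_of_mulVec (K := 2 * K * s) (by positivity) fun z => ?_).trans ?_
    · have := hAz (B *ᵥ z)
      rwa [mulVec_mulVec, hB, mul_nonsing_inv _ hAd, one_mulVec] at this
    · calc √r * (2 * K * s) ≤ K * (2 * K * s) := by gcongr; exact h.sqrt_le
        _ = _ := by ring
  set Q := (1 - Ξ * Ξᵀ) * Λ with hQ
  -- Solve for the loadings, Λ = (Ξ - E)A⁻¹. Since 1 - ΞΞ' kills Ξ, what is left is -(1 - ΞΞ')EA⁻¹: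
  -- rows of order w/√N times a norm of order √N.
  have eQ : Q = Ξ * (Ξᵀ * (E * B)) - E * B := by
    have h1 : Λ = (Ξ - E) * B := by
      rw [eΞ, add_sub_cancel_right, Matrix.mul_assoc, hB, mul_nonsing_inv _ hAd, Matrix.mul_one]
    have h2 : (1 - Ξ * Ξᵀ) * Ξ = 0 := by
      rw [Matrix.sub_mul, Matrix.one_mul, Matrix.mul_assoc, hΞ.orthonormal, Matrix.mul_one,
        sub_self]
    rw [hQ]
    conv_lhs => rw [h1]
    rw [← Matrix.mul_assoc, Matrix.mul_sub, h2, zero_sub, Matrix.neg_mul, Matrix.sub_mul,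
      Matrix.sub_mul, Matrix.one_mul]
    simp only [Matrix.mul_assoc]
    abel
  have nΞt : ‖Ξᵀ‖ ≤ K := by rw [frobenius_norm_transpose]; exact nΞ
  have rQ : ∀ i, vnorm (Q i) ≤ KQ * w := fun i => by
    have h1 : Q i = (Ξ * (Ξᵀ * (E * B))) i - (E * B) i := by
      conv_lhs => rw [eQ]
      rfl
    have h2 : vnorm ((E * B) i) ≤ KE * w / s * (2 * K ^ 2 * s) :=
      (vnorm_mul_row_le _ _ _).trans (mul_le_mul (rE i) nB (norm_nonneg _) (by positivity))
    have h3 : vnorm ((Ξ * (Ξᵀ * (E * B))) i) ≤ KX / s * (K * (KE * w * (2 * K ^ 2 * s))) := by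
      refine (vnorm_mul_row_le _ _ _).trans
        (mul_le_mul (rΞ i) ?_ (norm_nonneg _) (by positivity))
      refine (frobenius_norm_mul _ _).trans (mul_le_mul nΞt ?_ (norm_nonneg _) hK0.le)
      exact (frobenius_norm_mul _ _).trans (mul_le_mul nE nB (norm_nonneg _) (by positivity))
    rw [h1]
    refine (vnorm_sub_le _ _).trans ((add_le_add h3 h2).trans_eq ?_)
    rw [hKQ]; field_simp; ring
  set D2 := (1 - Ξ * Ξᵀ) * D with hD2
  have rD2 : ∀ i, vnorm (D2 i) ≤ KD * w := fun i => by
    have h1 : D2 i = D i - (Ξ * (Ξᵀ * D)) i := by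
      rw [hD2, Matrix.sub_mul, Matrix.one_mul, Matrix.mul_assoc]; rfl
    have h3 : vnorm ((Ξ * (Ξᵀ * D)) i) ≤ KX / s * (K * (s * (K * ε))) := by
      refine (vnorm_mul_row_le _ _ _).trans
        (mul_le_mul (rΞ i) ?_ (norm_nonneg _) (by positivity))
      exact (frobenius_norm_mul _ _).trans (mul_le_mul nΞt nD (norm_nonneg _) hK0.le)
    rw [h1]
    refine (vnorm_sub_le _ _).trans ((add_le_add (h.cross i) h3).trans ?_)
    calc K * ε + KX / s * (K * (s * (K * ε))) = KD * ε := by rw [hKD]; field_simp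
      _ ≤ KD * w := by gcongr
  have rSΞ : ∀ i, vnorm ((Su * Ξ) i) ≤ s * K * w * K := fun i =>
    (vnorm_mul_row_le _ _ _).trans (mul_le_mul (rS i) nΞ (norm_nonneg _) (by positivity))
  have nSΞ : ‖Su * Ξ‖ ≤ s * (s * K * w * K) :=
    (frob_le_of_rows (by positivity) rSΞ).trans_eq (by rw [hs])
  have b1 : |(Q * G * Qᵀ) i j| ≤ KQ * w * K * (KQ * w) :=
    (abs_mul_transpose_apply_le _ _ _ _).trans (mul_le_mul ((vnorm_mul_row_le _ _ _).trans
      (mul_le_mul (rQ i) nG (norm_nonneg _) (by positivity))) (rQ j) (vnorm_nonneg _)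
      (by positivity))
  have b2 : |(Q * D2ᵀ) i j| ≤ KQ * w * (KD * w) :=
    (abs_mul_transpose_apply_le _ _ _ _).trans (mul_le_mul (rQ i) (rD2 j) (vnorm_nonneg _)
      (by positivity))
  have b3 : |(D2 * Qᵀ) i j| ≤ KD * w * (KQ * w) :=
    (abs_mul_transpose_apply_le _ _ _ _).trans (mul_le_mul (rD2 i) (rQ j) (vnorm_nonneg _)
      (by positivity))
  have b4 : |Su i j - Sig i j| ≤ K * w := (h.cov i j).trans (by gcongr)
  have b5 : |(Ξ * (Su * Ξ)ᵀ) i j| ≤ KX / s * (s * K * w * K) :=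
    (abs_mul_transpose_apply_le _ _ _ _).trans (mul_le_mul (rΞ i) (rSΞ j) (vnorm_nonneg _)
      (by positivity))
  have b6 : |((Su * Ξ) * Ξᵀ) i j| ≤ s * K * w * K * (KX / s) :=
    (abs_mul_transpose_apply_le _ _ _ _).trans (mul_le_mul (rSΞ i) (rΞ j) (vnorm_nonneg _)
      (by positivity))
  have b7 : |(Ξ * (Ξᵀ * (Su * Ξ)) * Ξᵀ) i j| ≤
      KX / s * (K * (s * (s * K * w * K))) * (KX / s) := by
    refine (abs_mul_transpose_apply_le _ _ _ _).trans (mul_le_mul ((vnorm_mul_row_le _ _ _).trans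
      (mul_le_mul (rΞ i) ?_ (norm_nonneg _) (by positivity))) (rΞ j) (vnorm_nonneg _)
      (by positivity))
    exact (frobenius_norm_mul _ _).trans (mul_le_mul nΞt nSΞ (norm_nonneg _) hK0.le)
  have c5 : KX / s * (s * K * w * K) = K ^ 2 * KX * w := by field_simp
  have c6 : s * K * w * K * (KX / s) = K ^ 2 * KX * w := by field_simp
  have c7 : KX / s * (K * (s * (s * K * w * K))) * (KX / s) = KX ^ 2 * K ^ 3 * w := by
    field_simp
  rw [c5] at b5
  rw [c6] at b6
  rw [c7] at b7
  have hww : w * w ≤ w := by nlinarith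
  have c1 : KQ * w * K * (KQ * w) ≤ KQ ^ 2 * K * w := by
    calc KQ * w * K * (KQ * w) = KQ ^ 2 * K * (w * w) := by ring
      _ ≤ _ := by gcongr
  have c2 : KQ * w * (KD * w) ≤ KQ * KD * w := by
    calc KQ * w * (KD * w) = KQ * KD * (w * w) := by ring
      _ ≤ _ := by gcongr
  rw [residualCov_expand hΞ]
  simp only [Matrix.add_apply, Matrix.sub_apply]
  rw [abs_le] at *
  constructor <;> linarith [b1.1, b1.2, b2.1, b2.2, b3.1, b3.2, b4.1, b4.2, b5.1, b5.2, b6.1,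
    b6.2, b7.1, b7.2]

end FirstStep

/-! ### Thresholding: from entrywise errors to row sums -/

section Thresholding

/-- The summand `|σ|^q` of the sparsity level, an indicator for `q = 0`. -/
noncomputable def sparsityTerm (q σ : ℝ) : ℝ := if q = 0 then (if σ = 0 then 0 else 1) else |σ| ^ q

theorem sparsityTerm_nonneg (q σ : ℝ) : 0 ≤ sparsityTerm q σ := by
  unfold sparsityTerm; split_ifs <;> positivity

theorem rpow_le_sparsityTerm {q σ w : ℝ} (hq : 0 ≤ q) (hw : 0 < w) (h : w ≤ |σ|) :
    w ^ q ≤ sparsityTerm q σ := by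
  unfold sparsityTerm
  have hσ : σ ≠ 0 := abs_pos.1 (hw.trans_le h)
  split_ifs with h1
  · simp [h1]
  · exact Real.rpow_le_rpow hw.le h hq

/-- Charges an error of size w at a large entry to the sparsity sum, through w = w^(1-q) w^q. -/
theorem le_rpow_mul_sparsityTerm {q σ w : ℝ} (hq : 0 ≤ q) (hw : 0 < w) (h : w ≤ |σ|) :
    w ≤ w ^ (1 - q) * sparsityTerm q σ := by
  calc w = w ^ (1 - q) * w ^ q := by rw [← Real.rpow_add hw]; simp
    _ ≤ _ := by gcongr; exact rpow_le_sparsityTerm hq hw h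

/-- The counterpart for entries that are set to zero, where the error is |σ| itself. -/
theorem abs_le_rpow_mul_sparsityTerm {q σ y : ℝ} (hq1 : q ≤ 1) (h : |σ| ≤ y) :
    |σ| ≤ y ^ (1 - q) * sparsityTerm q σ := by
  have hy : 0 ≤ y := (abs_nonneg _).trans h
  rcases eq_or_ne σ 0 with h0 | h0
  · rw [h0, abs_zero]
    exact mul_nonneg (Real.rpow_nonneg hy _) (sparsityTerm_nonneg _ _)
  unfold sparsityTerm
  have hσ : 0 < |σ| := abs_pos.2 h0
  split_ifs with h1
  · simpa [h1] using h
  · calc |σ| = |σ| ^ (1 - q) * |σ| ^ q := by rw [← Real.rpow_add hσ]; simp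
      _ ≤ _ := by gcongr

/-- If |z| < τ the estimate is 0 and |σ| ≤ τ + K₁w ≤ Mw. Otherwise |σ| ≥ τ - K₁w ≥ K₁w ≥ w, which is
why τ ≥ 2K₁w is required, and the error is at most τ + K₁w. Either way it is charged to the sparsity
term of σ. -/
theorem thresholding_error {a b C₁ K₁ M q τ w z σ : ℝ} {s : ℝ → ℝ → ℝ} (hs : IsThresholding a b s)
    (hK : 1 ≤ K₁) (hq : 0 ≤ q) (hq1 : q ≤ 1) (hw : 0 < w) (hz : |z - σ| ≤ K₁ * w)
    (hτ1 : 2 * K₁ * w ≤ τ) (hτ2 : τ ≤ C₁ * w) (hM : C₁ + K₁ ≤ M) :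
    |s τ z - σ| ≤ M * (w ^ (1 - q) * sparsityTerm q σ) := by
  have hτ : 0 ≤ τ := le_trans (by positivity) hτ1
  have hC₁ : 0 ≤ C₁ := by
    have := hτ.trans hτ2
    exact nonneg_of_mul_nonneg_left this hw
  have hM1 : 1 ≤ M := by linarith
  obtain ⟨h1, h2, -⟩ := hs τ z hτ
  have hz' := abs_le.1 hz
  rcases lt_or_ge |z| τ with h | h
  · rw [h1 h, zero_sub, abs_neg]
    have h3 : |σ| ≤ M * w := by
      have := abs_sub_abs_le_abs_sub σ z
      rw [abs_sub_comm] at this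
      nlinarith
    refine (abs_le_rpow_mul_sparsityTerm hq1 h3).trans ?_
    rw [Real.mul_rpow (by linarith) hw.le, mul_assoc]
    have : 0 ≤ w ^ (1 - q) * sparsityTerm q σ :=
      mul_nonneg (by positivity) (sparsityTerm_nonneg _ _)
    gcongr
    calc M ^ (1 - q) ≤ M ^ (1 : ℝ) := Real.rpow_le_rpow_of_exponent_le hM1 (by linarith)
      _ = M := Real.rpow_one M
  · have h3 : w ≤ |σ| := by
      have := abs_sub_abs_le_abs_sub z σ
      nlinarith
    have h4 : |s τ z - σ| ≤ M * w := by
      calc |s τ z - σ| = |(s τ z - z) + (z - σ)| := by ring_nf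
        _ ≤ |s τ z - z| + |z - σ| := abs_add_le _ _
        _ ≤ C₁ * w + K₁ * w := by linarith
        _ ≤ M * w := by nlinarith
    refine h4.trans ?_
    gcongr
    exact le_rpow_mul_sparsityTerm hq hw h3

variable {N : ℕ}

/-- Thresholding a matrix that is close to a sparse matrix in the maximum norm gives a matrix that
is close to it in the norm of absolute row sums. -/
theorem thresholdCov_close {a b C K₁ c₁ c₂ q w m : ℝ} {s : Fin N → Fin N → ℝ → ℝ → ℝ}
    {R Sig : Matrix (Fin N) (Fin N) ℝ}
    (hs : ∀ i j, IsThresholding a b (s i j)) (hK : 1 ≤ K₁) (hq : 0 ≤ q) (hq1 : q ≤ 1) (hw : 0 < w)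
    (hc₂ : 0 < c₂) (hwc : K₁ * w ≤ c₂ / 2) (hC : 4 * K₁ / c₂ ≤ C)
    (hdiag : ∀ i, c₂ ≤ Sig i i ∧ Sig i i ≤ c₁) (hR : ∀ i j, |R i j - Sig i j| ≤ K₁ * w)
    (hm : ∀ i, ∑ j, sparsityTerm q (Sig i j) ≤ m) (i : Fin N) :
    ∑ j, |thresholdCov C w s R i j - Sig i j| ≤ (2 * C * c₁ + K₁) * (m * w ^ (1 - q)) := by
  have hK0 : 0 < K₁ := by linarith
  have hC0 : 0 ≤ C := le_trans (by positivity) hC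
  have hc₁ : c₂ ≤ c₁ := (hdiag i).1.trans (hdiag i).2
  have hwc2 : w ≤ c₂ := by nlinarith
  have hd : ∀ i, c₂ / 2 ≤ R i i ∧ R i i ≤ 2 * c₁ := fun i => by
    have h1 := abs_le.1 (hR i i)
    have h2 := hdiag i
    constructor <;> linarith
  have hM : 0 ≤ 2 * C * c₁ + K₁ := by have := hc₂.trans_le hc₁; positivity
  have hent : ∀ j, |thresholdCov C w s R i j - Sig i j| ≤
      (2 * C * c₁ + K₁) * (w ^ (1 - q) * sparsityTerm q (Sig i j)) := fun j => by
    have hcc : 0 < c₁ := hc₂.trans_le hc₁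
    by_cases hij : i = j
    · subst hij
      simp only [thresholdCov, of_apply, if_true]
      refine (hR i i).trans ?_
      -- The diagonal is kept, and its error K₁w is charged to the sparsity term of the diagonal
      -- entry, which is at least w^q because Σ_ii ≥ c₂ ≥ w.
      have h1 : w ≤ |Sig i i| := hwc2.trans ((hdiag i).1.trans (le_abs_self _))
      have h2 := le_rpow_mul_sparsityTerm hq hw h1
      calc K₁ * w ≤ (2 * C * c₁ + K₁) * w := by nlinarith [mul_nonneg hC0 hcc.le]
        _ ≤ _ := by gcongr
    · simp only [thresholdCov, of_apply, if_neg hij]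
      -- The random factor of the threshold lies between c₂/2 and 2c₁, so τ has exact order w, and C
      -- ≥ 4K₁/c₂ yields τ ≥ 2K₁w.
      have h3 : c₂ / 2 ≤ √(R i i * R j j) := by
        apply Real.le_sqrt_of_sq_le
        rw [sq]
        exact mul_le_mul (hd i).1 (hd j).1 (by positivity) (by linarith [(hd i).1])
      have h4 : √(R i i * R j j) ≤ 2 * c₁ := by
        rw [Real.sqrt_le_left (by positivity), sq]
        exact mul_le_mul (hd i).2 (hd j).2 (by linarith [(hd j).1]) (by positivity)
      refine thresholding_error (C₁ := 2 * C * c₁) (hs i j) hK hq hq1 hw (hR i j) ?_ ?_ le_rfl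
      · rw [div_le_iff₀ hc₂] at hC
        have : 2 * K₁ ≤ C * √(R i i * R j j) := by nlinarith
        gcongr
      · have : C * √(R i i * R j j) ≤ 2 * C * c₁ := by nlinarith
        gcongr
  calc ∑ j, |thresholdCov C w s R i j - Sig i j|
      ≤ ∑ j, (2 * C * c₁ + K₁) * (w ^ (1 - q) * sparsityTerm q (Sig i j)) :=
        Finset.sum_le_sum fun j _ => hent j
    _ = (2 * C * c₁ + K₁) * (w ^ (1 - q) * ∑ j, sparsityTerm q (Sig i j)) := by
        rw [← Finset.mul_sum, ← Finset.mul_sum]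
    _ ≤ (2 * C * c₁ + K₁) * (w ^ (1 - q) * m) := by gcongr; exact hm i
    _ = _ := by ring

theorem thresholdCov_symm {C w : ℝ} {s : Fin N → Fin N → ℝ → ℝ → ℝ} (hs : ∀ i j, s i j = s j i)
    {R : Matrix (Fin N) (Fin N) ℝ} (hR : Rᵀ = R) :
    (thresholdCov C w s R)ᵀ = thresholdCov C w s R := by
  ext i j
  have h : R j i = R i j := congrFun (congrFun hR i) j
  simp only [thresholdCov, transpose_apply, of_apply]
  by_cases hij : i = j
  · subst hij; rfl
  · rw [if_neg hij, if_neg (Ne.symm hij), hs j i, mul_comm (R j j), h]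

theorem residualCov_symm {T r : ℕ} (Y : Matrix (Fin N) (Fin T) ℝ) (ν : Fin r → ℝ)
    (Ξ : Matrix (Fin N) (Fin r) ℝ) : (residualCov Y ν Ξ)ᵀ = residualCov Y ν Ξ := by
  simp [residualCov, sampleCov, transpose_sum, transpose_vecMulVec]

end Thresholding

/-! ### Inverting the thresholded covariance matrix -/

section Inverse

variable {N : ℕ}

theorem rowSum_mul_le {A B : Matrix (Fin N) (Fin N) ℝ} {a b : ℝ} (i : Fin N)
    (hb : 0 ≤ b) (hA : ∑ j, |A i j| ≤ a) (hB : ∀ i, ∑ j, |B i j| ≤ b) :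
    ∑ j, |(A * B) i j| ≤ a * b := by
  calc ∑ j, |(A * B) i j| ≤ ∑ j, ∑ k, |A i k| * |B k j| := Finset.sum_le_sum fun j _ => by
        rw [Matrix.mul_apply]
        refine (Finset.abs_sum_le_sum_abs _ _).trans_eq ?_
        simp [abs_mul]
    _ = ∑ k, |A i k| * ∑ j, |B k j| := by rw [Finset.sum_comm]; simp [Finset.mul_sum]
    _ ≤ ∑ k, |A i k| * b := Finset.sum_le_sum fun k _ => by gcongr; exact hB k
    _ = (∑ k, |A i k|) * b := by rw [Finset.sum_mul]
    _ ≤ a * b := by gcongr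

/-- What is used of the estimated weight matrix `What`, an approximation of `W`. -/
structure WeightBounds (c₁ KW η : ℝ) (W What : Matrix (Fin N) (Fin N) ℝ) : Prop where
  symm : Whatᵀ = What
  quadForm_ge : ∀ x, (2 * c₁)⁻¹ * (x ⬝ᵥ x) ≤ x ⬝ᵥ (What *ᵥ x)
  rowSum : ∀ i, ∑ j, |What i j| ≤ 2 * KW
  rowSum_sub : ∀ i, ∑ j, |(What - W) i j| ≤ 2 * KW ^ 2 * η
  colSum_sub : ∀ j, ∑ i, |(What - W) i j| ≤ 2 * KW ^ 2 * η

/-- A perturbation Δ with row sums at most η is symmetric, so Schur's test bounds it in operator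
norm too and Σ̂ stays between c₂/2 and 2c₁. The inverses are compared by Σ̂⁻¹ - Σ⁻¹ = -Σ̂⁻¹ΔΣ⁻¹ in
the row sum norm. -/
theorem weightBounds_of_close {Sig Shat : Matrix (Fin N) (Fin N) ℝ} {c₁ c₂ KW η : ℝ}
    (hS : Sigᵀ = Sig) (hSh : Shatᵀ = Shat) (hc₁ : 0 < c₁) (hc₂ : 0 < c₂)
    (h1 : ∀ x, c₂ * (x ⬝ᵥ x) ≤ x ⬝ᵥ (Sig *ᵥ x)) (h2 : ∀ x, x ⬝ᵥ (Sig *ᵥ x) ≤ c₁ * (x ⬝ᵥ x))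
    (hKW : 0 ≤ KW) (hW : ∀ i, ∑ j, |Sig⁻¹ i j| ≤ KW) (hη : 0 ≤ η) (hη1 : η ≤ c₂ / 2) (hη2 : η ≤ c₁)
    (hη3 : KW * η ≤ 1 / 2) (hd : ∀ i, ∑ j, |Shat i j - Sig i j| ≤ η) :
    WeightBounds c₁ KW η Sig⁻¹ Shat⁻¹ := by
  set Δ := Shat - Sig with hΔ
  have hdr : ∀ i, ∑ j, |Δ i j| ≤ η := hd
  have hΔs : Δᵀ = Δ := by rw [hΔ, transpose_sub, hS, hSh]
  have hdc : ∀ j, ∑ i, |Δ i j| ≤ η := fun j => by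
    refine le_of_eq_of_le (Finset.sum_congr rfl fun i _ => ?_) (hdr j)
    rw [← congrFun (congrFun hΔs j) i, transpose_apply]
  have hq : ∀ x, |x ⬝ᵥ (Δ *ᵥ x)| ≤ η * (x ⬝ᵥ x) := fun x => by
    refine (abs_dotProduct_le _ _).trans ?_
    rw [← vnorm_sq_eq_dotProduct]
    have := vnorm_mulVec_le_of_sums hη hdr hdc x
    nlinarith [vnorm_nonneg x]
  have hSe : Shat = Sig + Δ := by rw [hΔ]; abel
  have hqq : ∀ x, x ⬝ᵥ (Shat *ᵥ x) = x ⬝ᵥ (Sig *ᵥ x) + x ⬝ᵥ (Δ *ᵥ x) := fun x => by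
    rw [hSe, add_mulVec, dotProduct_add]
  have hxx : ∀ x : Fin N → ℝ, 0 ≤ x ⬝ᵥ x := fun x => by
    rw [← vnorm_sq_eq_dotProduct]; positivity
  have hlow : ∀ x, c₂ / 2 * (x ⬝ᵥ x) ≤ x ⬝ᵥ (Shat *ᵥ x) := fun x => by
    have := (abs_le.1 (hq x)).1
    rw [hqq]
    nlinarith [h1 x, hxx x]
  have hup : ∀ x, x ⬝ᵥ (Shat *ᵥ x) ≤ (2 * c₁) * (x ⬝ᵥ x) := fun x => by
    have := (abs_le.1 (hq x)).2
    rw [hqq]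
    nlinarith [h2 x, hxx x]
  have hu := (isUnit_iff_isUnit_det _).1 (isUnit_of_quadForm_pos (by positivity) hlow)
  have huS := (isUnit_iff_isUnit_det _).1 (isUnit_of_quadForm_pos hc₂ h1)
  have hsym : (Shat⁻¹)ᵀ = Shat⁻¹ := by rw [transpose_nonsing_inv, hSh]
  have hsub : Shat⁻¹ - Sig⁻¹ = -(Shat⁻¹ * Δ * Sig⁻¹) := by
    rw [hΔ, Matrix.mul_sub, nonsing_inv_mul _ hu, Matrix.sub_mul, Matrix.one_mul, Matrix.mul_assoc,
      mul_nonsing_inv _ huS, Matrix.mul_one, neg_sub]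
  have hrs : ∀ i, ∑ j, |(Shat⁻¹ - Sig⁻¹) i j| ≤ (∑ j, |Shat⁻¹ i j|) * η * KW := fun i => by
    have := rowSum_mul_le (A := Shat⁻¹ * Δ) (B := Sig⁻¹) i hKW
      (rowSum_mul_le i hη le_rfl hdr) hW
    refine le_of_eq_of_le ?_ this
    rw [hsub]
    simp
  have hrow : ∀ i, ∑ j, |Shat⁻¹ i j| ≤ 2 * KW := by
    rcases isEmpty_or_nonempty (Fin N) with h | h
    · exact fun i => (h.false i).elim
    -- A self-consistent bound: the largest row sum m of Σ̂⁻¹ satisfies m ≤ m·η·KW + KW with η·KW ≤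
    -- 1/2, so m ≤ 2KW.
    obtain ⟨i0, hi0⟩ := Finite.exists_max (fun i => ∑ j, |Shat⁻¹ i j|)
    have h3 : ∑ j, |Shat⁻¹ i0 j| ≤ ∑ j, |(Shat⁻¹ - Sig⁻¹) i0 j| + ∑ j, |Sig⁻¹ i0 j| := by
      rw [← Finset.sum_add_distrib]
      refine Finset.sum_le_sum fun j _ => ?_
      have := abs_add_le ((Shat⁻¹ - Sig⁻¹) i0 j) (Sig⁻¹ i0 j)
      simpa using this
    have h4 : 0 ≤ ∑ j, |Shat⁻¹ i0 j| := Finset.sum_nonneg fun _ _ => abs_nonneg _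
    have h5 := hrs i0
    have h6 := hW i0
    intro i
    refine (hi0 i).trans ?_
    nlinarith
  have hsubrow : ∀ i, ∑ j, |(Shat⁻¹ - Sig⁻¹) i j| ≤ 2 * KW ^ 2 * η := fun i =>
    (hrs i).trans (by nlinarith [hrow i, mul_nonneg hη hKW])
  refine ⟨hsym, ?_, hrow, hsubrow, fun j => ?_⟩
  · exact quadForm_inv_ge hSh (mul_nonsing_inv _ hu) (by positivity)
      (fun x => le_trans (mul_nonneg (by positivity) (hxx x)) (hlow x)) hup
  · refine le_of_eq_of_le (Finset.sum_congr rfl fun i _ => ?_) (hsubrow j)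
    have : (Shat⁻¹ - Sig⁻¹)ᵀ = Shat⁻¹ - Sig⁻¹ := by
      rw [transpose_sub, hsym, transpose_nonsing_inv, hS]
    rw [← congrFun (congrFun this j) i, transpose_apply]

end Inverse

/-! ### Weighted principal components: factors, rotation and loadings -/

section SecondStep

open scoped Matrix.Norms.Frobenius

variable {N T r : ℕ}

/-- Bounds for the weighted averages of the idiosyncratic terms, with the population weights. -/
structure ScoreBounds (x τ L Lf : ℝ) (Λ : Matrix (Fin N) (Fin r) ℝ) (F : Matrix (Fin T) (Fin r) ℝ)
    (U : Matrix (Fin N) (Fin T) ℝ) (W : Matrix (Fin N) (Fin N) ℝ) : Prop where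
  one_le : 1 ≤ x
  τ_nonneg : 0 ≤ τ
  L_nonneg : 0 ≤ L
  Lf_nonneg : 0 ≤ Lf
  load_norm : ‖Uᵀ * W * Λ‖ ≤ √N * √T * x
  load_row : ∀ t, vnorm ((Uᵀ * W * Λ) t) ≤ √N * τ * x
  gram_norm : ‖Uᵀ * W * U‖ ≤ (T * √N + N * √T) * x
  gram_row : ∀ t, vnorm ((Uᵀ * W * U) t) ≤ (√T * √N * τ + N) * x
  u_le : ∀ i t, |U i t| ≤ L
  f_le : ∀ t, vnorm (F t) ≤ Lf

variable {K κ ε : ℝ} {Λ : Matrix (Fin N) (Fin r) ℝ} {F : Matrix (Fin T) (Fin r) ℝ}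
  {U : Matrix (Fin N) (Fin T) ℝ} {Sig : Matrix (Fin N) (Fin N) ℝ}

namespace SampleBounds

theorem sq_col_le (h : SampleBounds K κ ε Λ F U Sig) (k : Fin r) :
    vnorm (fun t => F t k) ^ 2 ≤ T * K := by
  have hT : (0 : ℝ) < T := by exact_mod_cast h.T_pos
  have h1 := (le_abs_self _).trans ((abs_entry_le _ k k).trans h.factor_upper)
  have h2 : ((T : ℝ)⁻¹ • (Fᵀ * F)) k k = (T : ℝ)⁻¹ * vnorm (fun t => F t k) ^ 2 := by
    rw [vnorm_sq_eq_dotProduct]; rfl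
  rwa [h2, inv_mul_le_iff₀ hT] at h1

theorem norm_factors (h : SampleBounds K κ ε Λ F U Sig) : ‖F‖ ≤ √T * K ^ 2 := by
  have hK := h.K_pos
  apply le_of_sq_le_sq _ (by positivity)
  rw [frob_sq_cols, mul_pow, Real.sq_sqrt (by positivity)]
  have hr : (r : ℝ) ≤ K ^ 2 := by
    have := pow_le_pow_left₀ (Real.sqrt_nonneg r) h.sqrt_le 2
    rwa [Real.sq_sqrt (by positivity)] at this
  calc ∑ k, vnorm (fun t => F t k) ^ 2 ≤ ∑ _k : Fin r, T * K :=
        Finset.sum_le_sum fun k _ => h.sq_col_le k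
    _ = r * (T * K) := by simp
    _ ≤ K ^ 2 * (T * K) := by gcongr
    _ = T * (K ^ 2 * K * 1) := by ring
    _ ≤ T * (K ^ 2 * K * K) := by gcongr; exact h.one_le
    _ = _ := by ring

theorem norm_row_U (h : SampleBounds K κ ε Λ F U Sig) (i : Fin N) :
    vnorm (U i) ≤ √T * (2 * K) := by
  have hT : (0 : ℝ) < T := by exact_mod_cast h.T_pos
  have hK := h.K_pos
  apply le_of_sq_le_sq _ (by positivity)
  rw [mul_pow, Real.sq_sqrt (by positivity)]
  have h1 := (le_abs_self _).trans (h.cov i i)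
  have h2 : ((T : ℝ)⁻¹ • (U * Uᵀ)) i i = (T : ℝ)⁻¹ * vnorm (U i) ^ 2 := by
    rw [vnorm_sq_eq_dotProduct]; rfl
  have h3 := (le_abs_self _).trans ((abs_le_vnorm _ i).trans (h.row_le i))
  have h4 : K * ε ≤ K := mul_le_of_le_one_right hK.le h.ε_le_one
  rw [h2] at h1
  have h5 : (T : ℝ)⁻¹ * vnorm (U i) ^ 2 ≤ 2 * K := by linarith
  rw [inv_mul_le_iff₀ hT] at h5
  refine h5.trans ?_
  gcongr
  nlinarith [h.one_le]

theorem norm_U (h : SampleBounds K κ ε Λ F U Sig) : ‖U‖ ≤ √N * (√T * (2 * K)) :=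
  frob_le_of_rows (by have := h.K_pos; positivity) h.norm_row_U

/-- The leading eigenvalues of the weighted Gram matrix are of order `N T`. -/
theorem weighted_eigenvalue_ge (h : SampleBounds K κ ε Λ F U Sig) (hκ1 : κ ≤ 1) {c₁ KW η : ℝ}
    {W What : Matrix (Fin N) (Fin N) ℝ} (hc₁ : 0 < c₁) (hW : WeightBounds c₁ KW η W What)
    (hε : K * ε ≤ κ ^ 2 / 2) {v : Fin r → ℝ} {V : Matrix (Fin T) (Fin r) ℝ}
    (hV : IsLeadingEigensystem ((Λ * Fᵀ + U)ᵀ * What * (Λ * Fᵀ + U)) v V) (l : Fin r) :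
    κ ^ 4 / (8 * c₁ * K) * (N * T) ≤ v l := by
  have hN : (0 : ℝ) < N := by exact_mod_cast h.N_pos
  have hT : (0 : ℝ) < T := by exact_mod_cast h.T_pos
  have hκ := h.κ_pos
  have hK := h.K_pos
  set G := (T : ℝ)⁻¹ • (Fᵀ * F) with hG
  set D := (T : ℝ)⁻¹ • (U * F) with hD
  have hFF : ∀ z, (F *ᵥ z) ⬝ᵥ (F *ᵥ z) = T * (z ⬝ᵥ (G *ᵥ z)) := fun z => by
    rw [hG, smul_mulVec, dotProduct_smul, ← mulVec_mulVec, smul_eq_mul, mul_inv_cancel_left₀ hT.ne']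
    conv_rhs => rw [dotProduct_mulVec, vecMul_transpose]
  have hzz : ∀ z : Fin r → ℝ, 0 ≤ z ⬝ᵥ z := fun z => by
    rw [← vnorm_sq_eq_dotProduct]; positivity
  -- The test subspace is the column space of `F`. There YFz = T(ΛGz + Dz), and the first summand is
  -- at least twice the bound on the second.
  refine hV.le_of_rayleigh (by simp [hW.symm, Matrix.mul_assoc]) F (by positivity)
    (fun z hz => ?_) (fun z => ?_) l
  · have h1 := hFF z
    rw [hz, dotProduct_zero] at h1
    have h2 := h.factor_lower z
    have h3 : z ⬝ᵥ (G *ᵥ z) = 0 := (mul_eq_zero.1 h1.symm).resolve_left hT.ne'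
    rw [← hG, h3] at h2
    have h4 : z ⬝ᵥ z = 0 := by nlinarith [hzz z]
    exact dotProduct_self_eq_zero.1 h4
  · set Y := Λ * Fᵀ + U with hY
    have h1 : (F *ᵥ z) ⬝ᵥ ((Yᵀ * What * Y) *ᵥ (F *ᵥ z)) =
        (Y *ᵥ (F *ᵥ z)) ⬝ᵥ (What *ᵥ (Y *ᵥ (F *ᵥ z))) := by
      rw [← mulVec_mulVec, ← mulVec_mulVec, dotProduct_mulVec, vecMul_transpose]
    have h2 : Y *ᵥ (F *ᵥ z) = (T : ℝ) • (Λ *ᵥ (G *ᵥ z) + D *ᵥ z) := by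
      rw [hY, hG, hD, add_mulVec, smul_mulVec, smul_mulVec, mulVec_smul, ← smul_add,
        smul_inv_smul₀ hT.ne']
      simp only [mulVec_mulVec, Matrix.mul_assoc]
    have hz0 := vnorm_nonneg z
    have h3 : κ * vnorm z ≤ vnorm (G *ᵥ z) := by
      have h4 := (h.factor_lower z).trans (le_of_abs_le (abs_dotProduct_le z (G *ᵥ z)))
      rw [← vnorm_sq_eq_dotProduct] at h4
      rcases eq_or_lt_of_le hz0 with h5 | h5
      · rw [← h5, mul_zero]; exact vnorm_nonneg _
      · exact le_of_mul_le_mul_left (by linarith) h5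
    have h4 : √N * (κ ^ 2 * vnorm z) ≤ vnorm (Λ *ᵥ (G *ᵥ z)) := by
      apply le_of_sq_le_sq _ (vnorm_nonneg _)
      rw [vnorm_sq_eq_dotProduct (Λ *ᵥ _), mul_pow, Real.sq_sqrt hN.le]
      refine le_trans ?_ (h.pervasive _)
      rw [← vnorm_sq_eq_dotProduct]
      calc (N : ℝ) * (κ ^ 2 * vnorm z) ^ 2 = N * (κ * κ) * (κ * vnorm z) ^ 2 := by ring
        _ ≤ N * (κ * 1) * vnorm (G *ᵥ z) ^ 2 := by gcongr
        _ = _ := by ring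
    have h5 : vnorm (D *ᵥ z) ≤ √N * (κ ^ 2 / 2 * vnorm z) := by
      refine (vnorm_mulVec_le _ _).trans ?_
      rw [← mul_assoc]
      gcongr
      exact h.norm_cross.trans (by gcongr)
    have h6 : √N * (κ ^ 2 / 2 * vnorm z) ≤ vnorm (Λ *ᵥ (G *ᵥ z) + D *ᵥ z) := by
      have := vnorm_sub_le (Λ *ᵥ (G *ᵥ z) + D *ᵥ z) (D *ᵥ z)
      rw [add_sub_cancel_right] at this
      linarith
    have h7 : vnorm (F *ᵥ z) ^ 2 ≤ T * (K * vnorm z ^ 2) := by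
      rw [vnorm_sq_eq_dotProduct (F *ᵥ z), hFF]
      gcongr
      refine (le_of_abs_le (abs_dotProduct_le z (G *ᵥ z))).trans ?_
      have := (vnorm_mulVec_le G z).trans (mul_le_mul_of_nonneg_right h.factor_upper hz0)
      nlinarith
    have h8 : T ^ 2 * (N * (κ ^ 4 / 4 * vnorm z ^ 2)) ≤ vnorm (Y *ᵥ (F *ᵥ z)) ^ 2 := by
      rw [h2, vnorm_smul, mul_pow, sq_abs]
      gcongr
      calc (N : ℝ) * (κ ^ 4 / 4 * vnorm z ^ 2) = (√N * (κ ^ 2 / 2 * vnorm z)) ^ 2 := by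
            rw [mul_pow, Real.sq_sqrt hN.le]; ring
        _ ≤ _ := by gcongr
    rw [h1]
    refine le_trans ?_ (hW.quadForm_ge _)
    rw [← vnorm_sq_eq_dotProduct, ← vnorm_sq_eq_dotProduct]
    -- In the constant, 1/(2c₁) comes from the weights, κ⁴/4 from the signal and 1/K from ‖Fz‖² ≤
    -- TK‖z‖².
    calc κ ^ 4 / (8 * c₁ * K) * (N * T) * vnorm (F *ᵥ z) ^ 2
        ≤ κ ^ 4 / (8 * c₁ * K) * (N * T) * (T * (K * vnorm z ^ 2)) := by gcongr
      _ = (2 * c₁)⁻¹ * (T ^ 2 * (N * (κ ^ 4 / 4 * vnorm z ^ 2))) := by field_simp; ring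
      _ ≤ _ := by gcongr

end SampleBounds

theorem rotationMatrix_eq {v : Fin r → ℝ} (hv : ∀ l, v l ≠ 0) (hN : 0 < N) (hT : 0 < T)
    (Fhat F : Matrix (Fin T) (Fin r) ℝ) (Λ : Matrix (Fin N) (Fin r) ℝ)
    (W : Matrix (Fin N) (Fin N) ℝ) :
    rotationMatrix v Fhat F Λ W = diagonal (fun l => (v l)⁻¹) * (Fhatᵀ * F * Λᵀ * W * Λ) := by
  have hN' : (N : ℝ) ≠ 0 := by exact_mod_cast hN.ne'
  have hT' : (T : ℝ) ≠ 0 := by exact_mod_cast hT.ne'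
  have h1 : (diagonal fun k => v k / ((N : ℝ) * T))⁻¹ = diagonal fun k => (N : ℝ) * T * (v k)⁻¹ := by
    apply inv_eq_right_inv
    rw [diagonal_mul_diagonal, ← diagonal_one]
    congr 1
    funext k
    have := hv k
    field_simp
  rw [rotationMatrix, h1, Matrix.mul_smul, ← Matrix.smul_mul, ← diagonal_smul]
  congr 2
  funext k
  simp only [Pi.smul_apply, smul_eq_mul]
  field_simp

/-- Insert Y = ΛF' + U into F̂ = Y'ŴYF̂ diag(v)⁻¹. Of the four products, the one without `U` equals
FH'; this is the reason for the definition of `H`. -/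
theorem factorEst_sub_eq {Y : Matrix (Fin N) (Fin T) ℝ} {v : Fin r → ℝ} (hv : ∀ l, v l ≠ 0)
    {Fhat : Matrix (Fin T) (Fin r) ℝ} {What : Matrix (Fin N) (Fin N) ℝ} (hW : Whatᵀ = What)
    (hY : Y = Λ * Fᵀ + U) (he : Yᵀ * What * Y * Fhat = Fhat * diagonal v)
    {H : Matrix (Fin r) (Fin r) ℝ}
    (hH : H = diagonal (fun l => (v l)⁻¹) * (Fhatᵀ * F * Λᵀ * What * Λ)) :
    Fhat - F * Hᵀ = (F * ((Uᵀ * What * Λ)ᵀ * Fhat) + (Uᵀ * What * Λ) * (Fᵀ * Fhat) +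
      (Uᵀ * What * U) * Fhat) * diagonal (fun l => (v l)⁻¹) := by
  have h1 : Fhat = Yᵀ * What * Y * Fhat * diagonal (fun l => (v l)⁻¹) := by
    rw [he, Matrix.mul_assoc, diagonal_mul_diagonal]
    simp [fun l => mul_inv_cancel₀ (hv l)]
  conv_lhs => rw [h1]
  rw [hH, hY]
  simp only [transpose_mul, transpose_add, transpose_transpose, diagonal_transpose, hW,
    Matrix.add_mul, Matrix.mul_add, Matrix.mul_assoc]
  abel

variable {c₁ KW η x τ L Lf : ℝ} {W What : Matrix (Fin N) (Fin N) ℝ}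
  {v : Fin r → ℝ} {Fhat : Matrix (Fin T) (Fin r) ℝ} {cv : ℝ}

theorem norm_diagonal_inv_le (h : SampleBounds K κ ε Λ F U Sig) (hcv : 0 < cv)
    (hv : ∀ l, cv * (N * T) ≤ v l) :
    ‖diagonal fun l => (v l)⁻¹‖ ≤ K / (cv * (N * T)) := by
  have hN : (0 : ℝ) < N := by exact_mod_cast h.N_pos
  have hT : (0 : ℝ) < T := by exact_mod_cast h.T_pos
  have hv0 : ∀ l, 0 < v l := fun l => lt_of_lt_of_le (by positivity) (hv l)
  refine (frob_diagonal_le (c := (cv * (N * T))⁻¹) (by positivity) fun l => ?_).trans ?_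
  · rw [abs_of_pos (inv_pos.2 (hv0 l))]
    exact inv_anti₀ (by positivity) (hv l)
  · rw [div_eq_mul_inv]
    gcongr
    exact h.sqrt_le

theorem norm_factorEst (h : SampleBounds K κ ε Λ F U Sig) (hF : Fhatᵀ * Fhat = (T : ℝ) • 1) :
    ‖Fhat‖ ≤ √T * K := by
  have hT : (0 : ℝ) < T := by exact_mod_cast h.T_pos
  have h1 : ((√(T : ℝ))⁻¹ • Fhat)ᵀ * ((√(T : ℝ))⁻¹ • Fhat) = 1 := by
    rw [transpose_smul, Matrix.smul_mul, Matrix.mul_smul, hF, smul_smul, smul_smul, ← mul_inv,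
      Real.mul_self_sqrt hT.le, inv_mul_cancel₀ hT.ne', one_smul]
  have h2 := frob_of_orthonormal h1
  rw [norm_smul, norm_inv, Real.norm_of_nonneg (Real.sqrt_nonneg _), inv_mul_eq_iff_eq_mul₀
    (Real.sqrt_pos.2 hT).ne'] at h2
  rw [h2]
  gcongr
  exact h.sqrt_le

/-- The estimated weights change the score matrix `U'WΛ` little. -/
theorem norm_weighted_load_le (h : SampleBounds K κ ε Λ F U Sig) (hs : ScoreBounds x τ L Lf Λ F U W)
    (hη0 : 0 ≤ η) (hr : ∀ i, ∑ j, |(What - W) i j| ≤ η) (hc : ∀ j, ∑ i, |(What - W) i j| ≤ η)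
    (hNη : 1 / √N ≤ η) :
    ‖Uᵀ * What * Λ‖ ≤ N * √T * (3 * K ^ 2 * x * η) ∧
      ∀ t, vnorm ((Uᵀ * What * Λ) t) ≤ N * (x * τ / √N + K * L * η) := by
  have hK := h.K_pos
  have hK1 := h.one_le
  have hsN := h.sqrtN_pos
  have hN : (N : ℝ) = √N ^ 2 := (Real.sq_sqrt (by positivity)).symm
  have hx := hs.one_le
  have hL := hs.L_nonneg
  have nUt : ‖Uᵀ‖ ≤ √N * (√T * (2 * K)) := by rw [frobenius_norm_transpose]; exact h.norm_U
  -- The population score is controlled by moments. The error in the weights is correlated with `U`,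
  -- so its contribution is bounded crudely by norms, which suffices because its row and column sums
  -- are at most η.
  have e : Uᵀ * What * Λ = Uᵀ * W * Λ + Uᵀ * ((What - W) * Λ) := by
    simp only [Matrix.sub_mul, Matrix.mul_sub, Matrix.mul_assoc]; abel
  have n1 : ‖(What - W) * Λ‖ ≤ η * (√N * K) :=
    (frob_mul_le_of_sums hη0 hr hc Λ).trans (by gcongr; exact h.norm_loadings)
  constructor
  · rw [e]
    refine (norm_add_le _ _).trans ((add_le_add hs.load_norm ((frobenius_norm_mul _ _).trans
      (mul_le_mul nUt n1 (norm_nonneg _)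
        (by positivity)))).trans ?_)
    have h1 : √N * √T * x ≤ N * √T * (x * η) := by
      have : √(N : ℝ) ≤ N * η := by
        calc √(N : ℝ) = N * (1 / √N) := by rw [hN]; field_simp; simp
          _ ≤ N * η := by gcongr
      calc √N * √T * x ≤ (N * η) * √T * x := by gcongr
        _ = _ := by ring
    have h2 : √N * (√T * (2 * K)) * (η * (√N * K)) = N * √T * (2 * K ^ 2 * 1 * η) := by
      linear_combination (√T * 2 * K ^ 2 * η) * Real.mul_self_sqrt (Nat.cast_nonneg (α := ℝ) N)
    have h3 : N * √T * (x * η) ≤ N * √T * (K ^ 2 * x * η) := by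
      gcongr
      exact le_mul_of_one_le_left (by linarith) (one_le_pow₀ hK1)
    have h4 : N * √T * (2 * K ^ 2 * 1 * η) ≤ N * √T * (2 * K ^ 2 * x * η) := by gcongr
    rw [h2]
    linarith
  · intro t
    have e1 : (Uᵀ * What * Λ) t = (Uᵀ * W * Λ) t + (Uᵀ * ((What - W) * Λ)) t := by rw [e]; rfl
    rw [e1]
    have h1 : vnorm (Uᵀ t) ≤ √N * L := vnorm_le_of_abs_le hL fun i => hs.u_le i t
    refine (vnorm_add_le _ _).trans ((add_le_add (hs.load_row t) ((vnorm_mul_row_le _ _ _).trans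
      (mul_le_mul h1 n1 (norm_nonneg _) (by positivity)))).trans_eq ?_)
    rw [hN]
    simp only [Real.sqrt_sq, Real.sqrt_nonneg]
    field_simp

/-- The estimated weights change the Gram matrix `U'WU` little. -/
theorem norm_weighted_gram_le (h : SampleBounds K κ ε Λ F U Sig) (hs : ScoreBounds x τ L Lf Λ F U W)
    (hη0 : 0 ≤ η) (hr : ∀ i, ∑ j, |(What - W) i j| ≤ η) (hc : ∀ j, ∑ i, |(What - W) i j| ≤ η)
    (hNη : 1 / √N ≤ η) (hTη : 1 / √T ≤ η) :
    ‖Uᵀ * What * U‖ ≤ N * T * (6 * K ^ 2 * x * η) ∧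
      ∀ t, vnorm ((Uᵀ * What * U) t) ≤ N * √T * (x * τ / √N + x * η + 2 * K * L * η) := by
  have hK := h.K_pos
  have hK1 := h.one_le
  have hx := hs.one_le
  have hL := hs.L_nonneg
  obtain ⟨sN, hsN⟩ : ∃ s, s = √(N : ℝ) := ⟨_, rfl⟩
  obtain ⟨sT, hsT⟩ : ∃ s, s = √(T : ℝ) := ⟨_, rfl⟩
  have hsN0 : 0 < sN := hsN ▸ h.sqrtN_pos
  have hsT0 : 0 < sT := hsT ▸ Real.sqrt_pos.2 (by exact_mod_cast h.T_pos)
  have hN : (N : ℝ) = sN ^ 2 := by rw [hsN, Real.sq_sqrt (by positivity)]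
  have hT : (T : ℝ) = sT ^ 2 := by rw [hsT, Real.sq_sqrt (by positivity)]
  have e : Uᵀ * What * U = Uᵀ * W * U + Uᵀ * ((What - W) * U) := by
    simp only [Matrix.sub_mul, Matrix.mul_sub, Matrix.mul_assoc]; abel
  have nU : ‖Uᵀ‖ ≤ √N * (√T * (2 * K)) := by rw [frobenius_norm_transpose]; exact h.norm_U
  have n1 : ‖(What - W) * U‖ ≤ η * (√N * (√T * (2 * K))) :=
    (frob_mul_le_of_sums hη0 hr hc U).trans (by gcongr; exact h.norm_U)
  have hgn := hs.gram_norm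
  have hgr := hs.gram_row
  rw [← hsN] at hNη nU n1 hgn ⊢
  rw [← hsT] at hTη nU n1 hgn ⊢
  rw [← hsN, ← hsT] at hgr
  rw [div_le_iff₀ hsN0] at hNη
  rw [div_le_iff₀ hsT0] at hTη
  rw [hN, hT] at hgn
  rw [hN] at hgr
  rw [hN, hT]
  constructor
  · rw [e]
    refine (norm_add_le _ _).trans ((add_le_add hgn ((frobenius_norm_mul _ _).trans
      (mul_le_mul nU n1 (norm_nonneg _)
        (by positivity)))).trans ?_)
    have h1 : sT ^ 2 * sN * 1 ≤ sT ^ 2 * sN * (η * sN) := by gcongr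
    have h2 : sN ^ 2 * sT * 1 ≤ sN ^ 2 * sT * (η * sT) := by gcongr
    have h3 : (sT ^ 2 * sN + sN ^ 2 * sT) * x ≤ (2 * (sN ^ 2 * sT ^ 2 * η)) * x := by
      gcongr
      linarith
    have h4 : sN ^ 2 * sT ^ 2 * η * x * 1 ≤ sN ^ 2 * sT ^ 2 * η * x * K ^ 2 := by
      gcongr; nlinarith
    have h5 : sN ^ 2 * sT ^ 2 * η * K ^ 2 * 1 ≤ sN ^ 2 * sT ^ 2 * η * K ^ 2 * x := by
      gcongr
    nlinarith
  · intro t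
    have e1 : (Uᵀ * What * U) t = (Uᵀ * W * U) t + (Uᵀ * ((What - W) * U)) t := by rw [e]; rfl
    rw [e1]
    have h1 : vnorm (Uᵀ t) ≤ sN * L := hsN ▸ vnorm_le_of_abs_le hL fun i => hs.u_le i t
    refine (vnorm_add_le _ _).trans ((add_le_add (hgr t) ((vnorm_mul_row_le _ _ _).trans
      (mul_le_mul h1 n1 (norm_nonneg _) (by positivity)))).trans ?_)
    have h2 : sN ^ 2 * 1 * x ≤ sN ^ 2 * (η * sT) * x := by gcongr
    have h3 : sN ^ 2 * sT * (x * τ / sN + x * η + 2 * K * L * η) =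
        sT * sN * τ * x + sN ^ 2 * sT * (x * η) + sN ^ 2 * sT * (2 * K * L * η) := by
      field_simp
    rw [h3]
    nlinarith

/-- Rates of the estimated factors, up to the rotation `H`. -/
theorem factorEst_sub_le (h : SampleBounds K κ ε Λ F U Sig) (hs : ScoreBounds x τ L Lf Λ F U W)
    (hη0 : 0 ≤ η) (hr : ∀ i, ∑ j, |(What - W) i j| ≤ η) (hc : ∀ j, ∑ i, |(What - W) i j| ≤ η)
    (hNη : 1 / √N ≤ η) (hTη : 1 / √T ≤ η) (hcv : 0 < cv) (hv : ∀ l, cv * (N * T) ≤ v l)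
    (hFF : Fhatᵀ * Fhat = (T : ℝ) • 1) {X : Matrix (Fin T) (Fin r) ℝ}
    (hX : X = (F * ((Uᵀ * What * Λ)ᵀ * Fhat) + (Uᵀ * What * Λ) * (Fᵀ * Fhat) +
      (Uᵀ * What * U) * Fhat) * diagonal (fun l => (v l)⁻¹)) :
    ‖X‖ ≤ 12 * K ^ 6 * x / cv * (√T * η) ∧
      ∀ t, vnorm (X t) ≤ 3 * K ^ 5 * x / cv * (τ / √N + (L + Lf + 1) * η) := by
  have hK := h.K_pos
  have hK1 := h.one_le
  have hx := hs.one_le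
  have hx0 : 0 < x := by linarith
  have hL := hs.L_nonneg
  have hLf := hs.Lf_nonneg
  have hτ := hs.τ_nonneg
  obtain ⟨zn, zr⟩ := norm_weighted_load_le h hs hη0 hr hc hNη
  obtain ⟨gn, gr⟩ := norm_weighted_gram_le h hs hη0 hr hc hNη hTη
  have nF := h.norm_factors
  have nFh := norm_factorEst h hFF
  have nv := norm_diagonal_inv_le h hcv hv
  set Z := Uᵀ * What * Λ
  set X0 := Uᵀ * What * U
  obtain ⟨sN, hsN⟩ : ∃ s, s = √(N : ℝ) := ⟨_, rfl⟩
  obtain ⟨sT, hsT⟩ : ∃ s, s = √(T : ℝ) := ⟨_, rfl⟩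
  have hsN0 : 0 < sN := hsN ▸ h.sqrtN_pos
  have hsT0 : 0 < sT := hsT ▸ Real.sqrt_pos.2 (by exact_mod_cast h.T_pos)
  have hN : (N : ℝ) = sN ^ 2 := by rw [hsN, Real.sq_sqrt (by positivity)]
  have hT : (T : ℝ) = sT ^ 2 := by rw [hsT, Real.sq_sqrt (by positivity)]
  rw [← hsN] at zr gr
  rw [← hsT] at zn nF nFh gr
  rw [hN] at zn zr gr
  rw [hN, hT] at gn nv
  rw [← hsN, ← hsT]
  have nZF : ‖Zᵀ * Fhat‖ ≤ sN ^ 2 * sT * (3 * K ^ 2 * x * η) * (sT * K) :=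
    (frobenius_norm_mul _ _).trans (mul_le_mul (by rw [frobenius_norm_transpose]; exact zn) nFh
      (norm_nonneg _) (by positivity))
  have nFF : ‖Fᵀ * Fhat‖ ≤ sT * K ^ 2 * (sT * K) :=
    (frobenius_norm_mul _ _).trans (mul_le_mul (by rw [frobenius_norm_transpose]; exact nF) nFh
      (norm_nonneg _) (by positivity))
  have k1 : K ^ 3 ≤ K ^ 5 := pow_le_pow_right₀ hK1 (by norm_num)
  constructor
  · have m1 : ‖F * (Zᵀ * Fhat)‖ ≤ sT * K ^ 2 * (sN ^ 2 * sT * (3 * K ^ 2 * x * η) * (sT * K)) :=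
      (frobenius_norm_mul _ _).trans (mul_le_mul nF nZF (norm_nonneg _) (by positivity))
    have m2 : ‖Z * (Fᵀ * Fhat)‖ ≤ sN ^ 2 * sT * (3 * K ^ 2 * x * η) * (sT * K ^ 2 * (sT * K)) :=
      (frobenius_norm_mul _ _).trans (mul_le_mul zn nFF (norm_nonneg _) (by positivity))
    have m3 : ‖X0 * Fhat‖ ≤ sN ^ 2 * sT ^ 2 * (6 * K ^ 2 * x * η) * (sT * K) :=
      (frobenius_norm_mul _ _).trans (mul_le_mul gn nFh (norm_nonneg _) (by positivity))
    have m4 : sN ^ 2 * sT ^ 2 * (6 * K ^ 2 * x * η) * (sT * K) ≤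
        6 * K ^ 5 * x * (sN ^ 2 * sT ^ 3 * η) := by
      calc _ = 6 * K ^ 3 * x * (sN ^ 2 * sT ^ 3 * η) := by ring
        _ ≤ _ := by gcongr
    rw [hX]
    refine (frobenius_norm_mul _ _).trans ?_
    calc _ ≤ 12 * K ^ 5 * x * (sN ^ 2 * sT ^ 3 * η) * (K / (cv * (sN ^ 2 * sT ^ 2))) := by
          refine mul_le_mul ?_ nv (norm_nonneg _) (by positivity)
          refine (norm_add_le _ _).trans ?_
          have := norm_add_le (F * (Zᵀ * Fhat)) (Z * (Fᵀ * Fhat))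
          have m5 : sT * K ^ 2 * (sN ^ 2 * sT * (3 * K ^ 2 * x * η) * (sT * K)) =
            3 * K ^ 5 * x * (sN ^ 2 * sT ^ 3 * η) := by ring
          have m6 : sN ^ 2 * sT * (3 * K ^ 2 * x * η) * (sT * K ^ 2 * (sT * K)) =
            3 * K ^ 5 * x * (sN ^ 2 * sT ^ 3 * η) := by ring
          linarith
      _ = _ := by field_simp
  · intro t
    -- For a single `t` the row of `F` is controlled by `Lf` and the column of `U` by √N L, instead
    -- of by averages. This is where the uniform rate loses against the Frobenius rate above.
    have m1 : vnorm ((F * (Zᵀ * Fhat)) t) ≤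
        Lf * (sN ^ 2 * sT * (3 * K ^ 2 * x * η) * (sT * K)) :=
      (vnorm_mul_row_le _ _ _).trans (mul_le_mul (hs.f_le t) nZF (norm_nonneg _) hLf)
    have m2 : vnorm ((Z * (Fᵀ * Fhat)) t) ≤
        sN ^ 2 * (x * τ / sN + K * L * η) * (sT * K ^ 2 * (sT * K)) :=
      (vnorm_mul_row_le _ _ _).trans (mul_le_mul (zr t) nFF (norm_nonneg _) (by positivity))
    have m3 : vnorm ((X0 * Fhat) t) ≤
        sN ^ 2 * sT * (x * τ / sN + x * η + 2 * K * L * η) * (sT * K) :=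
      (vnorm_mul_row_le _ _ _).trans (mul_le_mul (gr t) nFh (norm_nonneg _) (by positivity))
    have m0 : vnorm (X t) ≤ (vnorm ((F * (Zᵀ * Fhat)) t) + vnorm ((Z * (Fᵀ * Fhat)) t) +
        vnorm ((X0 * Fhat) t)) * (K / (cv * (sN ^ 2 * sT ^ 2))) := by
      rw [hX]
      refine (vnorm_mul_row_le _ _ _).trans (mul_le_mul ?_ nv (norm_nonneg _) ?_)
      · exact (vnorm_add_le ((F * (Zᵀ * Fhat) + Z * (Fᵀ * Fhat)) t) ((X0 * Fhat) t)).trans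
          (add_le_add (vnorm_add_le ((F * (Zᵀ * Fhat)) t) ((Z * (Fᵀ * Fhat)) t)) le_rfl)
      · exact add_nonneg (add_nonneg (vnorm_nonneg _) (vnorm_nonneg _)) (vnorm_nonneg _)
    refine m0.trans ?_
    obtain ⟨y, hy⟩ : ∃ y, y = τ / sN := ⟨_, rfl⟩
    have hy0 : 0 ≤ y := by rw [hy]; positivity
    have e1 : x * τ / sN = x * y := by rw [hy]; ring
    rw [e1] at m2 m3
    rw [← hy]
    have k4 : K ^ 3 ≤ K ^ 4 := pow_le_pow_right₀ hK1 (by norm_num)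
    have k2 : K ^ 2 ≤ K ^ 4 := pow_le_pow_right₀ hK1 (by norm_num)
    have k3 : K ≤ K ^ 4 := le_self_pow₀ hK1 (by norm_num)
    have t1 : 3 * K ^ 3 * x * (Lf * η) ≤ 3 * K ^ 4 * x * (Lf * η) := by gcongr
    have t2 : K ^ 3 * (x * y) ≤ K ^ 4 * (x * y) := by gcongr
    have t3 : K ^ 4 * (L * η) * 1 ≤ K ^ 4 * (L * η) * x := by gcongr
    have t4 : K * (x * y) ≤ K ^ 4 * (x * y) := by gcongr
    have t5 : K * (x * η) ≤ K ^ 4 * (x * η) := by gcongr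
    have t6 : K ^ 2 * (L * η) * 1 ≤ K ^ 4 * (L * η) * x := by gcongr
    have t7 : 0 ≤ K ^ 4 * (x * y) := by positivity
    have t8 : 0 ≤ K ^ 4 * (x * η) := by positivity
    have t9 : 3 * K ^ 3 * x * (Lf * η) + (K ^ 3 * (x * y) + K ^ 4 * (L * η)) +
        (K * (x * y) + K * (x * η) + 2 * (K ^ 2 * (L * η))) ≤
        3 * K ^ 4 * x * (y + (L + Lf + 1) * η) := by linarith
    have t10 := mul_le_mul_of_nonneg_left t9 (by positivity : 0 ≤ sN ^ 2 * sT ^ 2)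
    have t11 : 3 * K ^ 5 * x / cv * (y + (L + Lf + 1) * η) =
        sN ^ 2 * sT ^ 2 * (3 * K ^ 4 * x * (y + (L + Lf + 1) * η)) *
          (K / (cv * (sN ^ 2 * sT ^ 2))) := by field_simp
    rw [t11]
    refine mul_le_mul_of_nonneg_right ?_ (by positivity)
    linarith

/-- From F̂'F̂ = T·1, the product (F̂'F/T)H' equals 1 - E, where E = F̂'(F̂ - FH')/T has norm at
most 1/2. So 1 - E is invertible and its factor H' must be as well. -/
theorem isUnit_rotation_of_close {H : Matrix (Fin r) (Fin r) ℝ} (hT : 0 < T)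
    (hFF : Fhatᵀ * Fhat = (T : ℝ) • 1) {e : ℝ} (he : e ≤ 1 / 2)
    (hE : ‖(T : ℝ)⁻¹ • (Fhatᵀ * (Fhat - F * Hᵀ))‖ ≤ e) :
    IsUnit H ∧ (T : ℝ)⁻¹ • (Fhatᵀ * F) = (1 - (T : ℝ)⁻¹ • (Fhatᵀ * (Fhat - F * Hᵀ))) * (Hᵀ)⁻¹ ∧
      ∀ y, vnorm ((Hᵀ)⁻¹ *ᵥ y) ≤ 2 * (‖(T : ℝ)⁻¹ • (Fhatᵀ * F)‖ * vnorm y) := by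
  set E := (T : ℝ)⁻¹ • (Fhatᵀ * (Fhat - F * Hᵀ)) with hEd
  set J := (T : ℝ)⁻¹ • (Fhatᵀ * F) with hJ
  have hT0 : (T : ℝ) ≠ 0 := by exact_mod_cast hT.ne'
  have hJH : J * Hᵀ = 1 - E := by
    rw [hEd, Matrix.mul_sub, hFF, smul_sub, smul_smul, inv_mul_cancel₀ hT0, one_smul,
      sub_sub_cancel, hJ, Matrix.smul_mul, Matrix.mul_assoc]
  have hy : ∀ y, vnorm y ≤ 2 * vnorm ((1 - E) *ᵥ y) := fun y => by
    have h1 := vnorm_add_le ((1 - E) *ᵥ y) (E *ᵥ y)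
    have h2 : (1 - E) *ᵥ y + E *ᵥ y = y := by rw [sub_mulVec, one_mulVec, sub_add_cancel]
    rw [h2] at h1
    have h3 : vnorm (E *ᵥ y) ≤ 1 / 2 * vnorm y :=
      (vnorm_mulVec_le _ _).trans (mul_le_mul_of_nonneg_right (hE.trans he) (vnorm_nonneg _))
    linarith
  have hu : IsUnit (1 - E) := by
    rw [← mulVec_injective_iff_isUnit]
    intro a b hab
    have h1 := hy (a - b)
    have h2 : (1 - E) *ᵥ (a - b) = 0 := by rw [mulVec_sub, sub_eq_zero]; exact hab
    rw [h2, vnorm_zero, mul_zero] at h1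
    exact sub_eq_zero.1 (vnorm_eq_zero.1 (le_antisymm h1 (vnorm_nonneg _)))
  have hHt : IsUnit (Hᵀ).det := by
    rw [isUnit_iff_isUnit_det, ← hJH, det_mul] at hu
    exact isUnit_of_mul_isUnit_right hu
  refine ⟨(isUnit_iff_isUnit_det _).2 (by rwa [det_transpose] at hHt), ?_, fun y => ?_⟩
  · rw [← hJH, Matrix.mul_assoc, mul_nonsing_inv _ hHt, Matrix.mul_one]
  · refine (hy _).trans ?_
    rw [← hJH, mulVec_mulVec, Matrix.mul_assoc, mul_nonsing_inv _ hHt, Matrix.mul_one]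
    gcongr
    exact vnorm_mulVec_le _ _

/-- Rates of the estimated loadings, up to the rotation `H`. -/
theorem loadingEst_sub_le (h : SampleBounds K κ ε Λ F U Sig) (hεη : ε ≤ η)
    {H : Matrix (Fin r) (Fin r) ℝ} {A KH : ℝ} (hA : 0 ≤ A)
    (hFF : Fhatᵀ * Fhat = (T : ℝ) • 1) (hKH : ‖H‖ ≤ KH)
    (hX : ‖Fhat - F * Hᵀ‖ ≤ A * (√T * η)) (hη : K * A * η ≤ 1 / 2) :
    IsUnit H ∧ ∀ j, vnorm (loadingEst (Λ * Fᵀ + U) Fhat j - (Hᵀ)⁻¹ *ᵥ Λ j) ≤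
      (2 * K ^ 5 * A + 2 * K * A + K * KH) * η := by
  have hK := h.K_pos
  have hT : (0 : ℝ) < T := by exact_mod_cast h.T_pos
  have hη0 : 0 ≤ η := h.ε_nonneg.trans hεη
  have nFh := norm_factorEst h hFF
  have hTT : √(T : ℝ) * √T = T := Real.mul_self_sqrt hT.le
  have nE : ‖(T : ℝ)⁻¹ • (Fhatᵀ * (Fhat - F * Hᵀ))‖ ≤ K * A * η := by
    rw [norm_smul, norm_inv, Real.norm_of_nonneg hT.le, inv_mul_le_iff₀ hT]
    calc _ ≤ (√T * K) * (A * (√T * η)) := (frobenius_norm_mul _ _).trans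
          (mul_le_mul (by rw [frobenius_norm_transpose]; exact nFh) hX (norm_nonneg _)
            (by positivity))
      _ = (√T * √T) * (K * A * η) := by ring
      _ = _ := by rw [hTT]
  obtain ⟨hu, hJ, hinv⟩ := isUnit_rotation_of_close h.T_pos hFF hη nE
  refine ⟨hu, fun j => ?_⟩
  set E := (T : ℝ)⁻¹ • (Fhatᵀ * (Fhat - F * Hᵀ)) with hE
  set J := (T : ℝ)⁻¹ • (Fhatᵀ * F) with hJd
  have nJ : ‖J‖ ≤ K ^ 3 := by
    rw [hJd, norm_smul, norm_inv, Real.norm_of_nonneg hT.le, inv_mul_le_iff₀ hT]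
    calc _ ≤ (√T * K) * (√T * K ^ 2) := (frobenius_norm_mul _ _).trans
          (mul_le_mul (by rw [frobenius_norm_transpose]; exact nFh) h.norm_factors (norm_nonneg _)
            (by positivity))
      _ = (√T * √T) * K ^ 3 := by ring
      _ = _ := by rw [hTT]
  -- As F̂'F/T = (1 - E)(H')⁻¹, the signal part of the estimated loading misses its target only by
  -- E(H')⁻¹λ_j. In the noise part F̂ is split as (F̂ - FH') + FH'.
  have e1 : loadingEst (Λ * Fᵀ + U) Fhat j - (Hᵀ)⁻¹ *ᵥ Λ j = -(E *ᵥ ((Hᵀ)⁻¹ *ᵥ Λ j)) +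
      (((T : ℝ)⁻¹ • (U * (Fhat - F * Hᵀ))) j + (((T : ℝ)⁻¹ • (U * F)) * Hᵀ) j) := by
    have e2 : loadingEst (Λ * Fᵀ + U) Fhat = Λ * Jᵀ +
        ((T : ℝ)⁻¹ • (U * (Fhat - F * Hᵀ)) + ((T : ℝ)⁻¹ • (U * F)) * Hᵀ) := by
      rw [loadingEst, Matrix.add_mul, smul_add, hJd]
      simp only [transpose_smul, transpose_mul, transpose_transpose, Matrix.mul_smul,
        Matrix.mul_sub, smul_sub, Matrix.smul_mul, Matrix.mul_assoc]
      abel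
    have e3 : (Λ * Jᵀ) j = J *ᵥ Λ j := by rw [mul_apply_eq_vecMul, vecMul_transpose]
    have e4 : loadingEst (Λ * Fᵀ + U) Fhat j = J *ᵥ Λ j +
        (((T : ℝ)⁻¹ • (U * (Fhat - F * Hᵀ))) j + (((T : ℝ)⁻¹ • (U * F)) * Hᵀ) j) := by
      rw [e2, ← e3]; rfl
    rw [e4, hJ, ← mulVec_mulVec, sub_mulVec, one_mulVec]
    abel
  have b1 : vnorm (E *ᵥ ((Hᵀ)⁻¹ *ᵥ Λ j)) ≤ K * A * η * (2 * (K ^ 3 * K)) := by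
    refine (vnorm_mulVec_le _ _).trans (mul_le_mul nE ((hinv _).trans ?_) (vnorm_nonneg _)
      (by positivity))
    gcongr
    exacts [vnorm_nonneg _, h.loadings j]
  have b2 : vnorm (((T : ℝ)⁻¹ • (U * (Fhat - F * Hᵀ))) j) ≤ 2 * K * A * η := by
    have : ((T : ℝ)⁻¹ • (U * (Fhat - F * Hᵀ))) j = (T : ℝ)⁻¹ • ((U * (Fhat - F * Hᵀ)) j) := rfl
    rw [this, vnorm_smul, abs_of_pos (by positivity), inv_mul_le_iff₀ hT]
    calc _ ≤ (√T * (2 * K)) * (A * (√T * η)) := (vnorm_mul_row_le _ _ _).trans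
          (mul_le_mul (h.norm_row_U j) hX (norm_nonneg _) (by positivity))
      _ = (√T * √T) * (2 * K * A * η) := by ring
      _ = _ := by rw [hTT]
  have b3 : vnorm ((((T : ℝ)⁻¹ • (U * F)) * Hᵀ) j) ≤ K * η * KH := by
    refine (vnorm_mul_row_le _ _ _).trans (mul_le_mul ((h.cross j).trans (by gcongr))
      (by rw [frobenius_norm_transpose]; exact hKH) (norm_nonneg _) (by positivity))
  rw [e1]
  refine (vnorm_add_le _ _).trans ?_
  rw [vnorm_neg]
  have := vnorm_add_le (((T : ℝ)⁻¹ • (U * (Fhat - F * Hᵀ))) j) ((((T : ℝ)⁻¹ • (U * F)) * Hᵀ) j)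
  nlinarith

theorem norm_rotation_le (h : SampleBounds K κ ε Λ F U Sig) {c₁ : ℝ} (hKW : 0 ≤ KW)
    (hW : WeightBounds c₁ KW η W What) (hcv : 0 < cv) (hv : ∀ l, cv * (N * T) ≤ v l)
    (hFF : Fhatᵀ * Fhat = (T : ℝ) • 1) :
    ‖diagonal (fun l => (v l)⁻¹) * (Fhatᵀ * F * Λᵀ * What * Λ)‖ ≤ 2 * KW * K ^ 6 / cv := by
  have hK := h.K_pos
  have hT : (0 : ℝ) < T := by exact_mod_cast h.T_pos
  have hN : (0 : ℝ) < N := by exact_mod_cast h.N_pos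
  have nFh := norm_factorEst h hFF
  have nv := norm_diagonal_inv_le h hcv hv
  have nW : ‖What * Λ‖ ≤ 2 * KW * (√N * K) := by
    refine (frob_mul_le_of_sums (by positivity) hW.rowSum (fun j => ?_) Λ).trans
      (by gcongr; exact h.norm_loadings)
    refine le_of_eq_of_le (Finset.sum_congr rfl fun i _ => ?_) (hW.rowSum j)
    rw [← congrFun (congrFun hW.symm i) j, transpose_apply]
  have hTT : √(T : ℝ) * √T = T := Real.mul_self_sqrt hT.le
  have hNN : √(N : ℝ) * √N = N := Real.mul_self_sqrt hN.le
  have e : Fhatᵀ * F * Λᵀ * What * Λ = Fhatᵀ * F * (Λᵀ * (What * Λ)) := by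
    simp only [Matrix.mul_assoc]
  rw [e]
  calc _ ≤ K / (cv * (N * T)) * ((√T * K) * (√T * K ^ 2) * ((√N * K) * (2 * KW * (√N * K)))) := by
        refine (frobenius_norm_mul _ _).trans (mul_le_mul nv ((frobenius_norm_mul _ _).trans
          (mul_le_mul ((frobenius_norm_mul _ _).trans (mul_le_mul ?_ h.norm_factors
            (norm_nonneg _) (by positivity))) ((frobenius_norm_mul _ _).trans
            (mul_le_mul ?_ nW (norm_nonneg _) (by positivity))) (norm_nonneg _) (by positivity)))
          (norm_nonneg _) (by positivity))
        · rw [frobenius_norm_transpose]; exact nFh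
        · rw [frobenius_norm_transpose]; exact h.norm_loadings
    _ = K / (cv * (N * T)) * ((√T * √T) * (√N * √N) * (2 * KW * K ^ 5)) := by ring
    _ = _ := by rw [hTT, hNN]; field_simp

end SecondStep

/-! ### Covariance inequalities under strong mixing -/

section Mixing

variable {Ω : Type*} {m0 : MeasurableSpace Ω} {μ : Measure Ω}

/-- The strong mixing coefficient of the σ-algebras `m₁` and `m₂` is at most `α`. -/
def AlphaLE (μ : Measure Ω) (m₁ m₂ : MeasurableSpace Ω) (α : ℝ) : Prop :=
  ∀ A B : Set Ω, MeasurableSet[m₁] A → MeasurableSet[m₂] B →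
    |μ.real A * μ.real B - μ.real (A ∩ B)| ≤ α

theorem AlphaLE.nonneg {m₁ m₂ : MeasurableSpace Ω} {α : ℝ} (h : AlphaLE μ m₁ m₂ α) : 0 ≤ α :=
  (abs_nonneg _).trans (h ∅ ∅ (@MeasurableSet.empty _ m₁) (@MeasurableSet.empty _ m₂))

variable [IsProbabilityMeasure μ]

/-- A function whose integrals over the sets of `m` are small has small integrals against bounded
`m`-measurable functions. -/
theorem abs_integral_mul_le_of_setIntegral {m : MeasurableSpace Ω} (hm : m ≤ m0) {φ f : Ω → ℝ}
    {ε B : ℝ} (hφ : Integrable φ μ) (hA : ∀ A, MeasurableSet[m] A → |∫ ω in A, φ ω ∂μ| ≤ ε)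
    (hf : StronglyMeasurable[m] f) (hB : ∀ ω, |f ω| ≤ B) : |∫ ω, f ω * φ ω ∂μ| ≤ 2 * B * ε := by
  have hB0 : 0 ≤ B := by
    obtain ⟨ω⟩ := nonempty_of_isProbabilityMeasure μ
    exact (abs_nonneg _).trans (hB ω)
  set D := μ[φ|m] with hD
  have hDi : Integrable D μ := integrable_condExp
  have hDm : StronglyMeasurable[m] D := stronglyMeasurable_condExp
  have hfφ : Integrable (f * φ) μ :=
    hφ.bdd_mul (hf.mono hm).aestronglyMeasurable (Eventually.of_forall fun ω => hB ω)
  have hfD : Integrable (fun ω => f ω * D ω) μ :=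
    hDi.bdd_mul (hf.mono hm).aestronglyMeasurable (Eventually.of_forall fun ω => hB ω)
  have h1 : ∫ ω, f ω * φ ω ∂μ = ∫ ω, f ω * D ω ∂μ := by
    have h2 := condExp_mul_of_stronglyMeasurable_left hf hfφ hφ
    rw [← integral_condExp hm (f := fun ω => f ω * φ ω)]
    exact integral_congr_ae h2
  -- The L¹ norm of the conditional expectation is the integral of φ over {D ≥ 0} minus that over {D
  -- < 0}, hence at most 2ε.
  have hS : MeasurableSet[m] {ω | 0 ≤ D ω} := hDm.measurable measurableSet_Ici
  have h3 : ∫ ω, |D ω| ∂μ ≤ 2 * ε := by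
    rw [← integral_add_compl (hm _ hS) hDi.abs]
    have e1 : ∫ ω in {ω | 0 ≤ D ω}, |D ω| ∂μ = ∫ ω in {ω | 0 ≤ D ω}, φ ω ∂μ := by
      rw [← setIntegral_condExp hm hφ hS]
      exact setIntegral_congr_fun (hm _ hS) fun ω hω => abs_of_nonneg hω
    have e2 : ∫ ω in {ω | 0 ≤ D ω}ᶜ, |D ω| ∂μ = -∫ ω in {ω | 0 ≤ D ω}ᶜ, φ ω ∂μ := by
      rw [← setIntegral_condExp hm hφ hS.compl, ← integral_neg]
      exact setIntegral_congr_fun (hm _ hS.compl) fun ω hω => abs_of_neg (not_le.1 hω)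
    rw [e1, e2]
    have := (abs_le.1 (hA _ hS)).2
    have := (abs_le.1 (hA _ hS.compl)).1
    linarith
  rw [h1]
  calc |∫ ω, f ω * D ω ∂μ| ≤ ∫ ω, |f ω * D ω| ∂μ := abs_integral_le_integral_abs
    _ ≤ ∫ ω, B * |D ω| ∂μ := integral_mono hfD.abs (hDi.abs.const_mul _) fun ω => by
        simp only [abs_mul]; gcongr; exact hB ω
    _ = B * ∫ ω, |D ω| ∂μ := integral_const_mul _ _
    _ ≤ B * (2 * ε) := by gcongr
    _ = _ := by ring

/-- The preceding lemma with φ = 1_A - P(A), whose integrals over sets of `m₂` are exactly the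
mixing differences, tested against `Y`. Together with a second application, now in `m₁`, it yields
the covariance inequality. -/
theorem AlphaLE.abs_setIntegral_sub_le {m₁ m₂ : MeasurableSpace Ω} {α : ℝ}
    (h : AlphaLE μ m₁ m₂ α) (h₁ : m₁ ≤ m0) (h₂ : m₂ ≤ m0) {Y : Ω → ℝ} {B : ℝ}
    (hY : StronglyMeasurable[m₂] Y) (hB : ∀ ω, |Y ω| ≤ B) {A : Set Ω} (hA : MeasurableSet[m₁] A) :
    |∫ ω in A, (Y ω - ∫ ω', Y ω' ∂μ) ∂μ| ≤ 2 * B * α := by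
  have hA0 := h₁ _ hA
  have hYi : Integrable Y μ :=
    Integrable.of_bound (hY.mono h₂).aestronglyMeasurable B (Eventually.of_forall hB)
  have hφ : Integrable (fun ω => A.indicator (fun _ => (1 : ℝ)) ω - μ.real A) μ :=
    ((integrable_const (1 : ℝ)).indicator hA0).sub (integrable_const _)
  have h3 := abs_integral_mul_le_of_setIntegral (ε := α) h₂ hφ (fun C hC => ?_) hY hB
  · refine le_of_eq_of_le ?_ h3
    congr 1
    have e1 : ∀ ω, Y ω * (A.indicator (fun _ => (1 : ℝ)) ω - μ.real A) =
        A.indicator Y ω - μ.real A * Y ω := fun ω => by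
      by_cases hω : ω ∈ A <;> simp [hω] <;> ring
    simp_rw [e1]
    rw [integral_sub (hYi.indicator hA0) (hYi.const_mul _), integral_indicator hA0,
      integral_const_mul, integral_sub hYi.integrableOn (integrable_const _)]
    simp
  · have hC0 := h₂ _ hC
    rw [integral_sub (((integrable_const (1 : ℝ)).indicator hA0).integrableOn) (integrable_const _),
      setIntegral_indicator hA0]
    simp only [integral_const, smul_eq_mul, mul_one, MeasurableSet.univ, measureReal_restrict_apply,
      Set.univ_inter]
    rw [abs_sub_comm, Set.inter_comm, mul_comm]
    exact h A C hA hC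

/-- Covariance inequality for bounded random variables. -/
theorem AlphaLE.abs_cov_le {m₁ m₂ : MeasurableSpace Ω} {α : ℝ}
    (h : AlphaLE μ m₁ m₂ α) (h₁ : m₁ ≤ m0) (h₂ : m₂ ≤ m0) {X Y : Ω → ℝ} {B₁ B₂ : ℝ}
    (hX : StronglyMeasurable[m₁] X) (hY : StronglyMeasurable[m₂] Y) (hB₁ : ∀ ω, |X ω| ≤ B₁)
    (hB₂ : ∀ ω, |Y ω| ≤ B₂) :
    |∫ ω, X ω * Y ω ∂μ - (∫ ω, X ω ∂μ) * ∫ ω, Y ω ∂μ| ≤ 4 * B₁ * B₂ * α := by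
  have hXi : Integrable X μ :=
    Integrable.of_bound (hX.mono h₁).aestronglyMeasurable B₁ (Eventually.of_forall hB₁)
  have hYi : Integrable Y μ :=
    Integrable.of_bound (hY.mono h₂).aestronglyMeasurable B₂ (Eventually.of_forall hB₂)
  have h3 := abs_integral_mul_le_of_setIntegral (φ := fun ω => Y ω - ∫ ω', Y ω' ∂μ) h₁
    (hYi.sub (integrable_const (∫ ω, Y ω ∂μ)))
    (fun A hA => h.abs_setIntegral_sub_le h₁ h₂ hY hB₂ hA) hX hB₁
  have e : ∫ ω, X ω * (Y ω - ∫ ω', Y ω' ∂μ) ∂μ =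
      ∫ ω, X ω * Y ω ∂μ - (∫ ω, X ω ∂μ) * ∫ ω, Y ω ∂μ := by
    simp only [mul_sub]
    rw [integral_sub (hYi.bdd_mul (hX.mono h₁).aestronglyMeasurable (Eventually.of_forall hB₁))
      (hXi.mul_const _), integral_mul_const]
  rw [e] at h3
  linarith

/-- Truncation of a real number to `[-l, l]`. -/
noncomputable def clip (l x : ℝ) : ℝ := max (-l) (min x l)

theorem abs_clip_le {l : ℝ} (hl : 0 ≤ l) (x : ℝ) : |clip l x| ≤ l := by
  rw [abs_le]; unfold clip
  exact ⟨le_max_left _ _, max_le (by linarith) (min_le_right _ _)⟩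

theorem clip_eq_self {l x : ℝ} (h : |x| ≤ l) : clip l x = x := by
  rw [abs_le] at h; unfold clip
  rw [min_eq_left h.2, max_eq_right h.1]

theorem abs_clip_le_abs {l : ℝ} (hl : 0 ≤ l) (x : ℝ) : |clip l x| ≤ |x| := by
  rcases le_total |x| l with h | h
  · rw [clip_eq_self h]
  · exact (abs_clip_le hl x).trans h

theorem abs_sub_clip_le {l : ℝ} (hl : 0 < l) (x : ℝ) : |x - clip l x| ≤ x ^ 2 / l := by
  rcases le_total |x| l with h | h
  · rw [clip_eq_self h, sub_self, abs_zero]; positivity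
  · have h1 : |x - clip l x| ≤ |x| := by
      unfold clip
      rcases abs_cases x with ⟨h2, h3⟩ | ⟨h2, h3⟩
      · rw [h2] at h
        rw [min_eq_right h, max_eq_right (by linarith), abs_of_nonneg (by linarith), h2]; linarith
      · rw [h2] at h
        rw [min_eq_left (by linarith), max_eq_left (by linarith), abs_of_nonpos (by linarith), h2]
        linarith
    rw [le_div_iff₀ hl, ← sq_abs]
    nlinarith [abs_nonneg x]

theorem measurable_clip (l : ℝ) : Measurable (clip l) :=
  measurable_const.max (measurable_id.min measurable_const)

theorem integrable_of_abs_le_add {X Z : Ω → ℝ} (hX : Measurable X) (hZ : Integrable Z μ)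
    (h : ∀ ω, |X ω| ≤ 1 + Z ω) : Integrable X μ :=
  Integrable.mono' ((integrable_const (1 : ℝ)).add hZ) hX.aestronglyMeasurable
    (Eventually.of_forall h)

theorem sq_mul_le_cube_add {x y : ℝ} (hx : 0 ≤ x) (hy : 0 ≤ y) : x ^ 2 * y ≤ x ^ 3 + y ^ 3 := by
  rcases le_total x y with h | h
  · nlinarith [mul_le_mul h h hx hy, pow_nonneg hx 3]
  · nlinarith [sq_nonneg x, pow_nonneg hy 3]

theorem sq_le_one_add_cube {x : ℝ} (hx : 0 ≤ x) : x ^ 2 ≤ 1 + x ^ 3 := by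
  have := sq_mul_le_cube_add hx zero_le_one; linarith

theorem le_one_add_cube {x : ℝ} (hx : 0 ≤ x) : x ≤ 1 + x ^ 3 := by
  have := sq_mul_le_cube_add zero_le_one hx; linarith

/-- Covariance inequality for random variables with bounded third moments. -/
theorem AlphaLE.abs_cov_le_of_moments {m₁ m₂ : MeasurableSpace Ω} {α : ℝ}
    (h : AlphaLE μ m₁ m₂ α) (h₁ : m₁ ≤ m0) (h₂ : m₂ ≤ m0) {X Y : Ω → ℝ} {K l : ℝ}
    (hX : Measurable[m₁] X) (hY : Measurable[m₂] Y)
    (hX3 : Integrable (fun ω => |X ω| ^ 3) μ) (hY3 : Integrable (fun ω => |Y ω| ^ 3) μ)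
    (hXK : ∫ ω, |X ω| ^ 3 ∂μ ≤ K) (hYK : ∫ ω, |Y ω| ^ 3 ∂μ ≤ K) (hl : 0 < l) (hα : α * l ^ 3 ≤ 1) :
    |∫ ω, X ω * Y ω ∂μ - (∫ ω, X ω ∂μ) * ∫ ω, Y ω ∂μ| ≤ 10 * (1 + K) ^ 2 / l := by
  have hXm : Measurable[m0] X := hX.mono h₁ le_rfl
  have hYm : Measurable[m0] Y := hY.mono h₂ le_rfl
  have hK : 0 ≤ K := (integral_nonneg fun ω => by positivity).trans hXK
  have hcm := measurable_clip l
  have key : ∀ {V : Ω → ℝ}, Measurable[m0] V → Integrable (fun ω => |V ω| ^ 3) μ →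
      ∫ ω, |V ω| ^ 3 ∂μ ≤ K → Integrable V μ ∧ Integrable (fun ω => clip l (V ω)) μ ∧
      |∫ ω, V ω ∂μ| ≤ 1 + K ∧ |∫ ω, clip l (V ω) ∂μ| ≤ 1 + K ∧
      |∫ ω, V ω ∂μ - ∫ ω, clip l (V ω) ∂μ| ≤ (1 + K) / l := by
    intro V hV hV3 hVK
    have i1 : Integrable V μ :=
      integrable_of_abs_le_add hV hV3 fun ω => le_one_add_cube (abs_nonneg _)
    have i2 : Integrable (fun ω => clip l (V ω)) μ :=
      Integrable.of_bound (hcm.comp hV).aestronglyMeasurable l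
        (Eventually.of_forall fun ω => abs_clip_le hl.le _)
    have hsum : ∫ ω, (1 + |V ω| ^ 3) ∂μ ≤ 1 + K := by
      rw [integral_add (integrable_const _) hV3]; simpa using hVK
    have iS : Integrable (fun ω => 1 + |V ω| ^ 3) μ := (integrable_const _).add hV3
    refine ⟨i1, i2, ?_, ?_, ?_⟩
    · refine abs_integral_le_integral_abs.trans ((integral_mono i1.abs iS fun ω => ?_).trans hsum)
      exact le_one_add_cube (abs_nonneg _)
    · refine abs_integral_le_integral_abs.trans ((integral_mono i2.abs iS fun ω => ?_).trans hsum)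
      exact (abs_clip_le_abs hl.le _).trans (le_one_add_cube (abs_nonneg _))
    · rw [← integral_sub i1 i2]
      refine abs_integral_le_integral_abs.trans ((integral_mono (i1.sub i2).abs
        (iS.div_const l) fun ω => ?_).trans ?_)
      · refine (abs_sub_clip_le hl _).trans ?_
        gcongr
        rw [← sq_abs]
        exact sq_le_one_add_cube (abs_nonneg _)
      · rw [integral_div]; gcongr
  obtain ⟨iX, iXc, eX, eXc, dX⟩ := key hXm hX3 hXK
  obtain ⟨iY, iYc, eY, eYc, dY⟩ := key hYm hY3 hYK
  have iXY : Integrable (fun ω => X ω * Y ω) μ := by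
    refine integrable_of_abs_le_add (hXm.mul hYm) ((hX3.add hY3).add hY3) fun ω => ?_
    have h3 := sq_mul_le_cube_add (abs_nonneg (X ω)) (abs_nonneg (Y ω))
    have h4 := sq_nonneg (|X ω| - 1)
    have h5 := le_one_add_cube (abs_nonneg (Y ω))
    rw [abs_mul]
    simp only [Pi.add_apply]
    have h6 : |X ω| * |Y ω| ≤ (|X ω| ^ 2 * |Y ω| + |Y ω|) := by
      nlinarith [abs_nonneg (Y ω), mul_nonneg (abs_nonneg (Y ω)) h4,
        mul_nonneg (abs_nonneg (Y ω)) (sq_nonneg (|X ω|))]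
    linarith
  have iXYc : Integrable (fun ω => clip l (X ω) * clip l (Y ω)) μ :=
    Integrable.of_bound ((hcm.comp hXm).mul (hcm.comp hYm)).aestronglyMeasurable (l * l)
      (Eventually.of_forall fun ω => by
        rw [Real.norm_eq_abs, abs_mul]
        exact mul_le_mul (abs_clip_le hl.le _) (abs_clip_le hl.le _) (abs_nonneg _) hl.le)
  have d1 : |∫ ω, X ω * Y ω ∂μ - ∫ ω, clip l (X ω) * clip l (Y ω) ∂μ| ≤ 4 * K / l := by
    rw [← integral_sub iXY iXYc]
    have iS : Integrable (fun ω => 2 * (|X ω| ^ 3 + |Y ω| ^ 3) / l) μ :=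
      ((hX3.add hY3).const_mul 2).div_const l
    refine abs_integral_le_integral_abs.trans ((integral_mono (iXY.sub iXYc).abs iS
      fun ω => ?_).trans ?_)
    · have e : X ω * Y ω - clip l (X ω) * clip l (Y ω) =
          (X ω - clip l (X ω)) * Y ω + clip l (X ω) * (Y ω - clip l (Y ω)) := by ring
      change |X ω * Y ω - clip l (X ω) * clip l (Y ω)| ≤ _
      rw [e]
      refine (abs_add_le _ _).trans ?_
      rw [abs_mul, abs_mul]
      have t1 : |X ω - clip l (X ω)| * |Y ω| ≤ X ω ^ 2 / l * |Y ω| := by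
        gcongr; exact abs_sub_clip_le hl _
      have t2 : |clip l (X ω)| * |Y ω - clip l (Y ω)| ≤ |X ω| * (Y ω ^ 2 / l) :=
        mul_le_mul (abs_clip_le_abs hl.le _) (abs_sub_clip_le hl _) (abs_nonneg _) (abs_nonneg _)
      have t3 : X ω ^ 2 / l * |Y ω| ≤ (|X ω| ^ 3 + |Y ω| ^ 3) / l := by
        rw [div_mul_eq_mul_div, ← sq_abs]
        gcongr
        exact sq_mul_le_cube_add (abs_nonneg _) (abs_nonneg _)
      have t4 : |X ω| * (Y ω ^ 2 / l) ≤ (|X ω| ^ 3 + |Y ω| ^ 3) / l := by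
        rw [← mul_div_assoc, ← sq_abs, mul_comm, add_comm]
        gcongr
        exact sq_mul_le_cube_add (abs_nonneg _) (abs_nonneg _)
      have t5 : 2 * (|X ω| ^ 3 + |Y ω| ^ 3) / l = (|X ω| ^ 3 + |Y ω| ^ 3) / l +
        (|X ω| ^ 3 + |Y ω| ^ 3) / l := by ring
      linarith
    · rw [integral_div, integral_const_mul, integral_add hX3 hY3, div_le_div_iff_of_pos_right hl]
      linarith
  have d2 := h.abs_cov_le h₁ h₂ ((measurable_clip l).comp hX).stronglyMeasurable
    ((measurable_clip l).comp hY).stronglyMeasurable (fun ω => abs_clip_le hl.le _)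
    (fun ω => abs_clip_le hl.le _)
  simp only [Function.comp_def] at d2
  -- The condition αl³ ≤ 1 brings the covariance of the truncated variables down to the order 1/l of
  -- the truncation errors.
  have d3 : 4 * l * l * α ≤ 4 / l := by
    rw [le_div_iff₀ hl]; nlinarith
  set a := ∫ ω, X ω ∂μ
  set a' := ∫ ω, clip l (X ω) ∂μ
  set c := ∫ ω, Y ω ∂μ
  set c' := ∫ ω, clip l (Y ω) ∂μ
  have d4 : |a * c - a' * c'| ≤ 2 * (1 + K) ^ 2 / l := by
    calc |a * c - a' * c'| = |(a - a') * c + a' * (c - c')| := by ring_nf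
      _ ≤ |a - a'| * |c| + |a'| * |c - c'| := by
        refine (abs_add_le _ _).trans ?_
        rw [abs_mul, abs_mul]
      _ ≤ (1 + K) / l * (1 + K) + (1 + K) * ((1 + K) / l) := by gcongr
      _ = _ := by ring
  have d5 : 4 * K / l + 4 / l + 2 * (1 + K) ^ 2 / l ≤ 10 * (1 + K) ^ 2 / l := by
    rw [← add_div, ← add_div]
    gcongr
    nlinarith
  rw [abs_le] at *
  constructor <;> linarith [d1.1, d1.2, d2.1, d2.2, d4.1, d4.2]

end Mixing

/-! ### An exponential inequality by alternating blocks -/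

section BlockBound

variable {Ω : Type*} {m0 : MeasurableSpace Ω} {μ : Measure Ω} [IsProbabilityMeasure μ]

/-- A product of bounded variables, each nearly independent of the preceding ones, is bounded in
probability by the product of the means. -/
theorem measure_prod_ge_le {𝓕 : ℕ → MeasurableSpace Ω} (hmono : Monotone 𝓕) (hle : ∀ j, 𝓕 j ≤ m0)
    {𝓖 : ℕ → MeasurableSpace Ω} (hle' : ∀ j, 𝓖 j ≤ m0) {α B η M y : ℝ} {g : ℕ → Ω → ℝ}
    (hmix : ∀ j, AlphaLE μ (𝓕 j) (𝓖 j) α) (hgF : ∀ j, StronglyMeasurable[𝓕 (j + 1)] (g j))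
    (hgG : ∀ j, StronglyMeasurable[𝓖 j] (g j)) (hg0 : ∀ j ω, 0 ≤ g j ω) (hgB : ∀ j ω, g j ω ≤ B)
    (hη : 0 < η) (hy : 0 < y) (hM : ∀ j, ∫ ω, g j ω ∂μ + η ≤ M) (n : ℕ) :
    μ.real {ω | y ≤ ∏ j ∈ Finset.range n, g j ω} ≤ n * (2 * B * α / η) + M ^ n / y := by
  have hgi : ∀ j, Integrable (g j) μ := fun j =>
    Integrable.of_bound ((hgF j).mono (hle _)).aestronglyMeasurable B (Eventually.of_forall
      fun ω => by rw [Real.norm_of_nonneg (hg0 j ω)]; exact hgB j ω)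
  have hB0 : 0 ≤ B := by
    obtain ⟨ω⟩ := nonempty_of_isProbabilityMeasure μ
    exact (hg0 0 ω).trans (hgB 0 ω)
  have hM0 : 0 ≤ M := le_trans (add_nonneg (integral_nonneg (hg0 0)) hη.le) (hM 0)
  set D : ℕ → Ω → ℝ := fun j => μ[g j|𝓕 j] with hD
  -- On the complement of `A j` the conditional mean exceeds the mean by η. Mixing makes the
  -- integral of this excess at most 2Bα, so the complement has probability at most 2Bα/η.
  set A : ℕ → Set Ω := fun j => {ω | D j ω ≤ M} with hA
  have hAm : ∀ j, MeasurableSet[𝓕 j] (A j) := fun j => by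
    have hDm : StronglyMeasurable[𝓕 j] (D j) := stronglyMeasurable_condExp
    exact hDm.measurable measurableSet_Iic
  have hbad : ∀ j, μ.real (A j)ᶜ ≤ 2 * B * α / η := fun j => by
    have h1 := (hmix j).abs_setIntegral_sub_le (hle j) (hle' j) (hgG j) (B := B)
      (fun ω => by rw [abs_of_nonneg (hg0 j ω)]; exact hgB j ω) (hAm j).compl
    have hc0 := hle j _ (hAm j).compl
    rw [le_div_iff₀ hη]
    refine le_trans ?_ ((le_abs_self _).trans h1)
    rw [integral_sub (hgi j).integrableOn (integrable_const _),
      ← setIntegral_condExp (hle j) (hgi j) (hAm j).compl,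
      ← integral_sub integrable_condExp.integrableOn (integrable_const _)]
    have h2 : ∫ _ω in (A j)ᶜ, η ∂μ = μ.real (A j)ᶜ * η := by simp
    rw [← h2]
    refine setIntegral_mono_on (integrable_const _)
      (integrable_condExp.integrableOn.sub (integrable_const _)) hc0 fun ω hω => ?_
    have h3 : M < D j ω := not_le.1 hω
    have h4 := hM j
    change η ≤ D j ω - _
    linarith
  -- the product restricted to the event that the conditional means are under control
  set G : ℕ → Ω → ℝ := fun k ω =>
    ∏ j ∈ Finset.range k, ((A j).indicator (fun _ => (1 : ℝ)) ω * g j ω) with hG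
  have hterm : ∀ j ω, 0 ≤ (A j).indicator (fun _ => (1 : ℝ)) ω * g j ω ∧
      (A j).indicator (fun _ => (1 : ℝ)) ω * g j ω ≤ B := fun j ω => by
    by_cases h : ω ∈ A j <;> simp [h, hg0 j ω, hgB j ω, hB0]
  have hGm : ∀ k, StronglyMeasurable[𝓕 k] (G k) := fun k => by
    refine Finset.stronglyMeasurable_fun_prod _ fun j hj => ?_
    have hjk := Finset.mem_range.1 hj
    exact ((stronglyMeasurable_const (β := ℝ)).indicator (hmono hjk.le _ (hAm j))).mul
      ((hgF j).mono (hmono hjk))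
  have hG0 : ∀ k ω, 0 ≤ G k ω := fun k ω => Finset.prod_nonneg fun j _ => (hterm j ω).1
  have hGB : ∀ k ω, |G k ω| ≤ B ^ k := fun k ω => by
    rw [abs_of_nonneg (hG0 k ω)]
    refine (Finset.prod_le_prod (fun j _ => (hterm j ω).1) fun j _ => (hterm j ω).2).trans_eq ?_
    simp
  have hGi : ∀ k, Integrable (G k) μ := fun k =>
    Integrable.of_bound ((hGm k).mono (hle _)).aestronglyMeasurable (B ^ k)
      (Eventually.of_forall (hGB k))
  -- Conditioning on `𝓕 k` replaces the last factor by its conditional mean, which the indicator of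
  -- `A k` keeps below `M`.
  have hind : ∀ k, ∫ ω, G k ω ∂μ ≤ M ^ k := by
    intro k
    induction k with
    | zero => simp [hG]
    | succ k ih =>
      set V : Ω → ℝ := fun ω => G k ω * (A k).indicator (fun _ => (1 : ℝ)) ω with hV
      have hVm : StronglyMeasurable[𝓕 k] V :=
        (hGm k).mul ((stronglyMeasurable_const (β := ℝ)).indicator (hAm k))
      have hVB : ∀ ω, ‖V ω‖ ≤ B ^ k := fun ω => by
        have h1 := hGB k ω
        by_cases h : ω ∈ A k
        · simpa [hV, h] using h1
        · simp only [hV, h, Set.indicator_of_notMem, not_false_eq_true, mul_zero, norm_zero]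
          positivity
      have hVg : Integrable (V * g k) μ :=
        (hgi k).bdd_mul (hVm.mono (hle k)).aestronglyMeasurable (Eventually.of_forall hVB)
      have hVD : Integrable (V * D k) μ :=
        integrable_condExp.bdd_mul (hVm.mono (hle k)).aestronglyMeasurable
          (Eventually.of_forall hVB)
      have e1 : ∫ ω, G (k + 1) ω ∂μ = ∫ ω, (V * D k) ω ∂μ := by
        rw [← integral_congr_ae (condExp_mul_of_stronglyMeasurable_left hVm hVg (hgi k)),
          integral_condExp (hle k)]
        refine integral_congr_ae (Eventually.of_forall fun ω => ?_)
        simp only [hG, Finset.prod_range_succ, hV, Pi.mul_apply]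
        ring
      rw [e1, pow_succ]
      calc ∫ ω, (V * D k) ω ∂μ ≤ ∫ ω, G k ω * M ∂μ := by
            refine integral_mono hVD ((hGi k).mul_const _) fun ω => ?_
            simp only [Pi.mul_apply, hV]
            by_cases h : ω ∈ A k
            · simp only [h, Set.indicator_of_mem, mul_one]
              exact mul_le_mul_of_nonneg_left h (hG0 k ω)
            · simp only [h, Set.indicator_of_notMem, not_false_eq_true, mul_zero, zero_mul]
              exact mul_nonneg (hG0 k ω) hM0
        _ = (∫ ω, G k ω ∂μ) * M := integral_mul_const _ _
        _ ≤ M ^ k * M := by gcongr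
  have hsub : {ω | y ≤ ∏ j ∈ Finset.range n, g j ω} ⊆
      (⋃ j ∈ Finset.range n, (A j)ᶜ) ∪ {ω | y ≤ G n ω} := by
    intro ω hω
    by_cases h : ω ∈ ⋃ j ∈ Finset.range n, (A j)ᶜ
    · exact Or.inl h
    · refine Or.inr ?_
      simp only [Set.mem_iUnion, Set.mem_compl_iff, not_exists, not_not] at h
      have : G n ω = ∏ j ∈ Finset.range n, g j ω :=
        Finset.prod_congr rfl fun j hj => by simp [h j hj]
      change y ≤ G n ω
      rw [this]; exact hω
  have h1 : μ.real (⋃ j ∈ Finset.range n, (A j)ᶜ) ≤ n * (2 * B * α / η) := by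
    refine (measureReal_biUnion_finset_le _ _).trans ((Finset.sum_le_sum fun j _ => hbad j).trans_eq ?_)
    simp
  have h2 : μ.real {ω | y ≤ G n ω} ≤ M ^ n / y := by
    rw [le_div_iff₀ hy, mul_comm]
    exact (mul_meas_ge_le_integral_of_nonneg (Eventually.of_forall (hG0 n)) (hGi n) y).trans
      (hind n)
  calc _ ≤ μ.real ((⋃ j ∈ Finset.range n, (A j)ᶜ) ∪ {ω | y ≤ G n ω}) := measureReal_mono hsub
    _ ≤ _ := (measureReal_union_le _ _).trans (add_le_add h1 h2)

theorem sum_range_blocks (f : ℕ → ℝ) (p n : ℕ) :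
    ∑ t ∈ Finset.range (2 * p * n), f t =
      ∑ j ∈ Finset.range n, ∑ i ∈ Finset.range p, f (2 * p * j + i) +
        ∑ j ∈ Finset.range n, ∑ i ∈ Finset.range p, f (2 * p * j + p + i) := by
  induction n with
  | zero => simp
  | succ n ih =>
    have e : 2 * p * (n + 1) = 2 * p * n + p + p := by ring
    rw [e, Finset.sum_range_add, Finset.sum_range_add, ih, Finset.sum_range_succ,
      Finset.sum_range_succ]
    ring

variable {P Q : ℤ → MeasurableSpace Ω} {Z : ℤ → Ω → ℝ} {p : ℕ} {α B V : ℝ}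

/-- Exponential inequality for the sum over every second block. -/
theorem measure_block_sum_ge_le (hP : Monotone P) (hQ : Antitone Q) (hP0 : ∀ t, P t ≤ m0)
    (hQ0 : ∀ t, Q t ≤ m0) (hmix : ∀ t, AlphaLE μ (P t) (Q (t + p)) α)
    (hZP : ∀ t, Measurable[P t] (Z t)) (hZQ : ∀ t, Measurable[Q t] (Z t))
    (hZB : ∀ t ω, |Z t ω| ≤ B) (hZ0 : ∀ t, ∫ ω, Z t ω ∂μ = 0)
    (hV : ∀ b : ℤ, ∫ ω, (∑ i ∈ Finset.range p, Z (b + i) ω) ^ 2 ∂μ ≤ p * V)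
    {l η : ℝ} (hl : 0 < l) (hlB : l * (p * B) ≤ 1) (hη : 0 < η) (x : ℝ) (b : ℤ) (n : ℕ) :
    μ.real {ω | x ≤ ∑ j ∈ Finset.range n, ∑ i ∈ Finset.range p, Z (b + 2 * p * j + i) ω} ≤
      n * (6 * α / η) + Real.exp (-l * x + n * (l ^ 2 * (p * V) + η)) := by
  set Y : ℕ → Ω → ℝ := fun j ω => ∑ i ∈ Finset.range p, Z (b + 2 * p * j + i) ω with hY
  have hα : 0 ≤ α := (hmix 0).nonneg
  have hB0 : 0 ≤ B := by
    obtain ⟨ω⟩ := nonempty_of_isProbabilityMeasure μ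
    exact (abs_nonneg _).trans (hZB 0 ω)
  have hYP : ∀ j : ℕ, Measurable[P (b + 2 * p * j + p)] (Y j) := fun j =>
    Finset.measurable_fun_sum _ fun i hi => (hZP _).mono (hP (by
      have := Finset.mem_range.1 hi; omega)) le_rfl
  have hYQ : ∀ j : ℕ, Measurable[Q (b + 2 * p * j)] (Y j) := fun j =>
    Finset.measurable_fun_sum _ fun i _ => (hZQ _).mono (hQ (by omega)) le_rfl
  have hYB : ∀ j ω, |Y j ω| ≤ p * B := fun j ω => by
    refine (Finset.abs_sum_le_sum_abs _ _).trans ((Finset.sum_le_sum fun i _ => hZB _ ω).trans_eq ?_)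
    simp
  have hlY : ∀ j ω, |l * Y j ω| ≤ 1 := fun j ω => by
    rw [abs_mul, abs_of_pos hl]
    exact (mul_le_mul_of_nonneg_left (hYB j ω) hl.le).trans hlB
  have hYi : ∀ j, Integrable (Y j) μ := fun j =>
    Integrable.of_bound ((hYP j).mono (hP0 _) le_rfl).aestronglyMeasurable _
      (Eventually.of_forall (hYB j))
  have hZi : ∀ t, Integrable (Z t) μ := fun t =>
    Integrable.of_bound ((hZP t).mono (hP0 _) le_rfl).aestronglyMeasurable _
      (Eventually.of_forall (hZB t))
  have hYsq : ∀ j, Integrable (fun ω => Y j ω ^ 2) μ := fun j =>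
    Integrable.of_bound (((hYP j).mono (hP0 _) le_rfl).pow_const 2).aestronglyMeasurable
      ((p * B) ^ 2) (Eventually.of_forall fun ω => by
        rw [Real.norm_eq_abs, abs_pow]
        exact pow_le_pow_left₀ (abs_nonneg _) (hYB j ω) 2)
  have hYmean : ∀ j, ∫ ω, Y j ω ∂μ = 0 := fun j => by
    simp only [hY]
    rw [integral_finsetSum _ fun i _ => hZi _]
    simp [hZ0]
  set g : ℕ → Ω → ℝ := fun j ω => Real.exp (l * Y j ω) with hg
  have hg3 : ∀ j ω, g j ω ≤ 3 := fun j ω => by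
    calc g j ω ≤ Real.exp 1 := Real.exp_le_exp.2 ((le_abs_self _).trans (hlY j ω))
      _ ≤ 3 := Real.exp_one_lt_d9.le.trans (by norm_num)
  -- Uses e^y ≤ 1 + y + y² for |y| ≤ 1; the linear term has mean zero.
  have hgmean : ∀ j, ∫ ω, g j ω ∂μ ≤ 1 + l ^ 2 * (p * V) := fun j => by
    have h1 : ∀ ω, g j ω ≤ 1 + l * Y j ω + l ^ 2 * Y j ω ^ 2 := fun ω => by
      have := (abs_le.1 (Real.abs_exp_sub_one_sub_id_le (hlY j ω))).2
      rw [mul_pow] at this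
      simp only [hg]; linarith
    have i1 : Integrable (fun ω => 1 + l * Y j ω) μ :=
      (integrable_const _).add ((hYi j).const_mul l)
    calc ∫ ω, g j ω ∂μ ≤ ∫ ω, (1 + l * Y j ω + l ^ 2 * Y j ω ^ 2) ∂μ := by
          refine integral_mono (Integrable.of_bound (Real.measurable_exp.comp
            (((hYP j).mono (hP0 _) le_rfl).const_mul l)).aestronglyMeasurable 3
            (Eventually.of_forall fun ω => ?_)) (i1.add ((hYsq j).const_mul _)) h1
          rw [Real.norm_of_nonneg (Real.exp_pos _).le]; exact hg3 j ω
      _ = 1 + l ^ 2 * ∫ ω, Y j ω ^ 2 ∂μ := by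
          rw [integral_add i1 ((hYsq j).const_mul _), integral_add (integrable_const _)
            ((hYi j).const_mul l), integral_const_mul, integral_const_mul, hYmean]
          simp
      _ ≤ _ := by gcongr; exact hV (b + 2 * p * j)
  -- `𝓕 j` ends one block length before block `j` starts and still contains block j - 1. The skipped
  -- block in between supplies the gap `p` needed for mixing.
  have hfin := measure_prod_ge_le (μ := μ) (𝓕 := fun j : ℕ => P (b + 2 * p * j - p))
    (fun i j hij => hP (by
      have : (p : ℤ) * i ≤ p * j := by gcongr
      linarith)) (fun j => hP0 _) (𝓖 := fun j : ℕ => Q (b + 2 * p * j)) (fun j => hQ0 _)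
    (α := α) (B := 3) (η := η) (M := 1 + l ^ 2 * (p * V) + η) (y := Real.exp (l * x)) (g := g)
    (fun j => by
      have := hmix (b + 2 * p * j - p)
      rwa [sub_add_cancel] at this)
    (fun j => (Real.measurable_exp.comp (((hYP j).mono (hP (by push_cast; linarith))
      le_rfl).const_mul l)).stronglyMeasurable)
    (fun j => (Real.measurable_exp.comp ((hYQ j).const_mul l)).stronglyMeasurable)
    (fun j ω => (Real.exp_pos _).le) hg3 hη (Real.exp_pos _)
    (fun j => by have := hgmean j; linarith) n
  have hset : {ω | x ≤ ∑ j ∈ Finset.range n, Y j ω} =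
      {ω | Real.exp (l * x) ≤ ∏ j ∈ Finset.range n, g j ω} := by
    ext ω
    simp only [Set.mem_ofPred_eq, hg]
    rw [← Real.exp_sum, Real.exp_le_exp, ← Finset.mul_sum, mul_le_mul_iff_right₀ hl]
  rw [hset]
  refine hfin.trans (add_le_add (le_of_eq (by ring)) ?_)
  rw [div_eq_mul_inv, ← Real.exp_neg, neg_mul, Real.exp_add, mul_comm]
  gcongr
  rw [Real.exp_nat_mul]
  have hV0 : 0 ≤ p * V := le_trans (integral_nonneg fun ω => by positivity) (hV 0)
  gcongr
  have := Real.add_one_le_exp (l ^ 2 * (p * V) + η)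
  linarith

/-- Exponential inequality for partial sums of a bounded strongly mixing sequence. -/
theorem measure_abs_sum_ge_le (hP : Monotone P) (hQ : Antitone Q) (hP0 : ∀ t, P t ≤ m0)
    (hQ0 : ∀ t, Q t ≤ m0) (hmix : ∀ t, AlphaLE μ (P t) (Q (t + p)) α)
    (hZP : ∀ t, Measurable[P t] (Z t)) (hZQ : ∀ t, Measurable[Q t] (Z t))
    (hZB : ∀ t ω, |Z t ω| ≤ B) (hZ0 : ∀ t, ∫ ω, Z t ω ∂μ = 0)
    (hV : ∀ b : ℤ, ∫ ω, (∑ i ∈ Finset.range p, Z (b + i) ω) ^ 2 ∂μ ≤ p * V)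
    {l η : ℝ} (hl : 0 < l) (hlB : l * (p * B) ≤ 1) (hη : 0 < η) (x : ℝ) (n : ℕ) :
    μ.real {ω | 2 * x ≤ |∑ t ∈ Finset.range (2 * p * n), Z (t + 1) ω|} ≤
      4 * (n * (6 * α / η) + Real.exp (-l * x + n * (l ^ 2 * (p * V) + η))) := by
  set bd := n * (6 * α / η) + Real.exp (-l * x + n * (l ^ 2 * (p * V) + η)) with hbd
  set S : ℤ → Ω → ℝ := fun b ω =>
    ∑ j ∈ Finset.range n, ∑ i ∈ Finset.range p, Z (b + 2 * p * j + i) ω with hS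
  have h1 : ∀ b, μ.real {ω | x ≤ S b ω} ≤ bd := fun b =>
    measure_block_sum_ge_le hP hQ hP0 hQ0 hmix hZP hZQ hZB hZ0 hV hl hlB hη x b n
  have h2 : ∀ b, μ.real {ω | x ≤ -S b ω} ≤ bd := fun b => by
    have := measure_block_sum_ge_le (Z := fun t ω => -Z t ω) hP hQ hP0 hQ0 hmix
      (fun t => (hZP t).neg) (fun t => (hZQ t).neg) (fun t ω => by rw [abs_neg]; exact hZB t ω)
      (fun t => by rw [integral_neg, hZ0, neg_zero])
      (fun b => by
        refine le_of_eq_of_le (integral_congr_ae (Eventually.of_forall fun ω => ?_)) (hV b)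
        simp only [Finset.sum_neg_distrib, neg_sq]) hl hlB hη x b n
    simpa only [Finset.sum_neg_distrib] using this
  have hsplit : ∀ ω, ∑ t ∈ Finset.range (2 * p * n), Z (t + 1) ω = S 1 ω + S (1 + p) ω := fun ω => by
    have := sum_range_blocks (fun t => Z (t + 1) ω) p n
    rw [this]
    simp only [hS]
    congr 1 <;> refine Finset.sum_congr rfl fun j _ => Finset.sum_congr rfl fun i _ => ?_ <;>
      congr 1 <;> push_cast <;> ring
  -- A sum of two half-sums is at least 2x in absolute value only if one of them, up to sign, is at
  -- least x; two parities and two signs give the factor 4.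
  have hsub : {ω | 2 * x ≤ |∑ t ∈ Finset.range (2 * p * n), Z (t + 1) ω|} ⊆
      ({ω | x ≤ S 1 ω} ∪ {ω | x ≤ S (1 + p) ω}) ∪
        ({ω | x ≤ -S 1 ω} ∪ {ω | x ≤ -S (1 + p) ω}) := by
    intro ω hω
    simp only [Set.mem_ofPred_eq, hsplit ω] at hω
    simp only [Set.mem_union, Set.mem_ofPred_eq]
    by_contra! hcon
    obtain ⟨⟨a1, a2⟩, a3, a4⟩ := hcon
    have : |S 1 ω + S (1 + p) ω| < 2 * x := by rw [abs_lt]; constructor <;> linarith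
    linarith
  calc _ ≤ _ := measureReal_mono hsub
    _ ≤ (bd + bd) + (bd + bd) :=
      (measureReal_union_le _ _).trans (add_le_add
        ((measureReal_union_le _ _).trans (add_le_add (h1 _) (h1 _)))
        ((measureReal_union_le _ _).trans (add_le_add (h2 _) (h2 _))))
    _ = _ := by ring

end BlockBound

/-! ### Moments from exponential tails -/

section Tails

variable {Ω : Type*} {m0 : MeasurableSpace Ω} {μ : Measure Ω} [IsProbabilityMeasure μ]

/-- A bound for tail probabilities that covers both exponential tails. -/
noncomputable def tailFn (b₁ b₂ r₁ r₂ s : ℝ) : ℝ :=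
  Real.exp (-(s / b₁) ^ r₁) + Real.exp (-(s / b₂) ^ r₂)

theorem eventually_exp_le_rpow {c s : ℝ} (hc : 0 < c) (hs : 0 < s) (D : ℝ) :
    ∀ᶠ x : ℝ in atTop, Real.exp (-c * x ^ s) ≤ x ^ (-D) := by
  have h1 := (isLittleO_exp_neg_mul_rpow_atTop hc (-D / s)).comp_tendsto (tendsto_rpow_atTop hs)
  filter_upwards [h1.bound one_pos, eventually_gt_atTop 0] with x hx hx0
  simp only [Function.comp_apply, one_mul, Real.norm_eq_abs, Real.abs_exp] at hx
  rw [← Real.rpow_mul hx0.le, mul_div_cancel₀ _ hs.ne', abs_of_pos (Real.rpow_pos_of_pos hx0 _)]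
    at hx
  exact hx

theorem eventually_tailFn_le_rpow {b₁ b₂ r₁ r₂ s : ℝ} (hb₁ : 0 < b₁) (hb₂ : 0 < b₂) (hr₁ : 0 < r₁)
    (hr₂ : 0 < r₂) (hs : 0 < s) (D : ℝ) :
    ∀ᶠ x : ℝ in atTop, tailFn b₁ b₂ r₁ r₂ (x ^ s) ≤ 2 * x ^ (-D) := by
  have key : ∀ {b r : ℝ}, 0 < b → 0 < r →
      ∀ᶠ x : ℝ in atTop, Real.exp (-(x ^ s / b) ^ r) ≤ x ^ (-D) := by
    intro b r hb hr
    filter_upwards [eventually_exp_le_rpow (c := (b ^ r)⁻¹) (by positivity) (mul_pos hs hr) D,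
      eventually_gt_atTop 0] with x hx hx0
    rwa [Real.div_rpow (by positivity) hb.le, ← Real.rpow_mul hx0.le, div_eq_inv_mul,
      ← neg_mul]
  filter_upwards [key hb₁ hr₁, key hb₂ hr₂] with x h1 h2
  unfold tailFn
  linarith

theorem integrableOn_tailFn_mul {b₁ b₂ r₁ r₂ : ℝ} (hb₁ : 0 < b₁) (hb₂ : 0 < b₂) (hr₁ : 0 < r₁)
    (hr₂ : 0 < r₂) {p : ℝ} (hp : 0 < p) :
    IntegrableOn (fun t => tailFn b₁ b₂ r₁ r₂ t * t ^ (p - 1)) (Set.Ioi 0) := by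
  have key : ∀ {b r : ℝ}, 0 < b → 0 < r →
      IntegrableOn (fun t => Real.exp (-(t / b) ^ r) * t ^ (p - 1)) (Set.Ioi 0) := by
    intro b r hb hr
    refine (integrableOn_rpow_mul_exp_neg_mul_rpow (s := p - 1) (p := r) (b := (b ^ r)⁻¹)
      (by linarith) hr (by positivity)).congr_fun (fun t ht => ?_) measurableSet_Ioi
    have ht0 : (0 : ℝ) < t := ht
    simp only
    rw [Real.div_rpow ht0.le hb.le, div_eq_inv_mul, neg_mul, mul_comm]
  simp only [tailFn, add_mul]
  exact (key hb₁ hr₁).add (key hb₂ hr₂)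

/-- The layer-cake formula. The constant depends on the tail parameters only, so it is uniform over
coordinates, times and `N`. -/
theorem exists_moment_bound (μ : Measure Ω) [IsProbabilityMeasure μ] {b₁ b₂ r₁ r₂ : ℝ}
    (hb₁ : 0 < b₁) (hb₂ : 0 < b₂) (hr₁ : 0 < r₁) (hr₂ : 0 < r₂) (n : ℕ) :
    ∃ K : ℝ, 0 ≤ K ∧ ∀ V : Ω → ℝ, Measurable V →
      (∀ s, 0 < s → μ.real {ω | s < |V ω|} ≤ tailFn b₁ b₂ r₁ r₂ s) →
      Integrable (fun ω => |V ω| ^ n) μ ∧ ∫ ω, |V ω| ^ n ∂μ ≤ K := by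
  rcases Nat.eq_zero_or_pos n with rfl | hn
  · exact ⟨1, zero_le_one, fun V _ _ => by simp⟩
  have hp : (0 : ℝ) < n := by exact_mod_cast hn
  have hI := integrableOn_tailFn_mul hb₁ hb₂ hr₁ hr₂ hp
  set I := ∫ t in Set.Ioi (0 : ℝ), tailFn b₁ b₂ r₁ r₂ t * t ^ ((n : ℝ) - 1)
  have hnn : ∀ t ∈ Set.Ioi (0 : ℝ), 0 ≤ tailFn b₁ b₂ r₁ r₂ t * t ^ ((n : ℝ) - 1) := fun t ht => by
    have ht0 : (0 : ℝ) < t := ht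
    unfold tailFn
    positivity
  have hI0 : 0 ≤ I := setIntegral_nonneg measurableSet_Ioi hnn
  refine ⟨n * I, by positivity, fun V hV hT => ?_⟩
  have hle : ∫⁻ ω, ENNReal.ofReal (|V ω| ^ n) ∂μ ≤ ENNReal.ofReal (n * I) := by
    have h1 := lintegral_rpow_eq_lintegral_meas_lt_mul μ (f := fun ω => |V ω|)
      (Eventually.of_forall fun ω => abs_nonneg _) hV.abs.aemeasurable hp
    simp only [Real.rpow_natCast] at h1
    rw [h1, ENNReal.ofReal_mul hp.le,
      ofReal_integral_eq_lintegral_ofReal hI ((ae_restrict_iff' measurableSet_Ioi).2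
        (Eventually.of_forall hnn))]
    refine mul_le_mul' le_rfl (setLIntegral_mono' measurableSet_Ioi fun t ht => ?_)
    have ht0 : (0 : ℝ) < t := ht
    rw [ENNReal.ofReal_mul (by unfold tailFn; positivity)]
    gcongr
    rw [← ENNReal.ofReal_toReal (measure_ne_top μ {a | t < |V a|})]
    exact ENNReal.ofReal_le_ofReal (hT t ht0)
  have hnn' : 0 ≤ᵐ[μ] fun ω => |V ω| ^ n := Eventually.of_forall fun ω => by positivity
  have hm : AEStronglyMeasurable (fun ω => |V ω| ^ n) μ := (hV.abs.pow_const n).aestronglyMeasurable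
  constructor
  · rw [← lintegral_ofReal_ne_top_iff_integrable hm hnn']
    exact (hle.trans_lt ENNReal.ofReal_lt_top).ne
  · rw [integral_eq_lintegral_of_nonneg_ae hnn' hm]
    exact ENNReal.toReal_le_of_le_ofReal (by positivity) hle

end Tails

/-! ### Decay of autocovariances -/

section Decay

/-- The decay of covariances under exponential strong mixing. -/
noncomputable def decay (c r₃ : ℝ) (h : ℕ) : ℝ := Real.exp (-(c / 3) * (h : ℝ) ^ r₃)

theorem decay_pos (c r₃ : ℝ) (h : ℕ) : 0 < decay c r₃ h := Real.exp_pos _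

theorem decay_le_one {c r₃ : ℝ} (hc : 0 < c) (h : ℕ) : decay c r₃ h ≤ 1 := by
  unfold decay
  rw [Real.exp_le_one_iff]
  have : 0 ≤ c / 3 * (h : ℝ) ^ r₃ := by positivity
  linarith

theorem summable_decay {c r₃ : ℝ} (hc : 0 < c) (hr : 0 < r₃) : Summable (decay c r₃) := by
  refine summable_of_isBigO_nat (g := fun n : ℕ => (n : ℝ) ^ (-2 : ℝ))
    (Real.summable_nat_rpow.2 (by norm_num)) ?_
  refine IsBigO.of_bound 1 ?_
  have := tendsto_natCast_atTop_atTop (R := ℝ) |>.eventually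
    (eventually_exp_le_rpow (c := c / 3) (by positivity) hr 2)
  filter_upwards [this] with n hn
  rw [Real.norm_of_nonneg (decay_pos _ _ _).le, Real.norm_of_nonneg (by positivity), one_mul]
  exact hn

/-- Distinct times on the same side of `i` have distinct lags, so each side contributes at most the
full series. -/
theorem sum_decay_le {c r₃ : ℝ} (hc : 0 < c) (hr : 0 < r₃) {ι : Type*} (s : Finset ι) (g : ι → ℤ)
    (hg : Set.InjOn g s) (i : ℤ) :
    ∑ j ∈ s, decay c r₃ (i - g j).natAbs ≤ 2 * ∑' h, decay c r₃ h := by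
  classical
  have hs := summable_decay hc hr
  have key : ∀ s' : Finset ι, Set.InjOn (fun j => (i - g j).natAbs) s' →
      ∑ j ∈ s', decay c r₃ (i - g j).natAbs ≤ ∑' h, decay c r₃ h := fun s' hinj => by
    rw [← Finset.sum_image (f := decay c r₃) hinj]
    exact hs.sum_le_tsum _ fun _ _ => (decay_pos _ _ _).le
  rw [← Finset.sum_filter_add_sum_filter_not s (fun j => g j ≤ i), two_mul]
  refine add_le_add (key _ fun a ha b hb hab => ?_) (key _ fun a ha b hb hab => ?_) <;>
  · simp only [Finset.coe_filter, Set.mem_ofPred_eq] at ha hb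
    refine hg ha.1 hb.1 ?_
    have ha2 := ha.2
    have hb2 := hb.2
    simp only at hab
    omega

variable {Ω : Type*} {m0 : MeasurableSpace Ω} {μ : Measure Ω}

/-- Two families of σ-algebras, of the past and of the future, with exponentially decaying strong
mixing coefficients. -/
structure ExpMixing (μ : Measure Ω) (P Q : ℤ → MeasurableSpace Ω) (c r₃ : ℝ) : Prop where
  c_pos : 0 < c
  r₃_pos : 0 < r₃
  mono : Monotone P
  anti : Antitone Q
  past_le : ∀ t, P t ≤ m0
  future_le : ∀ t, Q t ≤ m0
  mix : ∀ (t : ℤ) (k : ℕ), 1 ≤ k → AlphaLE μ (P t) (Q (t + k)) (Real.exp (-c * (k : ℝ) ^ r₃))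

variable [IsProbabilityMeasure μ] {P Q : ℤ → MeasurableSpace Ω} {c r₃ : ℝ}

/-- Truncating at l = exp(c k^r₃ / 3) makes αl³ = 1, which explains the third of the rate in
`decay`. Lag zero, about which mixing says nothing, is covered by the moment bounds. -/
theorem ExpMixing.abs_cov_le (h : ExpMixing μ P Q c r₃) {X Y : Ω → ℝ} {s t : ℤ} {K : ℝ}
    (hXP : Measurable[P s] X) (hXQ : Measurable[Q s] X) (hYP : Measurable[P t] Y)
    (hYQ : Measurable[Q t] Y)
    (hX3 : Integrable (fun ω => |X ω| ^ 3) μ) (hY3 : Integrable (fun ω => |Y ω| ^ 3) μ)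
    (hXK : ∫ ω, |X ω| ^ 3 ∂μ ≤ K) (hYK : ∫ ω, |Y ω| ^ 3 ∂μ ≤ K) :
    |∫ ω, X ω * Y ω ∂μ - (∫ ω, X ω ∂μ) * ∫ ω, Y ω ∂μ| ≤
      10 * (1 + K) ^ 2 * decay c r₃ (s - t).natAbs := by
  have hX : Measurable X := hXP.mono (h.past_le s) le_rfl
  have hY : Measurable Y := hYP.mono (h.past_le t) le_rfl
  have hc := h.c_pos
  have key : ∀ {k : ℕ} {m₁ m₂ : MeasurableSpace Ω},
      AlphaLE μ m₁ m₂ (Real.exp (-c * (k : ℝ) ^ r₃)) → m₁ ≤ m0 → m₂ ≤ m0 → ∀ {X Y : Ω → ℝ},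
      Measurable[m₁] X → Measurable[m₂] Y → Integrable (fun ω => |X ω| ^ 3) μ →
      Integrable (fun ω => |Y ω| ^ 3) μ → ∫ ω, |X ω| ^ 3 ∂μ ≤ K → ∫ ω, |Y ω| ^ 3 ∂μ ≤ K →
      |∫ ω, X ω * Y ω ∂μ - (∫ ω, X ω ∂μ) * ∫ ω, Y ω ∂μ| ≤ 10 * (1 + K) ^ 2 * decay c r₃ k := by
    intro k m₁ m₂ hm h₁ h₂ X Y hX hY hX3 hY3 hXK hYK
    refine (hm.abs_cov_le_of_moments h₁ h₂ hX hY hX3 hY3 hXK hYK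
      (l := Real.exp (c / 3 * (k : ℝ) ^ r₃)) (Real.exp_pos _) ?_).trans_eq ?_
    · rw [← Real.exp_nat_mul, ← Real.exp_add, Real.exp_le_one_iff]
      push_cast
      apply le_of_eq; ring
    · rw [decay, neg_mul, Real.exp_neg, div_eq_mul_inv]
  rcases lt_trichotomy s t with hst | hst | hst
  · have hk : ((s - t).natAbs : ℤ) = t - s := by omega
    have hm := h.mix s (s - t).natAbs (by omega)
    rw [hk, add_sub_cancel] at hm
    exact key hm (h.past_le s) (h.future_le t) hXP hYQ hX3 hY3 hXK hYK
  · subst hst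
    have hK : 0 ≤ K := (integral_nonneg fun ω => by positivity).trans hXK
    have key2 : ∀ {V : Ω → ℝ}, Measurable V → Integrable (fun ω => |V ω| ^ 3) μ →
        ∫ ω, |V ω| ^ 3 ∂μ ≤ K → |∫ ω, V ω ∂μ| ≤ 1 + K := by
      intro V hV hV3 hVK
      have i1 : Integrable V μ :=
        integrable_of_abs_le_add hV hV3 fun ω => le_one_add_cube (abs_nonneg _)
      refine abs_integral_le_integral_abs.trans ((integral_mono i1.abs
        ((integrable_const (1 : ℝ)).add hV3) fun ω => le_one_add_cube (abs_nonneg _)).trans ?_)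
      simp only [Pi.add_apply]
      rw [integral_add (integrable_const _) hV3]
      simpa using hVK
    have hXY : |∫ ω, X ω * Y ω ∂μ| ≤ 1 + K := by
      have hb : ∀ ω, |X ω * Y ω| ≤ 1 + (|X ω| ^ 3 + |Y ω| ^ 3) / 2 := fun ω => by
        rw [abs_mul]
        have h1 := sq_le_one_add_cube (abs_nonneg (X ω))
        have h2 := sq_le_one_add_cube (abs_nonneg (Y ω))
        nlinarith [sq_nonneg (|X ω| - |Y ω|)]
      have iS : Integrable (fun ω => (|X ω| ^ 3 + |Y ω| ^ 3) / 2) μ := (hX3.add hY3).div_const 2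
      have i1 := integrable_of_abs_le_add (hX.mul hY) iS hb
      refine abs_integral_le_integral_abs.trans ((integral_mono i1.abs
        ((integrable_const (1 : ℝ)).add iS) hb).trans ?_)
      simp only [Pi.add_apply]
      rw [integral_add (integrable_const _) iS, integral_div, integral_add hX3 hY3]
      simp only [integral_const, probReal_univ, smul_eq_mul, mul_one]
      linarith
    have h0 : decay c r₃ (s - s).natAbs = 1 := by simp [decay, h.r₃_pos.ne']
    rw [h0, mul_one]
    have eX := key2 hX hX3 hXK
    have eY := key2 hY hY3 hYK
    have h3 : |(∫ ω, X ω ∂μ) * ∫ ω, Y ω ∂μ| ≤ (1 + K) * (1 + K) := by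
      rw [abs_mul]; gcongr
    have h4 := abs_sub (∫ ω, X ω * Y ω ∂μ) ((∫ ω, X ω ∂μ) * ∫ ω, Y ω ∂μ)
    nlinarith
  · have hk : ((s - t).natAbs : ℤ) = s - t := by omega
    have hm := h.mix t (s - t).natAbs (by omega)
    rw [hk, add_sub_cancel] at hm
    have := key hm (h.past_le t) (h.future_le s) hYP hXQ hY3 hX3 hYK hXK
    rw [mul_comm (∫ ω, X ω ∂μ)]
    simpa only [mul_comm] using this

end Decay

/-! ### Concentration of sample second moments -/

section Concentration

variable {Ω : Type*} {m0 : MeasurableSpace Ω} {μ : Measure Ω} [IsProbabilityMeasure μ]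

/-- With l = T^(1/16) the denominator l⁸ equals √T, so truncation biases a sum of `T` terms by O(√T)
only. -/
theorem abs_sub_clip_le_pow {l : ℝ} (hl : 0 < l) (x : ℝ) : |x - clip l x| ≤ |x| ^ 9 / l ^ 8 := by
  rcases le_total |x| l with h | h
  · rw [clip_eq_self h, sub_self, abs_zero]; positivity
  · have h1 := abs_sub_clip_le hl x
    rw [div_eq_mul_inv] at h1
    refine h1.trans ?_
    rw [le_div_iff₀ (by positivity), ← sq_abs]
    calc |x| ^ 2 * l⁻¹ * l ^ 8 = |x| ^ 2 * l ^ 7 := by field_simp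
      _ ≤ |x| ^ 2 * |x| ^ 7 := by gcongr
      _ = |x| ^ 9 := by ring

theorem pow_nine_mul_le {x y : ℝ} (hx : 0 ≤ x) (hy : 0 ≤ y) : x ^ 9 * y ≤ x ^ 10 + y ^ 10 := by
  rcases le_total x y with h | h
  · calc x ^ 9 * y ≤ y ^ 9 * y := by gcongr
      _ = y ^ 10 := by ring
      _ ≤ _ := by linarith [pow_nonneg hx 10]
  · calc x ^ 9 * y ≤ x ^ 9 * x := by gcongr
      _ = x ^ 10 := by ring
      _ ≤ _ := by linarith [pow_nonneg hy 10]

theorem abs_mul_sub_clip_mul_le {l : ℝ} (hl : 0 < l) (x y : ℝ) :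
    |x * y - clip l x * clip l y| ≤ 2 * (|x| ^ 10 + |y| ^ 10) / l ^ 8 := by
  have e : x * y - clip l x * clip l y = (x - clip l x) * y + clip l x * (y - clip l y) := by ring
  have h1 : |x - clip l x| * |y| ≤ (|x| ^ 10 + |y| ^ 10) / l ^ 8 := by
    calc |x - clip l x| * |y| ≤ |x| ^ 9 / l ^ 8 * |y| := by
          gcongr; exact abs_sub_clip_le_pow hl x
      _ = |x| ^ 9 * |y| / l ^ 8 := by ring
      _ ≤ _ := by gcongr; exact pow_nine_mul_le (abs_nonneg _) (abs_nonneg _)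
  have h2 : |clip l x| * |y - clip l y| ≤ (|x| ^ 10 + |y| ^ 10) / l ^ 8 := by
    calc |clip l x| * |y - clip l y| ≤ |x| * (|y| ^ 9 / l ^ 8) :=
          mul_le_mul (abs_clip_le_abs hl.le x) (abs_sub_clip_le_pow hl y) (abs_nonneg _)
            (abs_nonneg _)
      _ = |y| ^ 9 * |x| / l ^ 8 := by ring
      _ ≤ _ := by rw [add_comm]; gcongr; exact pow_nine_mul_le (abs_nonneg _) (abs_nonneg _)
  rw [e]
  refine (abs_add_le _ _).trans ?_
  rw [abs_mul, abs_mul]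
  calc _ ≤ _ := add_le_add h1 h2
    _ = _ := by ring

theorem abs_mul_le_one_add {x y : ℝ} (hx : 0 ≤ x) (hy : 0 ≤ y) : x * y ≤ 1 + (x ^ 10 + y ^ 10) := by
  have h : ∀ {z : ℝ}, 0 ≤ z → z ^ 2 ≤ 1 + z ^ 10 := fun {z} hz => by
    rcases le_total z 1 with h | h
    · have : z ^ 2 ≤ 1 := pow_le_one₀ hz h
      linarith [pow_nonneg hz 10]
    · have : z ^ 2 ≤ z ^ 10 := pow_le_pow_right₀ h (by norm_num)
      linarith
  nlinarith [sq_nonneg (x - y), h hx, h hy, pow_nonneg hx 10, pow_nonneg hy 10]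

theorem cube_mul_le_one_add {x y : ℝ} (hx : 0 ≤ x) (hy : 0 ≤ y) :
    (x * y) ^ 3 ≤ 1 + (x ^ 10 + y ^ 10) := by
  have h : ∀ {z : ℝ}, 0 ≤ z → z ^ 6 ≤ 1 + z ^ 10 := fun {z} hz => by
    rcases le_total z 1 with h | h
    · have : z ^ 6 ≤ 1 := pow_le_one₀ hz h
      linarith [pow_nonneg hz 10]
    · have : z ^ 6 ≤ z ^ 10 := pow_le_pow_right₀ h (by norm_num)
      linarith
  nlinarith [sq_nonneg (x ^ 3 - y ^ 3), h hx, h hy, pow_nonneg hx 10, pow_nonneg hy 10]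

/-- Truncation level and block length are both about T^(1/16): the tilt √(log T / T) times block
length times the bound 2T^(1/8) on the summands is then at most 1, while truncation and mixing
errors decay faster than any power of `T`. The value 72 makes 24/T at most 1/3. -/
theorem exists_rate_bounds {c r₃ b₁ b₂ r₁ r₂ : ℝ} (hc : 0 < c) (hr₃ : 0 < r₃) (hb₁ : 0 < b₁)
    (hb₂ : 0 < b₂) (hr₁ : 0 < r₁) (hr₂ : 0 < r₂) (D : ℝ) :
    ∃ T₀ : ℕ, ∀ T : ℕ, T₀ ≤ T → 72 ≤ T ∧
      √(Real.log T / T) * (⌈(T : ℝ) ^ (1 / 16 : ℝ)⌉₊ *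
        (2 * ((T : ℝ) ^ (1 / 16 : ℝ) * (T : ℝ) ^ (1 / 16 : ℝ)))) ≤ 1 ∧
      2 * T * tailFn b₁ b₂ r₁ r₂ ((T : ℝ) ^ (1 / 16 : ℝ)) ≤ (T : ℝ) ^ (-D) / 3 ∧
      24 * (T : ℝ) ^ 2 * Real.exp (-c * (⌈(T : ℝ) ^ (1 / 16 : ℝ)⌉₊ : ℝ) ^ r₃) ≤
        (T : ℝ) ^ (-D) / 3 ∧
      12 * (T : ℝ) ^ (-(D + 1)) ≤ (T : ℝ) ^ (-D) / 3 := by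
  have hcast := tendsto_natCast_atTop_atTop (R := ℝ)
  have e1 := hcast.eventually (eventually_tailFn_le_rpow hb₁ hb₂ hr₁ hr₂
    (s := 1 / 16) (by norm_num) (D + 2))
  have e2 := hcast.eventually (eventually_exp_le_rpow (c := c) (s := 1 / 16 * r₃) hc
    (by positivity) (D + 3))
  have e3 := hcast.eventually ((isLittleO_log_rpow_atTop (r := 1 / 8) (by norm_num)).bound
    (c := 1 / 16) (by norm_num))
  obtain ⟨T₀, hT₀⟩ := eventually_atTop.1 (e1.and (e2.and (e3.and (eventually_ge_atTop 72))))
  refine ⟨T₀, fun T hT => ?_⟩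
  obtain ⟨h1, h2, h3, h4⟩ := hT₀ T hT
  have hT1 : (72 : ℝ) ≤ T := by exact_mod_cast h4
  have hT0 : (0 : ℝ) < T := by linarith
  set x := (T : ℝ) ^ (1 / 16 : ℝ) with hx
  have hx1 : 1 ≤ x := Real.one_le_rpow (by linarith) (by norm_num)
  have hceil : (⌈x⌉₊ : ℝ) ≤ 2 * x := by
    have := (Nat.ceil_lt_add_one (by linarith : (0 : ℝ) ≤ x)).le
    linarith
  have hpow : ∀ e : ℝ, (T : ℝ) ^ (-(D + e)) = (T : ℝ) ^ (-D) * (T : ℝ) ^ (-e) := fun e => by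
    rw [← Real.rpow_add hT0]; ring_nf
  have hD0 : 0 < (T : ℝ) ^ (-D) := by positivity
  have hn : ∀ n : ℕ, (T : ℝ) ^ (-(n : ℝ)) = ((T : ℝ) ^ n)⁻¹ := fun n => by
    rw [Real.rpow_neg hT0.le, Real.rpow_natCast]
  have n1 : (T : ℝ) ^ (-(1 : ℝ)) = ((T : ℝ) ^ 1)⁻¹ := by exact_mod_cast hn 1
  have n2 : (T : ℝ) ^ (-(2 : ℝ)) = ((T : ℝ) ^ 2)⁻¹ := by exact_mod_cast hn 2
  have n3 : (T : ℝ) ^ (-(3 : ℝ)) = ((T : ℝ) ^ 3)⁻¹ := by exact_mod_cast hn 3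
  refine ⟨h4, ?_, ?_, ?_, ?_⟩
  · have hlog : Real.log T ≤ 1 / 16 * (T : ℝ) ^ (1 / 8 : ℝ) := by
      have h5 : 0 ≤ Real.log T := Real.log_nonneg (by linarith)
      rwa [Real.norm_of_nonneg h5, Real.norm_of_nonneg (by positivity)] at h3
    have h5 : √(Real.log T / T) ≤ 1 / 4 * x ^ (-(7 : ℝ)) := by
      rw [Real.sqrt_le_left (by positivity), mul_pow, ← Real.rpow_natCast (x ^ (-(7 : ℝ))), hx,
        ← Real.rpow_mul hT0.le, ← Real.rpow_mul hT0.le, div_le_iff₀ hT0]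
      refine hlog.trans (le_of_eq ?_)
      rw [mul_assoc]
      congr 1
      · norm_num
      · conv_rhs => rw [← Real.rpow_one (T : ℝ), ← Real.rpow_mul hT0.le, ← Real.rpow_add hT0]
        norm_num
    have hx0 : 0 < x := by linarith
    calc _ ≤ 1 / 4 * x ^ (-(7 : ℝ)) * (2 * x * (2 * (x * x))) := by gcongr
      _ = x ^ (-(7 : ℝ)) * x ^ (3 : ℝ) := by
        rw [show (3 : ℝ) = ((3 : ℕ) : ℝ) by norm_num, Real.rpow_natCast]; ring
      _ = x ^ (-(4 : ℝ)) := by rw [← Real.rpow_add hx0]; norm_num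
      _ ≤ 1 := Real.rpow_le_one_of_one_le_of_nonpos hx1 (by norm_num)
  · calc 2 * T * tailFn b₁ b₂ r₁ r₂ x ≤ 2 * T * (2 * (T : ℝ) ^ (-(D + 2))) := by gcongr
      _ = (T : ℝ) ^ (-D) * (4 / T) := by rw [hpow, n2]; field_simp; ring
      _ ≤ (T : ℝ) ^ (-D) * (1 / 3) := by
        refine mul_le_mul_of_nonneg_left ?_ hD0.le
        rw [div_le_div_iff₀ hT0 (by norm_num)]; linarith
      _ = _ := by ring
  · have h6 : Real.exp (-c * (⌈x⌉₊ : ℝ) ^ r₃) ≤ (T : ℝ) ^ (-(D + 3)) := by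
      refine le_trans ?_ h2
      rw [Real.exp_le_exp, Real.rpow_mul hT0.le, neg_mul, neg_mul, neg_le_neg_iff]
      gcongr
      exact Nat.le_ceil x
    calc _ ≤ 24 * (T : ℝ) ^ 2 * (T : ℝ) ^ (-(D + 3)) := by gcongr
      _ = (T : ℝ) ^ (-D) * (24 / T) := by rw [hpow, n3]; field_simp
      _ ≤ (T : ℝ) ^ (-D) * (1 / 3) := by
        refine mul_le_mul_of_nonneg_left ?_ hD0.le
        rw [div_le_div_iff₀ hT0 (by norm_num)]; linarith
      _ = _ := by ring
  · calc 12 * (T : ℝ) ^ (-(D + 1)) = (T : ℝ) ^ (-D) * (12 / T) := by rw [hpow, n1]; field_simp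
      _ ≤ (T : ℝ) ^ (-D) * (1 / 3) := by
        refine mul_le_mul_of_nonneg_left ?_ hD0.le
        rw [div_le_div_iff₀ hT0 (by norm_num)]; linarith
      _ = _ := by ring

/-- Summable autocovariances make the variance of a block linear in its length. Setting some of the
centred terms to zero does not affect the bound, and that allows padding to complete blocks. -/
theorem integral_sq_block_le {P Q : ℤ → MeasurableSpace Ω} {c r₃ K B : ℝ}
    (hmix : ExpMixing μ P Q c r₃) {A Z : ℤ → Ω → ℝ} {I : Set ℤ} [DecidablePred (· ∈ I)]
    (hAP : ∀ t, Measurable[P t] (A t)) (hAQ : ∀ t, Measurable[Q t] (A t))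
    (hAB : ∀ t ω, |A t ω| ≤ B) (hA3 : ∀ t, ∫ ω, |A t ω| ^ 3 ∂μ ≤ K)
    (hZ : ∀ t, Z t = (if t ∈ I then fun ω => A t ω - ∫ ω', A t ω' ∂μ else fun _ => 0 :
      Ω → ℝ)) (p : ℕ) (b : ℤ) :
    ∫ ω, (∑ i ∈ Finset.range p, Z (b + i) ω) ^ 2 ∂μ ≤
      p * (10 * (1 + K) ^ 2 * (2 * ∑' h, decay c r₃ h)) := by
  have hm : ∀ t, Measurable (A t) := fun t => (hAP t).mono (hmix.past_le t) le_rfl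
  have hAi : ∀ t, Integrable (A t) μ := fun t =>
    Integrable.of_bound (hm t).aestronglyMeasurable B (Eventually.of_forall (hAB t))
  have hA3i : ∀ t, Integrable (fun ω => |A t ω| ^ 3) μ := fun t =>
    Integrable.of_bound ((hm t).abs.pow_const 3).aestronglyMeasurable (B ^ 3)
      (Eventually.of_forall fun ω => by
        rw [Real.norm_of_nonneg (by positivity)]
        exact pow_le_pow_left₀ (abs_nonneg _) (hAB t ω) 3)
  have hAAi : ∀ s t, Integrable (fun ω => A s ω * A t ω) μ := fun s t =>
    (hAi t).bdd_mul (hm s).aestronglyMeasurable (Eventually.of_forall (hAB s))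
  have hZZi : ∀ s t, Integrable (fun ω => Z s ω * Z t ω) μ := fun s t => by
    rw [hZ s, hZ t]
    by_cases hs : s ∈ I
    · by_cases ht : t ∈ I
      · simp only [hs, ht, if_true]
        refine ((hAi t).sub (integrable_const _)).bdd_mul (c := B + |∫ ω', A s ω' ∂μ|)
          ((hm s).sub_const _).aestronglyMeasurable (Eventually.of_forall fun ω => ?_)
        exact (abs_sub _ _).trans (by gcongr; exact hAB s ω)
      · simp [ht]
    · simp [hs]
  have hcov : ∀ s t, ∫ ω, Z s ω * Z t ω ∂μ ≤ 10 * (1 + K) ^ 2 * decay c r₃ (s - t).natAbs :=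
    fun s t => by
      have hnn : 0 ≤ 10 * (1 + K) ^ 2 * decay c r₃ (s - t).natAbs :=
        mul_nonneg (by positivity) (decay_pos _ _ _).le
      rw [hZ s, hZ t]
      by_cases hs : s ∈ I
      · by_cases ht : t ∈ I
        · simp only [hs, ht, if_true]
          have h1 := hmix.abs_cov_le (hAP s) (hAQ s) (hAP t) (hAQ t) (hA3i s) (hA3i t) (hA3 s)
            (hA3 t)
          refine le_of_eq_of_le ?_ ((le_abs_self _).trans h1)
          set ms := ∫ ω', A s ω' ∂μ
          set mt := ∫ ω', A t ω' ∂μ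
          have e : ∀ ω, (A s ω - ms) * (A t ω - mt) =
              A s ω * A t ω - mt * A s ω - (ms * A t ω - ms * mt) := fun ω => by ring
          have i1 : Integrable (fun ω => A s ω * A t ω - mt * A s ω) μ :=
            (hAAi s t).sub ((hAi s).const_mul _)
          have i2 : Integrable (fun ω => ms * A t ω - ms * mt) μ :=
            ((hAi t).const_mul _).sub (integrable_const _)
          simp_rw [e]
          rw [integral_sub i1 i2, integral_sub (hAAi s t) ((hAi s).const_mul _),
            integral_sub ((hAi t).const_mul _) (integrable_const _), integral_const_mul,
            integral_const_mul]
          simp only [integral_const, probReal_univ, smul_eq_mul, one_mul]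
          ring
        · simpa [ht] using hnn
      · simpa [hs] using hnn
  have hexp : ∀ ω, (∑ i ∈ Finset.range p, Z (b + i) ω) ^ 2 =
      ∑ i ∈ Finset.range p, ∑ j ∈ Finset.range p, Z (b + i) ω * Z (b + j) ω := fun ω => by
    rw [sq, Finset.sum_mul_sum]
  simp_rw [hexp]
  rw [integral_finsetSum _ fun i _ => integrable_finsetSum _ fun j _ => hZZi _ _]
  simp_rw [integral_finsetSum (Finset.range p) fun j (_ : j ∈ Finset.range p) => hZZi _ _]
  calc _ ≤ ∑ i ∈ Finset.range p, 10 * (1 + K) ^ 2 * (2 * ∑' h, decay c r₃ h) :=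
        Finset.sum_le_sum fun i _ => by
          refine (Finset.sum_le_sum fun (j : ℕ) _ => hcov (b + i) (b + (j : ℤ))).trans ?_
          rw [← Finset.mul_sum]
          gcongr
          exact sum_decay_le hmix.c_pos hmix.r₃_pos _ (fun j : ℕ => b + j)
            (fun x _ y _ hxy => by simpa using hxy) _
    _ = _ := by simp

/-- Tenth moments pay both for the third moment of the product, needed in the covariance inequality,
and for a truncation bias of order L⁻⁸. -/
theorem clip_mul_moments {a b : Ω → ℝ} {M L : ℝ} (ha : Measurable a) (hb : Measurable b)
    (ha10 : Integrable (fun ω => |a ω| ^ 10) μ) (hb10 : Integrable (fun ω => |b ω| ^ 10) μ)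
    (haM : ∫ ω, |a ω| ^ 10 ∂μ ≤ M) (hbM : ∫ ω, |b ω| ^ 10 ∂μ ≤ M) (hL0 : 0 < L) :
    ∫ ω, |clip L (a ω) * clip L (b ω)| ^ 3 ∂μ ≤ 1 + (M + M) ∧
    |∫ ω, clip L (a ω) * clip L (b ω) ∂μ - ∫ ω, a ω * b ω ∂μ| ≤ 4 * M / L ^ 8 := by
  have hcl := measurable_clip L
  have hAm : Measurable fun ω => clip L (a ω) * clip L (b ω) := (hcl.comp ha).mul (hcl.comp hb)
  have hAB : ∀ ω, |clip L (a ω) * clip L (b ω)| ≤ L * L := fun ω => by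
    rw [abs_mul]
    exact mul_le_mul (abs_clip_le hL0.le _) (abs_clip_le hL0.le _) (abs_nonneg _) hL0.le
  have hAi : Integrable (fun ω => clip L (a ω) * clip L (b ω)) μ :=
    Integrable.of_bound hAm.aestronglyMeasurable _ (Eventually.of_forall hAB)
  have i0 : Integrable (fun ω => |a ω| ^ 10 + |b ω| ^ 10) μ := ha10.add hb10
  have hsum10 : ∫ ω, (|a ω| ^ 10 + |b ω| ^ 10) ∂μ ≤ M + M := by
    rw [integral_add ha10 hb10]
    exact add_le_add haM hbM
  have hab : Integrable (fun ω => a ω * b ω) μ :=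
    integrable_of_abs_le_add (ha.mul hb) i0 fun ω => by
      rw [abs_mul]; exact abs_mul_le_one_add (abs_nonneg _) (abs_nonneg _)
  constructor
  · have i1 : Integrable (fun ω => 1 + (|a ω| ^ 10 + |b ω| ^ 10)) μ := (integrable_const _).add i0
    have i2 : Integrable (fun ω => |clip L (a ω) * clip L (b ω)| ^ 3) μ :=
      Integrable.of_bound (hAm.abs.pow_const 3).aestronglyMeasurable ((L * L) ^ 3)
        (Eventually.of_forall fun ω => by
          rw [Real.norm_of_nonneg (by positivity)]
          exact pow_le_pow_left₀ (abs_nonneg _) (hAB ω) 3)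
    have hle : ∀ ω, |clip L (a ω) * clip L (b ω)| ^ 3 ≤ 1 + (|a ω| ^ 10 + |b ω| ^ 10) := fun ω => by
      refine le_trans ?_ (cube_mul_le_one_add (abs_nonneg (a ω)) (abs_nonneg (b ω)))
      rw [abs_mul]
      exact pow_le_pow_left₀ (by positivity) (mul_le_mul (abs_clip_le_abs hL0.le _)
        (abs_clip_le_abs hL0.le _) (abs_nonneg _) (abs_nonneg _)) 3
    refine (integral_mono i2 i1 hle).trans ?_
    rw [integral_add (integrable_const _) i0]
    simpa using hsum10
  · rw [← integral_sub hAi hab]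
    have i1 : Integrable (fun ω => 2 * (|a ω| ^ 10 + |b ω| ^ 10) / L ^ 8) μ :=
      (i0.const_mul 2).div_const _
    have i2 : Integrable (fun ω => |clip L (a ω) * clip L (b ω) - a ω * b ω|) μ := (hAi.sub hab).abs
    have hle : ∀ ω, |clip L (a ω) * clip L (b ω) - a ω * b ω| ≤
        2 * (|a ω| ^ 10 + |b ω| ^ 10) / L ^ 8 := fun ω => by
      rw [abs_sub_comm]
      exact abs_mul_sub_clip_mul_le hL0 _ _
    refine abs_integral_le_integral_abs.trans ((integral_mono i2 i1 hle).trans ?_)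
    rw [integral_div, integral_const_mul]
    exact div_le_div_of_nonneg_right (by linarith) (by positivity)

/-- The numerical bound behind the choice of block length `p` and number of blocks `n`. -/
theorem block_bound_le {T n p V D lam S e : ℝ} (hT1 : 72 ≤ T) (hnT : n ≤ T)
    (hpT : p * n ≤ T) (hV0 : 0 ≤ V) (hlog : 1 ≤ Real.log T) (hlam2 : lam ^ 2 = Real.log T / T)
    (hlamS : lam * S = Real.log T) (he : 0 ≤ e) (g3 : 24 * T ^ 2 * e ≤ T ^ (-D) / 3)
    (g4 : 12 * T ^ (-(D + 1)) ≤ T ^ (-D) / 3) :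
    4 * (n * (6 * e / (1 / T)) +
      Real.exp (-lam * ((V + D + 1) * S) + n * (lam ^ 2 * (p * V) + 1 / T))) ≤
      T ^ (-D) / 3 + T ^ (-D) / 3 := by
  have hT0 : 0 < T := by linarith
  have h1 : 4 * (n * (6 * e / (1 / T))) ≤ T ^ (-D) / 3 := by
    refine le_trans ?_ g3
    calc _ = 24 * (n * T) * e := by field_simp; ring
      _ ≤ 24 * (T * T) * e := by gcongr
      _ = _ := by ring
  have h2 : -lam * ((V + D + 1) * S) + n * (lam ^ 2 * (p * V) + 1 / T) ≤
      Real.log T * (-(D + 1)) + 1 := by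
    have e1 : -lam * ((V + D + 1) * S) = -(V + D + 1) * Real.log T := by
      rw [← hlamS]; ring
    have e2 : n * (lam ^ 2 * (p * V)) ≤ V * Real.log T := by
      rw [hlam2]
      calc n * (Real.log T / T * (p * V)) = (p * n) * (V * (Real.log T / T)) := by ring
        _ ≤ T * (V * (Real.log T / T)) := by gcongr
        _ = _ := by field_simp
    have e3 : n * (1 / T) ≤ 1 := by
      rw [mul_one_div, div_le_one hT0]; exact hnT
    rw [e1, mul_add]
    linarith
  have h3 : 4 * Real.exp (-lam * ((V + D + 1) * S) + n * (lam ^ 2 * (p * V) + 1 / T)) ≤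
      T ^ (-D) / 3 := by
    refine le_trans ?_ g4
    calc _ ≤ 4 * Real.exp (Real.log T * (-(D + 1)) + 1) := by gcongr
      _ = 4 * (T ^ (-(D + 1)) * Real.exp 1) := by
        rw [Real.exp_add, ← Real.rpow_def_of_pos hT0]
      _ ≤ 4 * (T ^ (-(D + 1)) * 3) := by
        gcongr; linarith [Real.exp_one_lt_d9]
      _ = _ := by ring
  linarith

set_option maxHeartbeats 400000 in
/-- Concentration of sample second moments of strongly mixing sequences with exponential tails. -/
theorem exists_concentration (μ : Measure Ω) [IsProbabilityMeasure μ] {c r₃ b₁ b₂ r₁ r₂ : ℝ}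
    (hc : 0 < c) (hr₃ : 0 < r₃)
    (hb₁ : 0 < b₁) (hb₂ : 0 < b₂) (hr₁ : 0 < r₁) (hr₂ : 0 < r₂) {D : ℝ} (hD : 0 < D) :
    ∃ K : ℝ, 0 < K ∧ ∃ T₀ : ℕ, ∀ T : ℕ, T₀ ≤ T → ∀ P Q : ℤ → MeasurableSpace Ω,
      ExpMixing μ P Q c r₃ → ∀ a b : ℤ → Ω → ℝ, (∀ t, Measurable[P t] (a t)) →
      (∀ t, Measurable[Q t] (a t)) → (∀ t, Measurable[P t] (b t)) → (∀ t, Measurable[Q t] (b t)) →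
      (∀ t s, 0 < s → μ.real {ω | s < |a t ω|} ≤ tailFn b₁ b₂ r₁ r₂ s) →
      (∀ t s, 0 < s → μ.real {ω | s < |b t ω|} ≤ tailFn b₁ b₂ r₁ r₂ s) →
      μ.real {ω | K * √(T * Real.log T) ≤ |∑ t ∈ Finset.range T,
        (a (t + 1) ω * b (t + 1) ω - ∫ ω', a (t + 1) ω' * b (t + 1) ω' ∂μ)|} ≤
          (T : ℝ) ^ (-D) := by
  obtain ⟨M, hM0, hM⟩ := exists_moment_bound μ hb₁ hb₂ hr₁ hr₂ 10
  obtain ⟨T₀, hT₀⟩ := exists_rate_bounds hc hr₃ hb₁ hb₂ hr₁ hr₂ D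
  set K3 := 1 + (M + M) with hK3
  set V := 10 * (1 + K3) ^ 2 * (2 * ∑' h, decay c r₃ h) with hV
  have hV0 : 0 ≤ V := mul_nonneg (by positivity) (mul_nonneg (by norm_num)
    (tsum_nonneg fun h => (decay_pos _ _ _).le))
  -- In the exponent V log T offsets the variance term; the remaining (D + 1) log T gives the power
  -- T^(-(D+1)).
  set K1 := V + D + 1 with hK1
  have hK10 : 0 < K1 := by positivity
  refine ⟨2 * K1 + 4 * M, by positivity, T₀, fun T hT P Q hmix a b haP haQ hbP hbQ hta htb => ?_⟩
  obtain ⟨hT72, g1, g2, g3, g4⟩ := hT₀ T hT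
  have hT1 : (72 : ℝ) ≤ T := by exact_mod_cast hT72
  have hT0 : (0 : ℝ) < T := by linarith
  set L := (T : ℝ) ^ (1 / 16 : ℝ) with hL
  have hL0 : 0 < L := by positivity
  set p := ⌈L⌉₊ with hp
  have hp1 : 1 ≤ p := Nat.one_le_ceil_iff.2 hL0
  have hlog1 : 1 ≤ Real.log T := by
    rw [Real.le_log_iff_exp_le hT0]
    linarith [Real.exp_one_lt_d9]
  have ham : ∀ t, Measurable (a t) := fun t => (haP t).mono (hmix.past_le t) le_rfl
  have hbm : ∀ t, Measurable (b t) := fun t => (hbP t).mono (hmix.past_le t) le_rfl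
  set A : ℤ → Ω → ℝ := fun t ω => clip L (a t ω) * clip L (b t ω) with hA
  have hcl := measurable_clip L
  have hAP : ∀ t, Measurable[P t] (A t) := fun t => (hcl.comp (haP t)).mul (hcl.comp (hbP t))
  have hAQ : ∀ t, Measurable[Q t] (A t) := fun t => (hcl.comp (haQ t)).mul (hcl.comp (hbQ t))
  have hAm : ∀ t, Measurable (A t) := fun t => (hAP t).mono (hmix.past_le t) le_rfl
  have hAB : ∀ t ω, |A t ω| ≤ L * L := fun t ω => by
    rw [hA, abs_mul]
    exact mul_le_mul (abs_clip_le hL0.le _) (abs_clip_le hL0.le _) (abs_nonneg _) hL0.le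
  have hAi : ∀ t, Integrable (A t) μ := fun t =>
    Integrable.of_bound (hAm t).aestronglyMeasurable _ (Eventually.of_forall (hAB t))
  have ha10 : ∀ t, Integrable (fun ω => |a t ω| ^ 10) μ := fun t => (hM _ (ham t) (hta t)).1
  have hb10 : ∀ t, Integrable (fun ω => |b t ω| ^ 10) μ := fun t => (hM _ (hbm t) (htb t)).1
  have hmo := fun t => clip_mul_moments (ham t) (hbm t) (ha10 t) (hb10 t) (hM _ (ham t) (hta t)).2
    (hM _ (hbm t) (htb t)).2 hL0
  have hA3 : ∀ t, ∫ ω, |A t ω| ^ 3 ∂μ ≤ K3 := fun t => (hmo t).1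
  have hL8 : L ^ 8 = √T := by
    rw [hL, ← Real.rpow_natCast, ← Real.rpow_mul hT0.le, Real.sqrt_eq_rpow]; norm_num
  have hbias : ∀ t, |∫ ω, A t ω ∂μ - ∫ ω, a t ω * b t ω ∂μ| ≤ 4 * M / √T := fun t => by
    rw [← hL8]; exact (hmo t).2
  -- The terms are extended by zero beyond the sample, so that the sum over complete pairs of blocks
  -- equals the sum over 1, …, T.
  set I : Set ℤ := Set.Icc 1 (T : ℤ) with hI
  have : DecidablePred (· ∈ I) := fun t => Set.decidableMemIcc
  set Z : ℤ → Ω → ℝ := fun t =>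
    if t ∈ I then fun ω => A t ω - ∫ ω', A t ω' ∂μ else fun _ => 0 with hZ
  have hZP : ∀ t, Measurable[P t] (Z t) := fun t => by
    simp only [hZ]; split_ifs
    exacts [(hAP t).sub_const _, measurable_const]
  have hZQ : ∀ t, Measurable[Q t] (Z t) := fun t => by
    simp only [hZ]; split_ifs
    exacts [(hAQ t).sub_const _, measurable_const]
  have hZB : ∀ t ω, |Z t ω| ≤ 2 * (L * L) := fun t ω => by
    simp only [hZ]; split_ifs
    · have h1 : |∫ ω', A t ω' ∂μ| ≤ L * L := by
        have h2 := norm_integral_le_of_norm_le_const (μ := μ) (f := A t)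
          (Eventually.of_forall (hAB t))
        simpa using h2
      have := abs_sub (A t ω) (∫ ω', A t ω' ∂μ)
      have := hAB t ω
      linarith
    · simp only [abs_zero]; positivity
  have hZ0 : ∀ t, ∫ ω, Z t ω ∂μ = 0 := fun t => by
    simp only [hZ]; split_ifs
    · rw [integral_sub (hAi t) (integrable_const _)]; simp
    · simp
  -- Rounding up covers the whole sample; pn ≤ T still holds since `p` is small compared with `T`.
  set n := T / (2 * p) + 1 with hn
  have hTn : T ≤ 2 * p * n := by
    have := Nat.lt_mul_div_succ T (show 0 < 2 * p by omega)
    exact this.le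
  have hpT : (p : ℝ) * n ≤ T := by
    have h1 : T / (2 * p) * (2 * p) ≤ T := Nat.div_mul_le_self _ _
    have h2 : (p : ℝ) ≤ T / 2 := by
      have h3 : (p : ℝ) ≤ L + 1 := (Nat.ceil_lt_add_one hL0.le).le
      have h4 : L ≤ √T := by
        rw [hL, Real.sqrt_eq_rpow]
        exact Real.rpow_le_rpow_of_exponent_le (by linarith) (by norm_num)
      have h5 : √(T : ℝ) ≤ T / 4 := by
        rw [Real.sqrt_le_left (by positivity)]; nlinarith
      linarith
    have h1' : ((T / (2 * p) : ℕ) : ℝ) * (2 * p) ≤ T := by exact_mod_cast h1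
    rw [hn]; push_cast
    nlinarith
  have hnT : (n : ℝ) ≤ T := by
    have : (1 : ℝ) ≤ p := by exact_mod_cast hp1
    have h0 : (0 : ℝ) ≤ n := by positivity
    nlinarith
  set lam := √(Real.log T / T) with hlam
  have hlam0 : 0 < lam := Real.sqrt_pos.2 (by positivity)
  have hlam2 : lam ^ 2 = Real.log T / T := Real.sq_sqrt (by positivity)
  set S := √(T * Real.log T) with hS
  have hlamS : lam * S = Real.log T := by
    rw [hlam, hS, ← Real.sqrt_mul (by positivity), show Real.log T / T * (T * Real.log T) =
      Real.log T * Real.log T by field_simp, Real.sqrt_mul_self (by linarith)]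
  have hmain := measure_abs_sum_ge_le (μ := μ) (α := Real.exp (-c * (p : ℝ) ^ r₃)) (V := V)
    (η := 1 / T) hmix.mono hmix.anti hmix.past_le hmix.future_le (fun t => hmix.mix t p hp1)
    hZP hZQ hZB hZ0 (fun b' => integral_sq_block_le hmix hAP hAQ hAB hA3 (I := I)
      (fun t => rfl) p b') hlam0 g1 (by positivity) (K1 * S) n
  have hbound : 4 * (n * (6 * Real.exp (-c * (p : ℝ) ^ r₃) / (1 / T)) +
      Real.exp (-lam * (K1 * S) + n * (lam ^ 2 * (p * V) + 1 / T))) ≤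
      (T : ℝ) ^ (-D) / 3 + (T : ℝ) ^ (-D) / 3 :=
    block_bound_le hT1 hnT hpT hV0 hlog1 hlam2 hlamS (Real.exp_pos _).le g3 g4
  have hsumZ : ∀ ω, ∑ t ∈ Finset.range (2 * p * n), Z (t + 1) ω =
      ∑ t ∈ Finset.range T, (A (t + 1) ω - ∫ ω', A (t + 1) ω' ∂μ) := fun ω => by
    rw [← Finset.sum_subset (Finset.range_mono hTn) fun t _ ht => ?_]
    · refine Finset.sum_congr rfl fun t ht => ?_
      have : (t : ℤ) + 1 ∈ I := by
        have := Finset.mem_range.1 ht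
        simp only [hI, Set.mem_Icc]; omega
      simp only [hZ, this, if_true]
    · have : (t : ℤ) + 1 ∉ I := by
        simp only [Finset.mem_range] at ht
        simp only [hI, Set.mem_Icc]; omega
      simp only [hZ, this, if_false]
  -- Outside `Bad` truncation changes no observation, so the original and the truncated sums differ
  -- only in their centring.
  set Bad : Set Ω := ⋃ t ∈ Finset.range T, ({ω | L < |a (t + 1) ω|} ∪ {ω | L < |b (t + 1) ω|})
    with hBad
  have hBadle : μ.real Bad ≤ (T : ℝ) ^ (-D) / 3 := by
    refine le_trans ?_ g2
    refine (measureReal_biUnion_finset_le _ _).trans ((Finset.sum_le_sum fun t _ =>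
      (measureReal_union_le _ _).trans (add_le_add (hta _ L hL0) (htb _ L hL0))).trans_eq ?_)
    simp; ring
  have hsub : {ω | (2 * K1 + 4 * M) * S ≤ |∑ t ∈ Finset.range T,
      (a (t + 1) ω * b (t + 1) ω - ∫ ω', a (t + 1) ω' * b (t + 1) ω' ∂μ)|} ⊆
      Bad ∪ {ω | 2 * (K1 * S) ≤ |∑ t ∈ Finset.range (2 * p * n), Z (t + 1) ω|} := by
    intro ω hω
    by_cases hb : ω ∈ Bad
    · exact Or.inl hb
    · refine Or.inr ?_
      simp only [hBad, Set.mem_iUnion, Set.mem_union, Set.mem_ofPred_eq, not_exists, not_or,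
        not_lt] at hb
      have e1 : ∑ t ∈ Finset.range T,
          (a (t + 1) ω * b (t + 1) ω - ∫ ω', a (t + 1) ω' * b (t + 1) ω' ∂μ) =
          ∑ t ∈ Finset.range T, (A (t + 1) ω - ∫ ω', A (t + 1) ω' ∂μ) +
          ∑ t ∈ Finset.range T, (∫ ω', A (t + 1) ω' ∂μ -
            ∫ ω', a (t + 1) ω' * b (t + 1) ω' ∂μ) := by
        rw [← Finset.sum_add_distrib]
        refine Finset.sum_congr rfl fun t ht => ?_
        have := hb t ht
        simp only [hA]
        rw [clip_eq_self this.1, clip_eq_self this.2]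
        ring
      have e2 : |∑ t ∈ Finset.range T, (∫ ω', A (t + 1) ω' ∂μ -
            ∫ ω', a (t + 1) ω' * b (t + 1) ω' ∂μ)| ≤ 4 * M * S := by
        refine (Finset.abs_sum_le_sum_abs _ _).trans
          ((Finset.sum_le_sum fun t _ => hbias _).trans ?_)
        simp only [Finset.sum_const, Finset.card_range, nsmul_eq_mul]
        have : √(T : ℝ) ≤ S := Real.sqrt_le_sqrt (by nlinarith)
        calc (T : ℝ) * (4 * M / √T) = 4 * M * √T := by
              rw [mul_div_assoc', div_eq_iff (Real.sqrt_pos.2 hT0).ne', mul_assoc,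
                Real.mul_self_sqrt hT0.le]; ring
          _ ≤ _ := by gcongr
      have hω' : (2 * K1 + 4 * M) * S ≤ |∑ t ∈ Finset.range T,
        (a (t + 1) ω * b (t + 1) ω - ∫ ω', a (t + 1) ω' * b (t + 1) ω' ∂μ)| := hω
      rw [e1] at hω'
      have e3 := abs_add_le (∑ t ∈ Finset.range T, (A (t + 1) ω - ∫ ω', A (t + 1) ω' ∂μ))
        (∑ t ∈ Finset.range T, (∫ ω', A (t + 1) ω' ∂μ -
            ∫ ω', a (t + 1) ω' * b (t + 1) ω' ∂μ))
      change 2 * (K1 * S) ≤ |_|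
      rw [hsumZ]
      linarith
  calc _ ≤ _ := measureReal_mono hsub
    _ ≤ (T : ℝ) ^ (-D) / 3 + ((T : ℝ) ^ (-D) / 3 + (T : ℝ) ^ (-D) / 3) :=
      (measureReal_union_le _ _).trans (add_le_add hBadle (hmain.trans hbound))
    _ = _ := by ring

end Concentration

/-! ### Stationarity and mixing of the factor model -/

namespace FactorModel

section Mixing

variable {Ω : Type*} {m0 : MeasurableSpace Ω} {r : ℕ}

/-- The path `t ↦ (f_t, u_t)`. -/
def path (M : FactorModel Ω r) (N : ℕ) (ω : Ω) (t : ℤ) : (Fin r → ℝ) × (Fin N → ℝ) :=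
  (M.f t ω, M.u N t ω)

/-- The σ-algebra generated by `{(f_s, u_s) : s ≤ t}`. -/
abbrev pastAt (M : FactorModel Ω r) (N : ℕ) (t : ℤ) : MeasurableSpace Ω :=
  ⨆ s : {s : ℤ // s ≤ t}, MeasurableSpace.comap (fun ω => M.path N ω s) inferInstance

/-- The σ-algebra generated by `{(f_s, u_s) : t ≤ s}`. -/
abbrev futureAt (M : FactorModel Ω r) (N : ℕ) (t : ℤ) : MeasurableSpace Ω :=
  ⨆ s : {s : ℤ // t ≤ s}, MeasurableSpace.comap (fun ω => M.path N ω s) inferInstance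

/-- The coordinates of `(u_t, f_t)`. -/
def coord (M : FactorModel Ω r) (N : ℕ) : Fin N ⊕ Fin r → ℤ → Ω → ℝ
  | Sum.inl i, t, ω => M.u N t ω i
  | Sum.inr k, t, ω => M.f t ω k

variable {μ : Measure Ω} {r₁ r₂ : ℝ} (M : FactorModel Ω r) (N : ℕ)

theorem measurable_path_apply (t : ℤ) : Measurable fun ω => M.path N ω t :=
  (M.measurable_f t).prodMk (M.measurable_u N t)

theorem measurable_path : Measurable (M.path N) :=
  measurable_pi_lambda _ fun t => M.measurable_path_apply N t

theorem pastAt_le (t : ℤ) : M.pastAt N t ≤ m0 :=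
  iSup_le fun s => (M.measurable_path_apply N s).comap_le

theorem futureAt_le (t : ℤ) : M.futureAt N t ≤ m0 :=
  iSup_le fun s => (M.measurable_path_apply N s).comap_le

theorem pastAt_mono : Monotone (M.pastAt N) := fun _ t hst =>
  iSup_le fun v => le_iSup (fun s : {s : ℤ // s ≤ t} =>
    MeasurableSpace.comap (fun ω => M.path N ω s) inferInstance) ⟨v, v.2.trans hst⟩

theorem futureAt_anti : Antitone (M.futureAt N) := fun s _ hst =>
  iSup_le fun v => le_iSup (fun v : {v : ℤ // s ≤ v} =>
    MeasurableSpace.comap (fun ω => M.path N ω v) inferInstance) ⟨v, hst.trans v.2⟩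

theorem measurable_pastAt (t : ℤ) : Measurable[M.pastAt N t] fun ω => M.path N ω t :=
  (comap_measurable _).mono (le_iSup (fun s : {s : ℤ // s ≤ t} =>
    MeasurableSpace.comap (fun ω => M.path N ω s) inferInstance) ⟨t, le_rfl⟩) le_rfl

theorem measurable_futureAt (t : ℤ) : Measurable[M.futureAt N t] fun ω => M.path N ω t :=
  (comap_measurable _).mono (le_iSup (fun s : {s : ℤ // t ≤ s} =>
    MeasurableSpace.comap (fun ω => M.path N ω s) inferInstance) ⟨t, le_rfl⟩) le_rfl

/-- A coordinate as a function of the state `(f_t, u_t)`. -/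
def coordMap {r N : ℕ} (c : Fin N ⊕ Fin r) (x : (Fin r → ℝ) × (Fin N → ℝ)) : ℝ :=
  Sum.elim x.2 x.1 c

theorem measurable_coordMap (c : Fin N ⊕ Fin r) : Measurable (coordMap c) := by
  rcases c with i | k
  · exact (measurable_pi_apply i).comp measurable_snd
  · exact (measurable_pi_apply k).comp measurable_fst

theorem coord_eq (c : Fin N ⊕ Fin r) (t : ℤ) (ω : Ω) :
    M.coord N c t ω = coordMap c (M.path N ω t) := by rcases c with i | k <;> rfl

theorem measurable_coord (c : Fin N ⊕ Fin r) (t : ℤ) : Measurable (M.coord N c t) := by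
  simp_rw [funext (M.coord_eq N c t)]
  exact (measurable_coordMap N c).comp (M.measurable_path_apply N t)

theorem measurable_coord_pastAt (c : Fin N ⊕ Fin r) (t : ℤ) :
    Measurable[M.pastAt N t] (M.coord N c t) := by
  simp_rw [funext (M.coord_eq N c t)]
  exact (measurable_coordMap N c).comp (M.measurable_pastAt N t)

theorem measurable_coord_futureAt (c : Fin N ⊕ Fin r) (t : ℤ) :
    Measurable[M.futureAt N t] (M.coord N c t) := by
  simp_rw [funext (M.coord_eq N c t)]
  exact (measurable_coordMap N c).comp (M.measurable_futureAt N t)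

variable {M}

/-- The one-step invariance is iterated; a negative shift is obtained by applying it to both sides
of the positive one. -/
theorem Regular.identDistrib_path (h : M.Regular μ r₁ r₂) (n : ℤ) :
    IdentDistrib (M.path N) (fun ω t => M.path N ω (t + n)) μ μ := by
  have hsh : ∀ n : ℤ, Measurable fun (x : ℤ → (Fin r → ℝ) × (Fin N → ℝ)) t => x (t + n) :=
    fun n => measurable_pi_lambda _ fun t => measurable_pi_apply _
  have hnat : ∀ n : ℕ, IdentDistrib (M.path N) (fun ω t => M.path N ω (t + n)) μ μ := by
    intro n
    induction n with
    | zero => simpa using IdentDistrib.refl (M.measurable_path N).aemeasurable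
    | succ n ih =>
      refine ih.trans ?_
      have := (h.stationary N).comp (hsh n)
      have e : (fun ω (t : ℤ) => M.path N ω (t + ((n + 1 : ℕ) : ℤ))) =
          (fun x t => x (t + (n : ℤ))) ∘ fun ω t => (M.f (t + 1) ω, M.u N (t + 1) ω) := by
        funext ω t
        simp only [Function.comp_apply, path, Nat.cast_succ, add_assoc]
      rw [e]
      exact this
  rcases Int.eq_nat_or_neg n with ⟨k, rfl | rfl⟩
  · exact hnat k
  · have := ((hnat k).comp (hsh (-k))).symm
    have e : (fun x t => x (t + -(k : ℤ))) ∘ (fun ω (t : ℤ) => M.path N ω (t + k)) = M.path N := by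
      funext ω t
      simp
    rwa [e] at this

/-- Exhibits the past at every `t` as the pullback of one σ-algebra on path space under the shifted
path, so that stationarity carries its events to time 0. -/
theorem pastAt_eq_comap (t : ℤ) : M.pastAt N t =
    MeasurableSpace.comap (fun ω s => M.path N ω (s + t))
      (⨆ s : {s : ℤ // s ≤ 0}, MeasurableSpace.comap (fun x => x s) inferInstance) := by
  rw [MeasurableSpace.comap_iSup]
  simp_rw [MeasurableSpace.comap_comp]
  refine le_antisymm (iSup_le fun s => ?_) (iSup_le fun s => ?_)
  · refine le_trans (le_of_eq ?_) (le_iSup _ ⟨(s : ℤ) - t, by have := s.2; omega⟩)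
    simp [Function.comp_def]
  · exact le_iSup (fun s : {s : ℤ // s ≤ t} =>
      MeasurableSpace.comap (fun ω => M.path N ω s) inferInstance) ⟨s + t, by have := s.2; omega⟩

theorem futureAt_eq_comap (k t : ℤ) : M.futureAt N (t + k) =
    MeasurableSpace.comap (fun ω s => M.path N ω (s + t))
      (⨆ s : {s : ℤ // k ≤ s}, MeasurableSpace.comap (fun x => x s) inferInstance) := by
  rw [MeasurableSpace.comap_iSup]
  simp_rw [MeasurableSpace.comap_comp]
  refine le_antisymm (iSup_le fun s => ?_) (iSup_le fun s => ?_)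
  · refine le_trans (le_of_eq ?_) (le_iSup _ ⟨(s : ℤ) - t, by have := s.2; omega⟩)
    simp [Function.comp_def]
  · exact le_iSup (fun s : {s : ℤ // t + k ≤ s} =>
      MeasurableSpace.comap (fun ω => M.path N ω s) inferInstance) ⟨s + t, by have := s.2; omega⟩

/-- The mixing assumption is anchored at time 0. Events at `t` are preimages of path events, whose
probabilities do not change when the path is shifted back. -/
theorem Regular.alphaLE [IsProbabilityMeasure μ] (h : M.Regular μ r₁ r₂) (t : ℤ) (k : ℕ) :
    AlphaLE μ (M.pastAt N t) (M.futureAt N (t + k)) (M.mixingCoeff μ N k) := by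
  intro A B hA hB
  rw [pastAt_eq_comap] at hA
  rw [futureAt_eq_comap] at hB
  obtain ⟨A', hA', rfl⟩ := hA
  obtain ⟨B', hB', rfl⟩ := hB
  have hle : ∀ p : ℤ → Prop, (⨆ s : {s : ℤ // p s}, MeasurableSpace.comap
      (fun x : ℤ → (Fin r → ℝ) × (Fin N → ℝ) => x s) inferInstance) ≤ MeasurableSpace.pi :=
    fun p => iSup_le fun s => (measurable_pi_apply _).comap_le
  have hA'' := hle _ _ hA'
  have hB'' := hle _ _ hB'
  have hid := h.identDistrib_path N t
  have hreal : ∀ S, MeasurableSet S → μ.real ((fun ω s => M.path N ω (s + t)) ⁻¹' S) =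
      μ.real (M.path N ⁻¹' S) := fun S hS => by
    rw [measureReal_def, measureReal_def, hid.measure_preimage_eq hS]
  rw [← Set.preimage_inter, hreal _ hA'', hreal _ hB'', hreal _ (hA''.inter hB'')]
  have hp0 : M.past N = M.pastAt N 0 := rfl
  have hf0 : M.future N k = M.futureAt N k := rfl
  have e0 : (fun ω s => M.path N ω (s + 0)) = M.path N := by simp
  refine le_csSup ⟨1, ?_⟩ ⟨M.path N ⁻¹' A', M.path N ⁻¹' B', ?_, ?_, rfl⟩
  · rintro x ⟨A, B, -, -, rfl⟩
    rw [abs_le]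
    have h1 : μ.real A ≤ 1 := measureReal_le_one
    have h2 : μ.real B ≤ 1 := measureReal_le_one
    have h3 : μ.real (A ∩ B) ≤ 1 := measureReal_le_one
    have h4 : 0 ≤ μ.real A * μ.real B := by positivity
    have h5 : μ.real A * μ.real B ≤ 1 := mul_le_one₀ h1 (by positivity) h2
    have h6 : 0 ≤ μ.real (A ∩ B) := by positivity
    constructor <;> linarith
  · rw [hp0, pastAt_eq_comap, e0]
    exact ⟨A', hA', rfl⟩
  · rw [hf0, show (k : ℤ) = 0 + k by simp, futureAt_eq_comap, e0]
    exact ⟨B', hB', rfl⟩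

theorem Regular.exists_expMixing [IsProbabilityMeasure μ] (h : M.Regular μ r₁ r₂) :
    ∃ c r₃ : ℝ, 0 < c ∧ 0 < r₃ ∧ ∀ N, ExpMixing μ (M.pastAt N) (M.futureAt N) c r₃ := by
  obtain ⟨r₃, c, hr₃, hc, hm⟩ := h.mixing
  refine ⟨c, r₃, hc, hr₃, fun N => ⟨hc, hr₃, M.pastAt_mono N, M.futureAt_anti N, M.pastAt_le N,
    M.futureAt_le N, fun t k hk => fun A B hA hB => (h.alphaLE N t k A B hA hB).trans (hm N k hk)⟩⟩

theorem Regular.exists_tail (h : M.Regular μ r₁ r₂) : ∃ b₁ b₂ : ℝ, 0 < b₁ ∧ 0 < b₂ ∧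
    (∀ N t i s, 0 < s → μ.real {ω | s < |M.u N t ω i|} ≤ Real.exp (-(s / b₁) ^ r₁)) ∧
    (∀ t k s, 0 < s → μ.real {ω | s < |M.f t ω k|} ≤ Real.exp (-(s / b₂) ^ r₂)) ∧
    ∀ N c t s, 0 < s → μ.real {ω | s < |M.coord N c t ω|} ≤ tailFn b₁ b₂ r₁ r₂ s := by
  obtain ⟨b₁, b₂, hb₁, hb₂, ht⟩ := h.tails
  refine ⟨b₁, b₂, hb₁, hb₂, fun N t i s hs => (ht s hs).1 N t i, fun t k s hs => (ht s hs).2 t k,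
    fun N c t s hs => ?_⟩
  unfold tailFn
  rcases c with i | k
  · exact ((ht s hs).1 N t i).trans (by linarith [Real.exp_pos (-(s / b₂) ^ r₂)])
  · exact ((ht s hs).2 t k).trans (by linarith [Real.exp_pos (-(s / b₁) ^ r₁)])

theorem Regular.integral_coord_mul (h : M.Regular μ r₁ r₂) (c c' : Fin N ⊕ Fin r) (t : ℤ) :
    ∫ ω, M.coord N c t ω * M.coord N c' t ω ∂μ =
      ∫ ω, M.coord N c 1 ω * M.coord N c' 1 ω ∂μ := by
  have hm : ∀ c : Fin N ⊕ Fin r, Measurable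
      fun x : ℤ → (Fin r → ℝ) × (Fin N → ℝ) => coordMap c (x 1) :=
    fun c => (measurable_coordMap N c).comp (measurable_pi_apply (1 : ℤ))
  have h1 := ((h.identDistrib_path N (t - 1)).comp ((hm c).mul (hm c'))).integral_eq
  simp only [Function.comp_def, Pi.mul_apply, add_sub_cancel] at h1
  simp_rw [coord_eq]
  exact h1.symm

end Mixing

end FactorModel

/-! ### From entrywise errors to `SampleBounds` -/

section Population

open scoped Matrix.Norms.Frobenius

theorem sampleBounds_of_moments {N T r : ℕ} {Λ : Matrix (Fin N) (Fin r) ℝ}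
    {F : Matrix (Fin T) (Fin r) ℝ} {U : Matrix (Fin N) (Fin T) ℝ} {Sig : Matrix (Fin N) (Fin N) ℝ}
    {G : Matrix (Fin r) (Fin r) ℝ} {c₁ c₂ KG K₀ ε κ₀ : ℝ} (hN : 0 < N) (hT : 0 < T) (hc₁ : 0 < c₁)
    (hc₂ : 0 < c₂) (hKG : 0 ≤ KG) (hK₀ : 0 ≤ K₀) (hε0 : 0 ≤ ε) (hε1 : ε ≤ 1) (hκ₀ : 0 < κ₀)
    (hΛ : ∀ i, vnorm (Λ i) ≤ c₁)
    (hperv : ∀ z, κ₀ * N * (z ⬝ᵥ z) ≤ (Λ *ᵥ z) ⬝ᵥ (Λ *ᵥ z)) (hS : Sigᵀ = Sig)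
    (hS0 : ∀ x, 0 ≤ x ⬝ᵥ (Sig *ᵥ x)) (hS1 : ∀ x, x ⬝ᵥ (Sig *ᵥ x) ≤ c₁ * (x ⬝ᵥ x))
    (hG : ∀ z, c₂ * (z ⬝ᵥ z) ≤ z ⬝ᵥ (G *ᵥ z)) (hGK : ∀ k l, |G k l| ≤ KG)
    (hUU : ∀ i j, |((T : ℝ)⁻¹ • (U * Uᵀ)) i j - Sig i j| ≤ K₀ * ε)
    (hUF : ∀ i k, |((T : ℝ)⁻¹ • (U * F)) i k| ≤ K₀ * ε)
    (hFF : ∀ k l, |((T : ℝ)⁻¹ • (Fᵀ * F)) k l - G k l| ≤ K₀ * ε)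
    (hsmall : √r * (√r * (K₀ * ε)) ≤ c₂ / 2) :
    SampleBounds (1 + √r + c₁ + K₀ + √r * K₀ + √r * (√r * (KG + K₀))) (min 1 (min κ₀ (c₂ / 2))) ε
      Λ F U Sig := by
  have p1 : 0 ≤ √(r : ℝ) := Real.sqrt_nonneg _
  have p2 : 0 ≤ √(r : ℝ) * K₀ := by positivity
  have p3 : 0 ≤ √(r : ℝ) * (√r * (KG + K₀)) := by positivity
  set K := 1 + √r + c₁ + K₀ + √r * K₀ + √r * (√r * (KG + K₀)) with hK
  have q : ∀ z : Fin r → ℝ, 0 ≤ z ⬝ᵥ z := fun z => by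
    rw [← vnorm_sq_eq_dotProduct]; positivity
  refine ⟨hN, hT, by linarith, by linarith, by positivity, hε0, hε1, fun i => ?_, fun z => ?_,
    fun i j => ?_, fun i => ?_, fun z => ?_, ?_, fun i => ?_⟩
  · exact (hΛ i).trans (by linarith)
  · refine le_trans ?_ (hperv z)
    have := q z
    gcongr
    exact (min_le_right _ _).trans (min_le_left _ _)
  · refine (hUU i j).trans ?_
    gcongr
    linarith
  · refine (vnorm_le_of_abs_le (by positivity) (hUF i)).trans ?_
    rw [← mul_assoc]
    gcongr
    linarith
  · set G' := (T : ℝ)⁻¹ • (Fᵀ * F) with hG'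
    have h1 : z ⬝ᵥ (G' *ᵥ z) = z ⬝ᵥ (G *ᵥ z) + z ⬝ᵥ ((G' - G) *ᵥ z) := by
      rw [sub_mulVec, dotProduct_sub]; ring
    have h2 : |z ⬝ᵥ ((G' - G) *ᵥ z)| ≤ c₂ / 2 * (z ⬝ᵥ z) := by
      refine (abs_dotProduct_le _ _).trans ?_
      have h3 : ‖G' - G‖ ≤ c₂ / 2 :=
        (frob_le_of_entries (by positivity) fun k l => hFF k l).trans hsmall
      calc vnorm z * vnorm ((G' - G) *ᵥ z) ≤ vnorm z * (c₂ / 2 * vnorm z) :=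
            mul_le_mul_of_nonneg_left ((vnorm_mulVec_le _ _).trans
              (mul_le_mul_of_nonneg_right h3 (vnorm_nonneg _))) (vnorm_nonneg _)
        _ = c₂ / 2 * (z ⬝ᵥ z) := by rw [← vnorm_sq_eq_dotProduct]; ring
    have h4 : min 1 (min κ₀ (c₂ / 2)) * (z ⬝ᵥ z) ≤ c₂ / 2 * (z ⬝ᵥ z) :=
      mul_le_mul_of_nonneg_right ((min_le_right _ _).trans (min_le_right _ _)) (q z)
    have h5 := hG z
    have h6 := neg_abs_le (z ⬝ᵥ ((G' - G) *ᵥ z))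
    linarith
  · refine (frob_le_of_entries (K := KG + K₀) (by positivity) fun k l => ?_).trans (by linarith)
    have h1 := hFF k l
    have h2 := hGK k l
    have h3 : K₀ * ε ≤ K₀ := mul_le_of_le_one_right hK₀ hε1
    have h4 := abs_add_le (((T : ℝ)⁻¹ • (Fᵀ * F)) k l - G k l) (G k l)
    rw [sub_add_cancel] at h4
    linarith
  · have h1 := vnorm_mulVec_le_of_quadForm hS hc₁ hS0 hS1 (Pi.single i 1)
    have h2 : Sig *ᵥ Pi.single i 1 = Sig i := by
      ext j
      rw [mulVec_single_one]
      exact congrFun (congrFun hS i) j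
    have h3 : vnorm (Pi.single i (1 : ℝ) : Fin N → ℝ) = 1 := by
      have h4 := vnorm_sq (Pi.single i (1 : ℝ) : Fin N → ℝ)
      have h5 : ∑ j, (Pi.single i (1 : ℝ) : Fin N → ℝ) j ^ 2 = 1 := by
        simp [Pi.single_apply]
      rw [h5] at h4
      nlinarith [vnorm_nonneg (Pi.single i (1 : ℝ) : Fin N → ℝ)]
    rw [h2, h3] at h1
    linarith

end Population

/-! ### Moments and population bounds -/

namespace FactorModel

section Moments

variable {Ω : Type*} {m0 : MeasurableSpace Ω} {r : ℕ} {μ : Measure Ω} {r₁ r₂ : ℝ}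
  {M : FactorModel Ω r}

theorem Regular.covU_apply (h : M.Regular μ r₁ r₂) (N : ℕ) (i j : Fin N) :
    M.covU μ N i j = ∫ ω, M.coord N (Sum.inl i) 1 ω * M.coord N (Sum.inl j) 1 ω ∂μ := by
  simp only [covU, Matrix.of_apply, covariance, h.mean_u, sub_zero]
  rfl

theorem covU_transpose (N : ℕ) : (M.covU μ N)ᵀ = M.covU μ N := by
  ext i j
  simp only [covU, Matrix.transpose_apply, Matrix.of_apply]
  exact covariance_comm _ _

theorem covF_transpose : (M.covF μ)ᵀ = M.covF μ := by
  ext i j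
  simp only [covF, Matrix.transpose_apply, Matrix.of_apply]
  exact covariance_comm _ _

variable [IsProbabilityMeasure μ]

theorem Regular.exists_moments (h : M.Regular μ r₁ r₂) (n : ℕ) : ∃ K : ℝ, 0 ≤ K ∧ ∀ N c t,
    Integrable (fun ω => |M.coord N c t ω| ^ n) μ ∧ ∫ ω, |M.coord N c t ω| ^ n ∂μ ≤ K := by
  obtain ⟨b₁, b₂, hb₁, hb₂, -, -, ht⟩ := h.exists_tail
  obtain ⟨K, hK, hm⟩ := exists_moment_bound μ hb₁ hb₂ h.r₁_pos h.r₂_pos n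
  exact ⟨K, hK, fun N c t => hm _ (M.measurable_coord N c t) fun s hs => ht N c t s hs⟩

theorem Regular.memLp_coord (h : M.Regular μ r₁ r₂) (N : ℕ) (c : Fin N ⊕ Fin r) (t : ℤ) (n : ℕ) :
    MemLp (M.coord N c t) n μ := by
  rcases Nat.eq_zero_or_pos n with rfl | hn
  · simpa using memLp_zero_iff_aestronglyMeasurable.2 (M.measurable_coord N c t).aestronglyMeasurable
  obtain ⟨K, hK, hm⟩ := h.exists_moments n
  rw [← integrable_norm_rpow_iff (M.measurable_coord N c t).aestronglyMeasurable
    (by exact_mod_cast hn.ne') (by simp)]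
  simpa using (hm N c t).1

theorem Regular.integrable_coord_mul (h : M.Regular μ r₁ r₂) (N : ℕ) (c c' : Fin N ⊕ Fin r)
    (s t : ℤ) : Integrable (fun ω => M.coord N c s ω * M.coord N c' t ω) μ :=
  MemLp.integrable_mul (p := 2) (q := 2) (mod_cast h.memLp_coord N c s 2)
    (mod_cast h.memLp_coord N c' t 2)

theorem Regular.exists_integral_coord_mul_le (h : M.Regular μ r₁ r₂) : ∃ K : ℝ, 0 ≤ K ∧
    ∀ N (c c' : Fin N ⊕ Fin r) s t, |∫ ω, M.coord N c s ω * M.coord N c' t ω ∂μ| ≤ K := by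
  obtain ⟨K, hK, hm⟩ := h.exists_moments 2
  refine ⟨K, hK, fun N c c' s t => abs_integral_le_integral_abs.trans ?_⟩
  have h1 := hm N c s
  have h2 := hm N c' t
  calc _ ≤ ∫ ω, (2⁻¹ * |M.coord N c s ω| ^ 2 + 2⁻¹ * |M.coord N c' t ω| ^ 2) ∂μ := by
        refine integral_mono (h.integrable_coord_mul N c c' s t).abs
          ((h1.1.const_mul _).add (h2.1.const_mul _)) fun ω => ?_
        show |M.coord N c s ω * M.coord N c' t ω| ≤ _
        rw [abs_mul]
        nlinarith [sq_nonneg (|M.coord N c s ω| - |M.coord N c' t ω|)]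
    _ ≤ K := by
        rw [integral_add (h1.1.const_mul _) (h2.1.const_mul _), integral_const_mul,
          integral_const_mul]
        linarith [h1.2, h2.2]

/-- The second moment matrix of the factors. -/
noncomputable def momentF (M : FactorModel Ω r) (μ : Measure Ω) : Matrix (Fin r) (Fin r) ℝ :=
  Matrix.of fun k l => ∫ ω, M.coord 0 (Sum.inr k) 1 ω * M.coord 0 (Sum.inr l) 1 ω ∂μ

/-- The factors need not be centred. The mean adds a positive semidefinite term, so the lower
eigenvalue bound for cov(f_t) passes to the second moment matrix, which is what F'F/T estimates. -/
theorem Regular.momentF_eq (h : M.Regular μ r₁ r₂) : M.momentF μ = M.covF μ +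
    vecMulVec (fun k => ∫ ω, M.f 1 ω k ∂μ) (fun k => ∫ ω, M.f 1 ω k ∂μ) := by
  ext k l
  have h1 := covariance_eq_sub (h.memLp_coord 0 (Sum.inr k) 1 2) (h.memLp_coord 0 (Sum.inr l) 1 2)
  simp only [momentF, covF, Matrix.of_apply, Matrix.add_apply, vecMulVec_apply]
  have h2 : cov[fun ω => M.f 1 ω k, fun ω => M.f 1 ω l; μ] =
      cov[M.coord 0 (Sum.inr k) 1, M.coord 0 (Sum.inr l) 1; μ] := rfl
  rw [h2, h1]
  simp [coord]

theorem Regular.exists_population (h : M.Regular μ r₁ r₂) : ∃ c₁ c₂ : ℝ, 0 < c₁ ∧ 0 < c₂ ∧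
    (∀ N x, c₂ * (x ⬝ᵥ x) ≤ x ⬝ᵥ (M.covU μ N *ᵥ x)) ∧
    (∀ N x, x ⬝ᵥ (M.covU μ N *ᵥ x) ≤ c₁ * (x ⬝ᵥ x)) ∧
    (∀ N j, vnorm (M.Λ N j) ≤ c₁) ∧
    (∀ z, c₂ * (z ⬝ᵥ z) ≤ z ⬝ᵥ (M.momentF μ *ᵥ z)) := by
  obtain ⟨c₁, c₂, hc₁, hc₂, hU, hΛ, hF⟩ := h.bounds
  refine ⟨c₁, c₂, hc₁, hc₂, fun N => quadForm_ge_of_eigenvalues (covU_transpose N)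
    fun κ x hx he => ((hU N κ (mem_spectrum_of_mulVec hx he)).1).le,
    fun N => quadForm_le_of_eigenvalues (covU_transpose N)
    fun κ x hx he => ((hU N κ (mem_spectrum_of_mulVec hx he)).2).le, fun N j => (hΛ N j).le,
    fun z => ?_⟩
  refine (quadForm_ge_of_eigenvalues covF_transpose
    (fun κ x hx he => ((hF κ (mem_spectrum_of_mulVec hx he)).1).le) z).trans ?_
  rw [h.momentF_eq, add_mulVec, dotProduct_add, vecMulVec_mulVec, op_smul_eq_smul, dotProduct_smul,
    dotProduct_comm z (fun k => ∫ ω, M.f 1 ω k ∂μ), smul_eq_mul]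
  linarith [mul_self_nonneg ((fun k => ∫ ω, M.f 1 ω k ∂μ) ⬝ᵥ z)]

theorem Pervasive.exists_quadForm_ge (h : M.Pervasive) : ∃ κ : ℝ, 0 < κ ∧ ∀ᶠ N : ℕ in atTop,
    ∀ z, κ * N * (z ⬝ᵥ z) ≤ (M.Λ N *ᵥ z) ⬝ᵥ (M.Λ N *ᵥ z) := by
  obtain ⟨c, C, hc, hev⟩ := h
  refine ⟨c, hc, ?_⟩
  filter_upwards [hev, eventually_gt_atTop 0] with N hN hN0 z
  have hN' : (0 : ℝ) < N := by exact_mod_cast hN0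
  have h1 := quadForm_ge_of_eigenvalues (A := (N : ℝ)⁻¹ • ((M.Λ N)ᵀ * M.Λ N))
    (by rw [transpose_smul, transpose_mul, transpose_transpose])
    (fun κ x hx he => (hN κ (mem_spectrum_of_mulVec hx he)).1) z
  rw [smul_mulVec, dotProduct_smul, ← mulVec_mulVec, smul_eq_mul] at h1
  have h2 : z ⬝ᵥ ((M.Λ N)ᵀ *ᵥ (M.Λ N *ᵥ z)) = (M.Λ N *ᵥ z) ⬝ᵥ (M.Λ N *ᵥ z) := by
    rw [dotProduct_mulVec, vecMul_transpose]
  rw [h2] at h1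
  rw [inv_mul_eq_div, le_div_iff₀ hN'] at h1
  linarith

end Moments

end FactorModel

/-! ### Scores with the population weights -/

section Scores

open scoped Matrix.Norms.Frobenius

theorem sq_le_sq_mul_one_add_rpow {y M δ : ℝ} (hy : 0 ≤ y) (hM : 0 < M) (hδ : 2 ≤ δ) :
    y ^ 2 ≤ M ^ 2 * (1 + (y / M) ^ δ) := by
  have key : ∀ z : ℝ, 0 ≤ z → z ^ 2 ≤ 1 + z ^ δ := fun z hz => by
    rcases le_total z 1 with h | h
    · have h1 : z ^ 2 ≤ 1 := pow_le_one₀ hz h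
      have h2 : 0 ≤ z ^ δ := by positivity
      linarith
    · have h1 : z ^ (2 : ℝ) ≤ z ^ δ := Real.rpow_le_rpow_of_exponent_le h hδ
      rw [Real.rpow_two] at h1
      linarith
  calc y ^ 2 = M ^ 2 * (y / M) ^ 2 := by field_simp
    _ ≤ _ := by gcongr; exact key _ (by positivity)

/-- From δ-th powers to squares at scale `M`: M = 1 serves for averages, M = T^(1/δ) for the worst
row. -/
theorem sum_sq_le_of_sum_rpow_le {ι : Type*} {s : Finset ι} {y : ι → ℝ} {M δ A : ℝ}
    (hy : ∀ i ∈ s, 0 ≤ y i) (hM : 0 < M) (hδ : 2 ≤ δ) (h : ∑ i ∈ s, y i ^ δ ≤ M ^ δ * A) :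
    ∑ i ∈ s, y i ^ 2 ≤ M ^ 2 * (s.card + A) := by
  calc ∑ i ∈ s, y i ^ 2 ≤ ∑ i ∈ s, M ^ 2 * (1 + (y i / M) ^ δ) :=
        Finset.sum_le_sum fun i hi => sq_le_sq_mul_one_add_rpow (hy i hi) hM hδ
    _ = M ^ 2 * (s.card + (∑ i ∈ s, y i ^ δ) / M ^ δ) := by
        rw [← Finset.mul_sum, Finset.sum_add_distrib, Finset.sum_div]
        congr 2
        · simp
        · exact Finset.sum_congr rfl fun i hi => Real.div_rpow (hy i hi) hM.le _
    _ ≤ _ := by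
        gcongr
        rw [div_le_iff₀ (by positivity)]
        linarith

/-- U'WU splits into its mean `E`, whose rows have norm O(N) because autocovariances are summable,
and the fluctuation `D`, controlled by its δ-th moments. -/
theorem scoreBounds_of_moments {N T r : ℕ} {Λ : Matrix (Fin N) (Fin r) ℝ}
    {F : Matrix (Fin T) (Fin r) ℝ} {U : Matrix (Fin N) (Fin T) ℝ} {W : Matrix (Fin N) (Fin N) ℝ}
    {E ψ : Matrix (Fin T) (Fin T) ℝ} {δ B C S₀ L Lf : ℝ} (hδ : 2 ≤ δ) (hN : 0 < N) (hT : 0 < T)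
    (hB : 1 ≤ B) (hW : Wᵀ = W) (hC : 0 ≤ C) (hψ0 : ∀ t s, 0 ≤ ψ t s) (hψ1 : ∀ t s, ψ t s ≤ 1)
    (hψ : ∀ t, ∑ s, ψ t s ≤ S₀)
    (h1 : ∑ t, vnorm ((√(N : ℝ))⁻¹ • ((Λᵀ * W) *ᵥ (Uᵀ t))) ^ δ ≤ T * B)
    (h2 : ∑ t, ∑ s, |(√(N : ℝ))⁻¹ * (Uᵀ t ⬝ᵥ (W *ᵥ Uᵀ s) - E t s)| ^ δ ≤ (T : ℝ) ^ 2 * B)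
    (h3 : ∀ t s, |E t s| ≤ N * C * ψ t s) (hL : 0 ≤ L) (hLf : 0 ≤ Lf) (hUL : ∀ i t, |U i t| ≤ L)
    (hFL : ∀ t, vnorm (F t) ≤ Lf) :
    ScoreBounds (1 + B + C * (1 + S₀)) ((T : ℝ) ^ (1 / δ)) L Lf Λ F U W := by
  have hN0 : (0 : ℝ) < N := by exact_mod_cast hN
  have hT0 : (0 : ℝ) < T := by exact_mod_cast hT
  have hS₀ : 0 ≤ S₀ := (Finset.sum_nonneg fun s _ => hψ0 ⟨0, hT⟩ s).trans (hψ _)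
  have hC1 : 0 ≤ C * (1 + S₀) := by positivity
  have hsN : 0 < √(N : ℝ) := Real.sqrt_pos.2 hN0
  have hδ0 : 0 < δ := by linarith
  set τ := (T : ℝ) ^ (1 / δ) with hτ
  have hτ0 : 0 < τ := by positivity
  have hτδ : τ ^ δ = T := by
    rw [hτ, ← Real.rpow_mul hT0.le, one_div_mul_cancel hδ0.ne', Real.rpow_one]
  have hB1 : √(1 + B) ≤ 1 + B := by
    rw [Real.sqrt_le_left (by linarith)]; nlinarith
  have hBB : 1 + B ≤ (1 + B) ^ 2 := by nlinarith
  have hBT : T * (1 + B) ≤ T * (1 + B) ^ 2 := mul_le_mul_of_nonneg_left hBB hT0.le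
  have hS1 : √S₀ ≤ 1 + S₀ := by
    rw [Real.sqrt_le_left (by linarith)]; nlinarith
  set a : Fin T → ℝ := fun t => vnorm ((√(N : ℝ))⁻¹ • ((Λᵀ * W) *ᵥ (Uᵀ t))) with ha
  have ha0 : ∀ t, 0 ≤ a t := fun t => vnorm_nonneg _
  have hrow : ∀ t, vnorm ((Uᵀ * W * Λ) t) = √N * a t := fun t => by
    have e : (Uᵀ * W * Λ) t = (Λᵀ * W) *ᵥ (Uᵀ t) := by
      have : Uᵀ * W * Λ = ((Λᵀ * W) * U)ᵀ := by
        rw [transpose_mul, transpose_mul, hW, transpose_transpose, Matrix.mul_assoc]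
      rw [this]; rfl
    simp only [ha]
    rw [e, vnorm_smul, abs_of_nonneg (by positivity), mul_inv_cancel_left₀ hsN.ne']
  set b : Fin T → Fin T → ℝ := fun t s => |(√(N : ℝ))⁻¹ * (Uᵀ t ⬝ᵥ (W *ᵥ Uᵀ s) - E t s)| with hb
  have hb0 : ∀ t s, 0 ≤ b t s := fun t s => abs_nonneg _
  set D : Matrix (Fin T) (Fin T) ℝ := Uᵀ * W * U - E with hD
  have hentry : ∀ t s, (Uᵀ * W * U) t s = Uᵀ t ⬝ᵥ (W *ᵥ Uᵀ s) := fun t s => by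
    rw [Matrix.mul_assoc]; rfl
  have hDb : ∀ t s, D t s ^ 2 = N * b t s ^ 2 := fun t s => by
    rw [hb, sq_abs, mul_pow, inv_pow, Real.sq_sqrt hN0.le, hD, Matrix.sub_apply, hentry]
    field_simp
  -- One row is a part of the double sum, which is at most T²B = τ^δ·TB; at scale M = τ the row
  -- exceeds its average size by the factor τ only.
  have hDrow : ∀ t, vnorm (D t) ≤ √N * (τ * (√T * (1 + B))) := fun t => by
    have h4 : ∑ s, b t s ^ δ ≤ τ ^ δ * (T * B) := by
      rw [hτδ]
      refine le_trans (Finset.single_le_sum (f := fun t => ∑ s, b t s ^ δ)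
        (fun t _ => Finset.sum_nonneg fun s _ => Real.rpow_nonneg (hb0 t s) _)
        (Finset.mem_univ t)) (h2.trans_eq (by ring))
    have h5 := sum_sq_le_of_sum_rpow_le (fun s _ => hb0 t s) hτ0 hδ h4
    refine le_of_sq_le_sq ?_ (by positivity)
    rw [vnorm_sq]
    simp_rw [hDb]
    rw [← Finset.mul_sum, mul_pow, mul_pow, mul_pow, Real.sq_sqrt hN0.le, Real.sq_sqrt hT0.le]
    refine mul_le_mul_of_nonneg_left (h5.trans ?_) hN0.le
    refine mul_le_mul_of_nonneg_left ?_ (by positivity)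
    simp only [Finset.card_univ, Fintype.card_fin]
    linarith
  have hDnorm : ‖D‖ ≤ √N * (T * (1 + B)) := by
    have h4 : ∑ p : Fin T × Fin T, b p.1 p.2 ^ δ ≤ (1 : ℝ) ^ δ * (T ^ 2 * B) := by
      rw [Fintype.sum_prod_type, Real.one_rpow, one_mul]; exact h2
    have h5 := sum_sq_le_of_sum_rpow_le (fun p _ => hb0 p.1 p.2) one_pos hδ h4
    refine le_of_sq_le_sq ?_ (by positivity)
    rw [frob_sq_sum]
    simp_rw [hDb]
    simp_rw [← Finset.mul_sum]
    rw [mul_pow, mul_pow, Real.sq_sqrt hN0.le]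
    refine mul_le_mul_of_nonneg_left ?_ hN0.le
    rw [Fintype.sum_prod_type] at h5
    refine h5.trans ?_
    simp only [Finset.card_univ, Fintype.card_prod, Fintype.card_fin, one_pow, one_mul]
    push_cast
    have : (T : ℝ) ^ 2 * (1 + B) ≤ T ^ 2 * (1 + B) ^ 2 :=
      mul_le_mul_of_nonneg_left hBB (by positivity)
    linarith
  have hErow : ∀ t, vnorm (E t) ≤ N * (C * (1 + S₀)) := fun t => by
    have h4 : vnorm (E t) ≤ N * C * √S₀ := by
      refine le_of_sq_le_sq ?_ (by positivity)
      rw [vnorm_sq, mul_pow, Real.sq_sqrt hS₀]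
      calc ∑ s, E t s ^ 2 ≤ ∑ s, (N * C) ^ 2 * ψ t s := Finset.sum_le_sum fun s _ => by
            rw [← sq_abs]
            calc |E t s| ^ 2 ≤ (N * C * ψ t s) ^ 2 := by gcongr; exact h3 t s
              _ = (N * C) ^ 2 * (ψ t s * ψ t s) := by ring
              _ ≤ (N * C) ^ 2 * (ψ t s * 1) := by
                have := hψ0 t s
                gcongr; exact hψ1 t s
              _ = _ := by ring
        _ ≤ _ := by rw [← Finset.mul_sum]; gcongr; exact hψ t
    refine h4.trans ?_
    rw [mul_assoc]
    gcongr
  have hEnorm : ‖E‖ ≤ √T * (N * (C * (1 + S₀))) := frob_le_of_rows (by positivity) hErow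
  have hsplit : Uᵀ * W * U = D + E := by rw [hD, sub_add_cancel]
  have hx1 : 1 + B ≤ 1 + B + C * (1 + S₀) := by linarith
  have hx2 : C * (1 + S₀) ≤ 1 + B + C * (1 + S₀) := by linarith
  have hx3 : B ≤ 1 + B + C * (1 + S₀) := by linarith
  have hx4 : 1 ≤ 1 + B + C * (1 + S₀) := by linarith
  generalize 1 + B + C * (1 + S₀) = x at hx1 hx2 hx3 hx4 ⊢
  refine ⟨hx4, hτ0.le, hL, hLf, ?_, fun t => ?_, ?_, fun t => ?_, hUL, hFL⟩
  · have h4 : ∑ t, a t ^ δ ≤ (1 : ℝ) ^ δ * (T * B) := by rw [Real.one_rpow, one_mul]; exact h1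
    have h5 := sum_sq_le_of_sum_rpow_le (fun t _ => ha0 t) one_pos hδ h4
    have h6 : ‖Uᵀ * W * Λ‖ ≤ √N * √T * (1 + B) := by
      refine le_of_sq_le_sq ?_ (by positivity)
      rw [frob_sq]
      simp_rw [hrow, mul_pow, Real.sq_sqrt hN0.le, Real.sq_sqrt hT0.le]
      rw [← Finset.mul_sum, mul_assoc]
      refine mul_le_mul_of_nonneg_left (h5.trans ?_) hN0.le
      simp only [Finset.card_univ, Fintype.card_fin, one_pow, one_mul]
      linarith
    refine h6.trans ?_
    gcongr
  · rw [hrow, mul_assoc]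
    refine mul_le_mul_of_nonneg_left ?_ hsN.le
    have h4 : a t ^ δ ≤ (τ * B) ^ δ := by
      rw [Real.mul_rpow hτ0.le (by linarith), hτδ]
      refine (Finset.single_le_sum (f := fun t => a t ^ δ)
        (fun t _ => Real.rpow_nonneg (ha0 t) _) (Finset.mem_univ t)).trans (h1.trans ?_)
      gcongr
      exact Real.self_le_rpow_of_one_le hB (by linarith)
    have h5 := (Real.rpow_le_rpow_iff (ha0 t) (by positivity) hδ0).1 h4
    refine h5.trans ?_
    gcongr
  · rw [hsplit]
    refine (norm_add_le _ _).trans ((add_le_add hDnorm hEnorm).trans ?_)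
    have e1 : √(N : ℝ) * (T * (1 + B)) ≤ T * √N * x := by
      rw [show √(N : ℝ) * (T * (1 + B)) = T * √N * (1 + B) by ring]
      gcongr
    have e2 : √(T : ℝ) * (N * (C * (1 + S₀))) ≤ N * √T * x := by
      rw [show √(T : ℝ) * (N * (C * (1 + S₀))) = N * √T * (C * (1 + S₀)) by ring]
      gcongr
    linarith
  · rw [hsplit]
    refine (vnorm_add_le _ _).trans ((add_le_add (hDrow t) (hErow t)).trans ?_)
    have e1 : √(N : ℝ) * (τ * (√T * (1 + B))) ≤ √T * √N * τ * x := by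
      rw [show √(N : ℝ) * (τ * (√T * (1 + B))) = √T * √N * τ * (1 + B) by ring]
      gcongr
    have e2 : N * (C * (1 + S₀)) ≤ N * x := by
      gcongr
    linarith

end Scores

/-! ### Measurability, integrability and Markov's inequality -/

section Markov

variable {Ω : Type*} {m0 : MeasurableSpace Ω} {μ : Measure Ω}

theorem measurable_vnorm {k : ℕ} {v : Ω → Fin k → ℝ} (hv : ∀ i, Measurable fun ω => v ω i) :
    Measurable fun ω => vnorm (v ω) := by
  have e : ∀ ω, vnorm (v ω) = √(∑ i, v ω i ^ 2) := fun ω => by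
    rw [← vnorm_sq, Real.sqrt_sq (vnorm_nonneg _)]
  simp_rw [e]
  exact (Finset.measurable_sum _ fun i _ => (hv i).pow_const 2).sqrt

theorem memLp_vnorm {k : ℕ} {v : Ω → Fin k → ℝ} (hm : ∀ i, Measurable fun ω => v ω i) {p : ENNReal}
    (hv : ∀ i, MemLp (fun ω => v ω i) p μ) : MemLp (fun ω => vnorm (v ω)) p μ := by
  have h1 : MemLp (fun ω => √k * ∑ i, |v ω i|) p μ :=
    (memLp_finsetSum _ fun i _ => (hv i).abs).const_mul _
  refine h1.mono' (measurable_vnorm hm).aestronglyMeasurable (Eventually.of_forall fun ω => ?_)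
  rw [Real.norm_of_nonneg (vnorm_nonneg _)]
  exact vnorm_le_of_abs_le (Finset.sum_nonneg fun i _ => abs_nonneg _) fun i =>
    Finset.single_le_sum (f := fun i => |v ω i|) (fun i _ => abs_nonneg _) (Finset.mem_univ i)

variable [IsProbabilityMeasure μ]

theorem measureReal_sum_gt_le {ι : Type*} {s : Finset ι} {X : ι → Ω → ℝ} {K B : ℝ}
    (hX : ∀ i ∈ s, Integrable (X i) μ) (hX0 : ∀ i ∈ s, ∀ ω, 0 ≤ X i ω)
    (hK : ∀ i ∈ s, ∫ ω, X i ω ∂μ ≤ K) (hK0 : 0 ≤ K) (hB : 0 < B) :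
    μ.real {ω | s.card * B < ∑ i ∈ s, X i ω} ≤ K / B := by
  rcases s.eq_empty_or_nonempty with rfl | hs
  · simpa using div_nonneg hK0 hB.le
  have hc : (0 : ℝ) < s.card := by exact_mod_cast hs.card_pos
  have h1 := mul_meas_ge_le_integral_of_nonneg (μ := μ) (f := fun ω => ∑ i ∈ s, X i ω)
    (Eventually.of_forall fun ω => Finset.sum_nonneg fun i hi => hX0 i hi ω)
    (integrable_finsetSum _ hX) (s.card * B)
  rw [integral_finsetSum _ hX] at h1
  have h2 : ∑ i ∈ s, ∫ ω, X i ω ∂μ ≤ s.card * K := by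
    simpa using Finset.sum_le_sum hK
  have h3 : μ.real {ω | s.card * B < ∑ i ∈ s, X i ω} ≤
      μ.real {ω | s.card * B ≤ ∑ i ∈ s, X i ω} := by
    refine measureReal_mono fun ω hω => ?_
    simp only [Set.mem_ofPred_eq] at hω ⊢
    exact hω.le
  rw [le_div_iff₀ hB]
  have h4 : (s.card : ℝ) * (μ.real {ω | s.card * B < ∑ i ∈ s, X i ω} * B) ≤ s.card * K := by
    calc _ = s.card * B * μ.real {ω | s.card * B < ∑ i ∈ s, X i ω} := by ring
      _ ≤ s.card * B * μ.real {ω | s.card * B ≤ ∑ i ∈ s, X i ω} := by gcongr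
      _ ≤ _ := h1.trans h2
  exact le_of_mul_le_mul_left h4 hc

theorem MemLp.integrable_abs_rpow {X : Ω → ℝ} (hX : ∀ n : ℕ, MemLp X n μ) {δ : ℝ} (hδ : 0 < δ) :
    Integrable (fun ω => |X ω| ^ δ) μ := by
  have h1 : MemLp X (ENNReal.ofReal δ) μ := (hX ⌈δ⌉₊).mono_exponent (by
    rw [← ENNReal.ofReal_natCast]
    exact ENNReal.ofReal_le_ofReal (Nat.le_ceil δ))
  have h2 := (integrable_norm_rpow_iff h1.1 (by simpa using hδ) (by simp)).2 h1
  rw [ENNReal.toReal_ofReal hδ.le] at h2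
  simpa using h2

end Markov

/-! ### Probabilities of the sample events -/

namespace FactorModel

section Events

variable {Ω : Type*} {m0 : MeasurableSpace Ω} {r : ℕ} {μ : Measure Ω} [IsProbabilityMeasure μ]
  {r₁ r₂ : ℝ} {M : FactorModel Ω r}

theorem sum_time {T : ℕ} (g : ℤ → ℝ) : ∑ t : Fin T, g (time t) = ∑ t ∈ Finset.range T, g (t + 1) :=
  (Finset.sum_range fun t : ℕ => g (t + 1)).symm

/-- Treating the coordinates of u_t and f_t alike covers UU', UF and F'F at once. The exponent 6
beats the number of pairs, which is O(T⁴) when N ≤ T². -/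
theorem Regular.exists_moment_concentration (h : M.Regular μ r₁ r₂) : ∃ K : ℝ, 0 < K ∧
    ∃ T₀ : ℕ, ∀ N T : ℕ, T₀ ≤ T → μ.real {ω | ∃ c c' : Fin N ⊕ Fin r, K * √(T * Real.log T) ≤
      |∑ t : Fin T, (M.coord N c (time t) ω * M.coord N c' (time t) ω -
        ∫ ω', M.coord N c 1 ω' * M.coord N c' 1 ω' ∂μ)|} ≤
      ((N : ℝ) + r) ^ 2 * (T : ℝ) ^ (-(6 : ℝ)) := by
  obtain ⟨c, r₃, hc, hr₃, hmix⟩ := h.exists_expMixing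
  obtain ⟨b₁, b₂, hb₁, hb₂, -, -, ht⟩ := h.exists_tail
  obtain ⟨K, hK, T₀, hT₀⟩ := exists_concentration μ hc hr₃ hb₁ hb₂ h.r₁_pos h.r₂_pos
    (D := 6) (by norm_num)
  refine ⟨K, hK, T₀, fun N T hT => ?_⟩
  set A : (Fin N ⊕ Fin r) × (Fin N ⊕ Fin r) → Set Ω := fun p => {ω | K * √(T * Real.log T) ≤
      |∑ t : Fin T, (M.coord N p.1 (time t) ω * M.coord N p.2 (time t) ω -
        ∫ ω', M.coord N p.1 1 ω' * M.coord N p.2 1 ω' ∂μ)|} with hA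
  have hAle : ∀ p, μ.real (A p) ≤ (T : ℝ) ^ (-(6 : ℝ)) := fun p => by
    have h1 := hT₀ T hT _ _ (hmix N) (M.coord N p.1) (M.coord N p.2)
      (M.measurable_coord_pastAt N p.1) (M.measurable_coord_futureAt N p.1)
      (M.measurable_coord_pastAt N p.2) (M.measurable_coord_futureAt N p.2)
      (ht N p.1) (ht N p.2)
    refine le_trans (le_of_eq ?_) h1
    congr 1
    ext ω
    simp only [hA, Set.mem_ofPred_eq]
    rw [sum_time fun t => M.coord N p.1 t ω * M.coord N p.2 t ω -
        ∫ ω', M.coord N p.1 1 ω' * M.coord N p.2 1 ω' ∂μ]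
    simp_rw [h.integral_coord_mul N p.1 p.2]
  have hsub : {ω | ∃ c c' : Fin N ⊕ Fin r, K * √(T * Real.log T) ≤
      |∑ t : Fin T, (M.coord N c (time t) ω * M.coord N c' (time t) ω -
        ∫ ω', M.coord N c 1 ω' * M.coord N c' 1 ω' ∂μ)|} ⊆ ⋃ p ∈ Finset.univ, A p := by
    rintro ω ⟨c, c', hω⟩
    simp only [Set.mem_iUnion]
    exact ⟨(c, c'), Finset.mem_univ _, hω⟩
  have hmono := measureReal_mono (μ := μ) hsub (measure_ne_top _ _)
  refine hmono.trans ((measureReal_biUnion_finset_le _ _).trans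
    ((Finset.sum_le_sum fun p _ => hAle p).trans_eq ?_))
  simp only [Finset.sum_const, Finset.card_univ, Fintype.card_prod, Fintype.card_sum,
    Fintype.card_fin, nsmul_eq_mul]
  push_cast
  ring

theorem exp_neg_tail_eq {b ρ x : ℝ} (hb : 0 < b) (hρ : 0 < ρ) (hx : 1 < x) :
    Real.exp (-(b * (4 * Real.log x) ^ (1 / ρ) / b) ^ ρ) = x ^ (-(4 : ℝ)) := by
  have hl : 0 < Real.log x := Real.log_pos hx
  rw [mul_div_cancel_left₀ _ hb.ne', ← Real.rpow_mul (by positivity), one_div_mul_cancel hρ.ne',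
    Real.rpow_one, Real.rpow_def_of_pos (by linarith)]
  ring_nf

/-- At the level b(4 log T)^(1/ρ) a tail exp(-(s/b)^ρ) equals T⁻⁴, small enough for a union over (N
+ r)T variables when N ≤ T². -/
theorem Regular.exists_max_le (h : M.Regular μ r₁ r₂) : ∃ B : ℝ, 0 < B ∧ ∀ N T : ℕ, 1 < T →
    μ.real {ω | (∃ (i : Fin N) (t : Fin T), B * Real.log T ^ (1 / r₁) < |M.u N (time t) ω i|) ∨
      ∃ (k : Fin r) (t : Fin T), B * Real.log T ^ (1 / r₂) < |M.f (time t) ω k|} ≤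
      ((N : ℝ) + r) * T * (T : ℝ) ^ (-(4 : ℝ)) := by
  obtain ⟨b₁, b₂, hb₁, hb₂, hu, hf, -⟩ := h.exists_tail
  have h1 := h.r₁_pos
  have h2 := h.r₂_pos
  set B := max (b₁ * 4 ^ (1 / r₁)) (b₂ * 4 ^ (1 / r₂)) with hB
  refine ⟨B, lt_max_of_lt_left (by positivity), fun N T hT => ?_⟩
  have hT1 : (1 : ℝ) < T := by exact_mod_cast hT
  have hl : 0 < Real.log T := Real.log_pos hT1
  have hB1 : b₁ * (4 * Real.log T) ^ (1 / r₁) ≤ B * Real.log T ^ (1 / r₁) := by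
    rw [Real.mul_rpow (by norm_num) hl.le, ← mul_assoc]
    gcongr
    exact le_max_left _ _
  have hB2 : b₂ * (4 * Real.log T) ^ (1 / r₂) ≤ B * Real.log T ^ (1 / r₂) := by
    rw [Real.mul_rpow (by norm_num) hl.le, ← mul_assoc]
    gcongr
    exact le_max_right _ _
  set A : (Fin N ⊕ Fin r) × Fin T → Set Ω := fun p => Sum.elim
    (fun i => {ω | B * Real.log T ^ (1 / r₁) < |M.u N (time p.2) ω i|})
    (fun k => {ω | B * Real.log T ^ (1 / r₂) < |M.f (time p.2) ω k|}) p.1 with hA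
  have hAle : ∀ p, μ.real (A p) ≤ (T : ℝ) ^ (-(4 : ℝ)) := by
    rintro ⟨i | k, t⟩
    · rw [← exp_neg_tail_eq hb₁ h1 hT1]
      exact (measureReal_mono fun ω hω => hB1.trans_lt hω).trans
        (hu N (time t) i _ (by positivity))
    · rw [← exp_neg_tail_eq hb₂ h2 hT1]
      exact (measureReal_mono fun ω hω => hB2.trans_lt hω).trans
        (hf (time t) k _ (by positivity))
  have hsub : {ω | (∃ (i : Fin N) (t : Fin T),
      B * Real.log T ^ (1 / r₁) < |M.u N (time t) ω i|) ∨ ∃ (k : Fin r) (t : Fin T),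
      B * Real.log T ^ (1 / r₂) < |M.f (time t) ω k|} ⊆ ⋃ p ∈ Finset.univ, A p := by
    rintro ω (⟨i, t, hω⟩ | ⟨k, t, hω⟩) <;> simp only [Set.mem_iUnion]
    · exact ⟨(Sum.inl i, t), Finset.mem_univ _, hω⟩
    · exact ⟨(Sum.inr k, t), Finset.mem_univ _, hω⟩
  have hmono := measureReal_mono (μ := μ) hsub (measure_ne_top _ _)
  refine hmono.trans ((measureReal_biUnion_finset_le _ _).trans
    ((Finset.sum_le_sum fun p _ => hAle p).trans_eq ?_))
  simp only [Finset.sum_const, Finset.card_univ, Fintype.card_prod, Fintype.card_sum,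
    Fintype.card_fin, nsmul_eq_mul]
  push_cast
  ring

theorem Regular.exists_cov_decay (h : M.Regular μ r₁ r₂) : ∃ K c r₃ : ℝ, 0 ≤ K ∧ 0 < c ∧ 0 < r₃ ∧
    ∀ N (i j : Fin N) s t, |∫ ω, M.u N s ω i * M.u N t ω j ∂μ| ≤ K * decay c r₃ (s - t).natAbs := by
  obtain ⟨c, r₃, hc, hr₃, hmix⟩ := h.exists_expMixing
  obtain ⟨K, hK, hm⟩ := h.exists_moments 3
  refine ⟨10 * (1 + K) ^ 2, c, r₃, by positivity, hc, hr₃, fun N i j s t => ?_⟩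
  have h1 := (hmix N).abs_cov_le (M.measurable_coord_pastAt N (Sum.inl i) s)
    (M.measurable_coord_futureAt N (Sum.inl i) s) (M.measurable_coord_pastAt N (Sum.inl j) t)
    (M.measurable_coord_futureAt N (Sum.inl j) t) (hm N (Sum.inl i) s).1 (hm N (Sum.inl j) t).1
    (hm N (Sum.inl i) s).2 (hm N (Sum.inl j) t).2
  have h2 : ∫ ω, M.coord N (Sum.inl i) s ω ∂μ = 0 := h.mean_u N s i
  rw [h2, zero_mul, sub_zero] at h1
  exact h1

theorem Regular.abs_integral_quadForm_le (h : M.Regular μ r₁ r₂) {N : ℕ}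
    {W : Matrix (Fin N) (Fin N) ℝ} {KW C : ℝ} (hC : 0 ≤ C) (hW : ∀ i, ∑ j, |W i j| ≤ KW) {s t : ℤ}
    (hcov : ∀ i j : Fin N, |∫ ω, M.u N s ω i * M.u N t ω j ∂μ| ≤ C) :
    |∫ ω, M.u N s ω ⬝ᵥ (W *ᵥ M.u N t ω) ∂μ| ≤ N * (KW * C) := by
  have e : ∀ ω, M.u N s ω ⬝ᵥ (W *ᵥ M.u N t ω) =
      ∑ i, ∑ j, W i j * (M.u N s ω i * M.u N t ω j) := fun ω => by
    simp only [dotProduct, mulVec, Finset.mul_sum]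
    exact Finset.sum_congr rfl fun i _ => Finset.sum_congr rfl fun j _ => by ring
  have hi : ∀ i j, Integrable (fun ω => W i j * (M.u N s ω i * M.u N t ω j)) μ := fun i j =>
    (h.integrable_coord_mul N (Sum.inl i) (Sum.inl j) s t).const_mul _
  simp_rw [e]
  rw [integral_finsetSum _ fun i _ => integrable_finsetSum _ fun j _ => hi i j]
  simp_rw [fun i => integral_finsetSum Finset.univ fun j (_ : j ∈ Finset.univ) => hi i j,
    integral_const_mul]
  refine (Finset.abs_sum_le_sum_abs _ _).trans ((Finset.sum_le_sum (g := fun _ => KW * C)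
    fun i _ => ?_).trans_eq (by simp))
  refine (Finset.abs_sum_le_sum_abs _ _).trans ?_
  calc _ ≤ ∑ j, |W i j| * C := Finset.sum_le_sum fun j _ => by
        rw [abs_mul]; gcongr; exact hcov i j
    _ ≤ _ := by rw [← Finset.sum_mul]; gcongr; exact hW i

/-- A bound on a Bochner integral carries no information unless the function is integrable;
exponential tails supply the integrability that Markov's inequality requires. Products are handled
by Hölder with exponents 2n. -/
theorem Regular.memLp_uWuc (h : M.Regular μ r₁ r₂) (N : ℕ) (W : Matrix (Fin N) (Fin N) ℝ)
    (s t : ℤ) (n : ℕ) : MemLp (M.uWuc μ N W s t) n μ := by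
  have e : M.uWuc μ N W s t = fun ω => ∑ i, ∑ j, W i j * (M.u N s ω i * M.u N t ω j) -
      ∫ ω', M.u N s ω' ⬝ᵥ (W *ᵥ M.u N t ω') ∂μ := by
    funext ω
    simp only [uWuc, dotProduct, mulVec, Finset.mul_sum]
    congr 1
    exact Finset.sum_congr rfl fun i _ => Finset.sum_congr rfl fun j _ => by ring
  rw [e]
  refine MemLp.sub ?_ (memLp_const _)
  refine memLp_finsetSum _ fun i _ => memLp_finsetSum _ fun j _ => MemLp.const_mul ?_ _
  have h1 := h.memLp_coord N (Sum.inl i) s (2 * n)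
  have h2 := h.memLp_coord N (Sum.inl j) t (2 * n)
  have : ENNReal.HolderTriple ((2 * n : ℕ) : ENNReal) ((2 * n : ℕ) : ENNReal) (n : ENNReal) := by
    refine ⟨?_⟩
    rw [Nat.cast_mul, ENNReal.mul_inv (by simp) (by simp), ← add_mul, Nat.cast_ofNat,
      ENNReal.inv_two_add_inv_two, one_mul]
  exact h2.mul' h1

theorem Regular.memLp_score (h : M.Regular μ r₁ r₂) (N : ℕ) (A : Matrix (Fin r) (Fin N) ℝ) (x : ℝ)
    (t : ℤ) (n : ℕ) : MemLp (fun ω => vnorm (x • (A *ᵥ M.u N t ω))) n μ := by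
  have hm : ∀ i : Fin N, Measurable fun ω => M.u N t ω i := fun i =>
    M.measurable_coord N (Sum.inl i) t
  refine memLp_vnorm (fun k => ?_) fun k => ?_
  · simp only [Pi.smul_apply, mulVec, dotProduct, smul_eq_mul]
    exact (Finset.measurable_sum _ fun i _ => (hm i).const_mul _).const_mul _
  · simp only [Pi.smul_apply, mulVec, dotProduct, smul_eq_mul]
    exact (memLp_finsetSum _ fun i _ => (h.memLp_coord N (Sum.inl i) t n).const_mul _).const_mul _

end Events

end FactorModel

/-! ### Rates of the estimators on a good sample -/

section Deterministic

open scoped Matrix.Norms.Frobenius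

theorem estimator_bounds_of_weightBounds {N T r : ℕ} {K κ c₁ KW x A₁ ε τ L Lf η₀ η cv : ℝ}
    {Λ : Matrix (Fin N) (Fin r) ℝ} {F : Matrix (Fin T) (Fin r) ℝ} {U : Matrix (Fin N) (Fin T) ℝ}
    {Sig W What : Matrix (Fin N) (Fin N) ℝ} {v : Fin r → ℝ} {Fhat : Matrix (Fin T) (Fin r) ℝ}
    {H : Matrix (Fin r) (Fin r) ℝ} (hS : SampleBounds K κ ε Λ F U Sig)
    (hSc : ScoreBounds x τ L Lf Λ F U W) (hκ1 : κ ≤ 1) (hc₁ : 0 < c₁) (hKW : 0 ≤ KW)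
    (hWB : WeightBounds c₁ KW η₀ W What) (hη0 : 0 ≤ η) (hr : 2 * KW ^ 2 * η₀ ≤ η)
    (hNη : 1 / √N ≤ η) (hTη : 1 / √T ≤ η) (hεη : ε ≤ η) (hKε : K * ε ≤ κ ^ 2 / 2)
    (hcv : cv = κ ^ 4 / (8 * c₁ * K)) (hA₁ : A₁ = 12 * K ^ 6 * x / cv) (hη1 : K * A₁ * η ≤ 1 / 2)
    (hv : IsLeadingEigensystem ((Λ * Fᵀ + U)ᵀ * What * (Λ * Fᵀ + U)) v ((√(T : ℝ))⁻¹ • Fhat))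
    (hH : H = rotationMatrix v Fhat F Λ What) :
    IsUnit H ∧
    (∀ t, vnorm (Fhat t - H *ᵥ F t) ≤ 3 * K ^ 5 * x / cv * (τ / √N + (L + Lf + 1) * η)) ∧
    ∀ j, vnorm (loadingEst (Λ * Fᵀ + U) Fhat j - (Hᵀ)⁻¹ *ᵥ Λ j) ≤
      (2 * K ^ 5 * A₁ + 2 * K * A₁ + K * (2 * KW * K ^ 6 / cv)) * η := by
  have hN0 : (0 : ℝ) < N := by exact_mod_cast hS.N_pos
  have hT0 : (0 : ℝ) < T := by exact_mod_cast hS.T_pos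
  have hK0 := hS.K_pos
  have hκ0 := hS.κ_pos
  have hx := hSc.one_le
  have hcv0 : 0 < cv := by rw [hcv]; positivity
  have hA₁0 : 0 ≤ A₁ := by rw [hA₁]; positivity
  have hvl : ∀ l, cv * (N * T) ≤ v l := fun l => by
    rw [hcv]; exact hS.weighted_eigenvalue_ge hκ1 hc₁ hWB hKε hv l
  have hv0 : ∀ l, v l ≠ 0 := fun l => ((by positivity : 0 < cv * (N * T)).trans_le (hvl l)).ne'
  have hsT : √(T : ℝ) ≠ 0 := (Real.sqrt_pos.2 hT0).ne'
  have hFF : Fhatᵀ * Fhat = (T : ℝ) • 1 := by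
    have h1 := hv.orthonormal
    rw [transpose_smul, Matrix.smul_mul, Matrix.mul_smul, smul_smul, ← mul_inv,
      Real.mul_self_sqrt hT0.le] at h1
    rw [← h1, smul_smul, mul_inv_cancel₀ hT0.ne', one_smul]
  have hei : (Λ * Fᵀ + U)ᵀ * What * (Λ * Fᵀ + U) * Fhat = Fhat * diagonal v := by
    have h1 := hv.eigen
    rw [Matrix.mul_smul, Matrix.smul_mul] at h1
    have h2 := congrArg (fun X => √(T : ℝ) • X) h1
    simpa only [smul_smul, mul_inv_cancel₀ hsT, one_smul] using h2
  rw [rotationMatrix_eq hv0 hS.N_pos hS.T_pos] at hH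
  have hX := factorEst_sub_eq hv0 hWB.symm rfl hei hH
  have hfac := factorEst_sub_le hS hSc hη0 (fun i => (hWB.rowSum_sub i).trans hr)
    (fun j => (hWB.colSum_sub j).trans hr) hNη hTη hcv0 hvl hFF hX
  have hKHle : ‖H‖ ≤ 2 * KW * K ^ 6 / cv := by
    rw [hH]; exact norm_rotation_le hS hKW hWB hcv0 hvl hFF
  rw [← hA₁] at hfac
  have hload := loadingEst_sub_le hS hεη hA₁0 hFF hKHle hfac.1 hη1
  refine ⟨hload.1, fun t => ?_, hload.2⟩
  have h1 : Fhat t - H *ᵥ F t = (Fhat - F * Hᵀ) t := by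
    funext k
    simp only [Pi.sub_apply, Matrix.sub_apply, Matrix.mul_apply, mulVec, dotProduct,
      Matrix.transpose_apply]
    congr 1
    exact Finset.sum_congr rfl fun l _ => mul_comm _ _
  rw [h1]
  exact hfac.2 t

/-- The rates of the weighted principal components estimators on a sample that satisfies the bounds
`SampleBounds` and `ScoreBounds`. -/
theorem exists_estimator_bounds {r : ℕ} {K κ c₁ c₂ KW K₁ C x : ℝ} (hκ0 : 0 < κ) (hκ1 : κ ≤ 1)
    (hc₁ : 0 < c₁) (hc₂ : 0 < c₂) (hK : 1 ≤ K) (hKW : 0 ≤ KW) (hK₁ : 1 ≤ K₁) (hC : 4 * K₁ / c₂ ≤ C)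
    (hx : 1 ≤ x) : ∃ A ρ₀ : ℝ, 0 < A ∧ 0 < ρ₀ ∧ ∀ {N T : ℕ} {Λ : Matrix (Fin N) (Fin r) ℝ}
    {F : Matrix (Fin T) (Fin r) ℝ} {U : Matrix (Fin N) (Fin T) ℝ} {Sig : Matrix (Fin N) (Fin N) ℝ}
    {ε τ L Lf m q a b : ℝ} {s : Fin N → Fin N → ℝ → ℝ → ℝ} {ν v : Fin r → ℝ}
    {Ξ : Matrix (Fin N) (Fin r) ℝ} {Shat : Matrix (Fin N) (Fin N) ℝ}
    {Fhat : Matrix (Fin T) (Fin r) ℝ} {H : Matrix (Fin r) (Fin r) ℝ},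
    SampleBounds K κ ε Λ F U Sig → ScoreBounds x τ L Lf Λ F U Sig⁻¹ → Sigᵀ = Sig →
    (∀ x, c₂ * (x ⬝ᵥ x) ≤ x ⬝ᵥ (Sig *ᵥ x)) → (∀ x, x ⬝ᵥ (Sig *ᵥ x) ≤ c₁ * (x ⬝ᵥ x)) →
    (∀ i, ∑ j, |Sig⁻¹ i j| ≤ KW) → 0 ≤ q → q ≤ 1 →
    (∀ i, ∑ j, sparsityTerm q (Sig i j) ≤ m) →
    (∀ i j, IsThresholding a b (s i j)) → (∀ i j, s i j = s j i) →
    (∀ i j, |residualCov (Λ * Fᵀ + U) ν Ξ i j - Sig i j| ≤ K₁ * (ε + 1 / √N)) →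
    Shat = thresholdCov C (ε + 1 / √N) s (residualCov (Λ * Fᵀ + U) ν Ξ) →
    IsLeadingEigensystem ((Λ * Fᵀ + U)ᵀ * Shat⁻¹ * (Λ * Fᵀ + U)) v ((√(T : ℝ))⁻¹ • Fhat) →
    H = rotationMatrix v Fhat F Λ Shat⁻¹ →
    ε + 1 / √N ≤ m * (ε + 1 / √N) ^ (1 - q) → 1 / √T ≤ ε →
    m * (ε + 1 / √N) ^ (1 - q) ≤ ρ₀ →
    IsUnit H ∧
    (∀ t, vnorm (Fhat t - H *ᵥ F t) ≤
      A * (τ / √N + (L + Lf + 1) * (m * (ε + 1 / √N) ^ (1 - q)))) ∧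
    ∀ j, vnorm (loadingEst (Λ * Fᵀ + U) Fhat j - (Hᵀ)⁻¹ *ᵥ Λ j) ≤
      A * (m * (ε + 1 / √N) ^ (1 - q)) := by
  have hK0 : 0 < K := by linarith
  have hC0 : 0 < C := lt_of_lt_of_le (by positivity) hC
  set D₀ := 2 * C * c₁ + K₁ with hD₀
  have hD₀1 : 1 ≤ D₀ := by
    have : 0 ≤ 2 * C * c₁ := by positivity
    linarith
  -- D₀ρ bounds the row sums of Σ̂_u - Σ_u. With this `D`, η = Dρ dominates both ρ and the resulting
  -- error 2KW²D₀ρ of the weights.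
  set D := (1 + 2 * KW ^ 2) * D₀ with hD
  have hD1 : 1 ≤ D := by
    have : 0 ≤ KW ^ 2 * D₀ := by positivity
    nlinarith
  have hD0 : 0 < D := by linarith
  set cv := κ ^ 4 / (8 * c₁ * K) with hcv
  have hcv0 : 0 < cv := by positivity
  set A₁ := 12 * K ^ 6 * x / cv with hA₁
  have hA₁0 : 0 < A₁ := by positivity
  set A₂ := 3 * K ^ 5 * x / cv with hA₂
  have hA₂0 : 0 < A₂ := by positivity
  set A₃ := 2 * K ^ 5 * A₁ + 2 * K * A₁ + K * (2 * KW * K ^ 6 / cv) with hA₃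
  have hA₃0 : 0 < A₃ := by positivity
  -- Each summand encodes one smallness condition as ρ·y ≤ 1; taking 1/B as the threshold for ρ
  -- grants all of them.
  set B := D₀ * (2 / c₂ + 1 / c₁ + 2 * KW) + 2 * K / κ ^ 2 + 2 * K₁ / c₂ + 2 * (K * A₁ * D) with hB
  have b1 : 0 ≤ D₀ * (2 / c₂) := by positivity
  have b2 : 0 ≤ D₀ * (1 / c₁) := by positivity
  have b3 : 0 ≤ D₀ * (2 * KW) := by positivity
  have b4 : 0 < 2 * K / κ ^ 2 := by positivity
  have b5 : 0 ≤ 2 * K₁ / c₂ := by positivity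
  have b6 : 0 ≤ 2 * (K * A₁ * D) := by positivity
  have hB0 : 0 < B := by rw [hB]; linarith
  refine ⟨(A₂ + A₃) * D, 1 / B, by positivity, by positivity, ?_⟩
  intro N T Λ F U Sig ε τ L Lf m q a b s ν v Ξ Shat Fhat H hS hSc hsym hq1 hq2 hrow hq0 hq1' hm hs
    hss hR hSh hv hH hwρ hTε hρ₀
  set w := ε + 1 / √N with hw
  set ρ := m * w ^ (1 - q) with hρ
  have hN0 : (0 : ℝ) < N := by exact_mod_cast hS.N_pos
  have hT0 : (0 : ℝ) < T := by exact_mod_cast hS.T_pos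
  have hsN : 0 < 1 / √(N : ℝ) := by have := Real.sqrt_pos.2 hN0; positivity
  have hε0 := hS.ε_nonneg
  have hw0 : 0 < w := by linarith
  have hρ0 : 0 < ρ := lt_of_lt_of_le hw0 hwρ
  rw [le_div_iff₀ hB0] at hρ₀
  have use : ∀ y : ℝ, y ≤ B → ρ * y ≤ 1 := fun y hy =>
    (mul_le_mul_of_nonneg_left hy hρ0.le).trans hρ₀
  have u1 := use (D₀ * (2 / c₂)) (by rw [hB]; linarith)
  have u2 := use (D₀ * (1 / c₁)) (by rw [hB]; linarith)
  have u3 := use (D₀ * (2 * KW)) (by rw [hB]; linarith)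
  have u4 := use (2 * K / κ ^ 2) (by rw [hB]; linarith)
  have u5 := use (2 * K₁ / c₂) (by rw [hB]; linarith)
  have u6 := use (2 * (K * A₁ * D)) (by rw [hB]; linarith)
  have hdiag : ∀ i, c₂ ≤ Sig i i ∧ Sig i i ≤ c₁ := fun i => by
    have h1 := hq1 (Pi.single i 1)
    have h2 := hq2 (Pi.single i 1)
    simp only [single_one_dotProduct, mulVec_single_one, Matrix.col_apply, Pi.single_eq_same,
      mul_one] at h1 h2
    exact ⟨h1, h2⟩
  have hRw : K₁ * w ≤ c₂ / 2 := by
    have : ρ * (2 * K₁ / c₂) = (K₁ * ρ) * 2 / c₂ := by ring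
    rw [this, div_le_one hc₂] at u5
    have : K₁ * w ≤ K₁ * ρ := by gcongr
    linarith
  have hthr := thresholdCov_close hs hK₁ hq0 hq1' hw0 hc₂ hRw hC hdiag hR hm
  rw [← hSh, ← hD₀, ← hρ] at hthr
  have hShs : Shatᵀ = Shat := by
    rw [hSh]; exact thresholdCov_symm hss (residualCov_symm _ _ _)
  have hη₀ : 0 ≤ D₀ * ρ := by positivity
  have hWB : WeightBounds c₁ KW (D₀ * ρ) Sig⁻¹ Shat⁻¹ := by
    refine weightBounds_of_close hsym hShs hc₁ hc₂ hq1 hq2 hKW hrow hη₀ ?_ ?_ ?_ hthr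
    · have : ρ * (D₀ * (2 / c₂)) = D₀ * ρ * 2 / c₂ := by ring
      rw [this, div_le_one hc₂] at u1
      linarith
    · have : ρ * (D₀ * (1 / c₁)) = D₀ * ρ / c₁ := by ring
      rwa [this, div_le_one hc₁] at u2
    · linarith
  set η := D * ρ with hη
  have hη0 : 0 ≤ η := by positivity
  have hρη : ρ ≤ η := le_mul_of_one_le_left hρ0.le hD1
  have hr : 2 * KW ^ 2 * (D₀ * ρ) ≤ η := by
    have : η = D₀ * ρ + 2 * KW ^ 2 * (D₀ * ρ) := by rw [hη, hD]; ring
    linarith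
  have hNη : 1 / √N ≤ η := by linarith
  have hTη : 1 / √T ≤ η := by linarith
  have hεη : ε ≤ η := by linarith
  have hKε : K * ε ≤ κ ^ 2 / 2 := by
    have : ρ * (2 * K / κ ^ 2) = (K * ρ) * 2 / κ ^ 2 := by ring
    rw [this, div_le_one (by positivity)] at u4
    have : K * ε ≤ K * ρ := by gcongr; linarith
    linarith
  obtain ⟨hl1, hl2, hl3⟩ := estimator_bounds_of_weightBounds hS hSc hκ1 hc₁ hKW hWB hη0 hr hNη hTη
    hεη hKε hcv hA₁ (by
      have : ρ * (2 * (K * A₁ * D)) = K * A₁ * η * 2 := by rw [hη]; ring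
      linarith) hv hH
  refine ⟨hl1, fun t => ?_, fun j => (hl3 j).trans ?_⟩
  · refine (hl2 t).trans ?_
    have hL := hSc.L_nonneg
    have hLf := hSc.Lf_nonneg
    have hτ := hSc.τ_nonneg
    have h2 : τ / √N ≤ D * (τ / √N) := le_mul_of_one_le_left (by positivity) hD1
    calc A₂ * (τ / √N + (L + Lf + 1) * η) ≤ A₂ * (D * (τ / √N) + (L + Lf + 1) * η) := by gcongr
      _ = A₂ * D * (τ / √N + (L + Lf + 1) * ρ) := by rw [hη]; ring
      _ ≤ _ := by gcongr; linarith
  · calc A₃ * η = A₃ * D * ρ := (mul_assoc _ _ _).symm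
      _ ≤ (A₂ + A₃) * D * ρ := mul_le_mul_of_nonneg_right
        (mul_le_mul_of_nonneg_right (by linarith) hD0.le) hρ0.le

end Deterministic

/-! ### Good samples have high probability -/

namespace FactorModel

section GoodSamples

open scoped Matrix.Norms.Frobenius

variable {Ω : Type*} {m0 : MeasurableSpace Ω} {r : ℕ}

/-- The `N × T` matrix of idiosyncratic components. -/
def idio (M : FactorModel Ω r) (N T : ℕ) (ω : Ω) : Matrix (Fin N) (Fin T) ℝ :=
  Matrix.of fun i t => M.u N (time t) ω i

theorem Y_eq (M : FactorModel Ω r) (N T : ℕ) (ω : Ω) :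
    M.Y N T ω = M.Λ N * (M.F T ω)ᵀ + M.idio N T ω := by
  ext i t
  rfl

variable {μ : Measure Ω} [IsProbabilityMeasure μ] {r₁ r₂ : ℝ} {M : FactorModel Ω r}

theorem abs_inv_mul_sum_sub_le {T : ℕ} (hT : 0 < T) {a : Fin T → ℝ} {e K l : ℝ}
    (h : |∑ t, (a t - e)| ≤ K * √(T * l)) : |(T : ℝ)⁻¹ * ∑ t, a t - e| ≤ K * √(l / T) := by
  have hT0 : (0 : ℝ) < T := by exact_mod_cast hT
  have e1 : (T : ℝ)⁻¹ * ∑ t, a t - e = (T : ℝ)⁻¹ * ∑ t, (a t - e) := by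
    rw [Finset.sum_sub_distrib]
    simp only [Finset.sum_const, Finset.card_univ, Fintype.card_fin, nsmul_eq_mul]
    field_simp
  have e2 : √(T * l) = T * √(l / T) := by
    rw [show (T : ℝ) * l = T ^ 2 * (l / T) by field_simp, Real.sqrt_mul (by positivity),
      Real.sqrt_sq hT0.le]
  rw [e1, abs_mul, abs_of_pos (inv_pos.2 hT0), inv_mul_le_iff₀ hT0]
  rw [e2] at h
  linarith

/-- N ≤ T² keeps the union bounds at O(1/T). T ≤ N² gives log T ≤ 2 log N, so the concentration rate
√(log T / T) is at most 2ε, which is the factor 2 in `K₀`. -/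
theorem Regular.exists_sampleBounds (h : M.Regular μ r₁ r₂) (hp : M.Pervasive) :
    ∃ K κ B : ℝ, 1 ≤ K ∧ 0 < κ ∧ κ ≤ 1 ∧ 0 < B ∧ ∃ ε₀ : ℝ, 0 < ε₀ ∧ ∃ n₀ : ℕ, ∀ N T : ℕ,
      n₀ ≤ N → n₀ ≤ T → N ≤ T ^ 2 → T ≤ N ^ 2 → √(Real.log N / T) ≤ ε₀ →
      μ.real {ω | ¬ (SampleBounds K κ √(Real.log N / T) (M.Λ N) (M.F T ω) (M.idio N T ω)
          (M.covU μ N) ∧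
        (∀ i t, |M.idio N T ω i t| ≤ B * Real.log T ^ (1 / r₁)) ∧
        ∀ t k, |M.F T ω t k| ≤ B * Real.log T ^ (1 / r₂))} ≤ 6 / T := by
  obtain ⟨c₁, c₂, hc₁, hc₂, hS0, hS1, hΛ, hG⟩ := h.exists_population
  obtain ⟨κ₀, hκ₀, hperv⟩ := hp.exists_quadForm_ge
  obtain ⟨KG, hKG0, hKG⟩ := h.exists_integral_coord_mul_le
  obtain ⟨K₁, hK₁, T₀, hconc⟩ := h.exists_moment_concentration
  obtain ⟨B, hB, hmax⟩ := h.exists_max_le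
  obtain ⟨N₀, hN₀⟩ := eventually_atTop.1 hperv
  set K₀ := 2 * K₁ with hK₀
  set K := 1 + √r + c₁ + K₀ + √r * K₀ + √r * (√r * (KG + K₀)) with hK
  set κ := min 1 (min κ₀ (c₂ / 2)) with hκ
  have hK1 : 1 ≤ K := by
    have p1 : 0 ≤ √(r : ℝ) := Real.sqrt_nonneg _
    have p2 : 0 ≤ √(r : ℝ) * K₀ := by positivity
    have p3 : 0 ≤ √(r : ℝ) * (√r * (KG + K₀)) := by positivity
    linarith
  set ε₀ := min 1 (c₂ / 2 / (1 + √r * (√r * K₀))) with hε₀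
  refine ⟨K, κ, B, hK1, by positivity, min_le_left _ _, hB, ε₀, by positivity,
    max (max T₀ N₀) (max 3 r), fun N T hNn hTn hNT hTN hε => ?_⟩
  simp only [max_le_iff] at hNn hTn
  have hT1 : 1 < T := by omega
  have hT0 : (0 : ℝ) < T := by exact_mod_cast (by omega : 0 < T)
  have hTone : (1 : ℝ) ≤ T := by exact_mod_cast hT1.le
  have hN0 : (0 : ℝ) < N := by exact_mod_cast (by omega : 0 < N)
  set ε := √(Real.log N / T) with hεdef
  have hε0 : 0 ≤ ε := Real.sqrt_nonneg _
  have hlogT : Real.log T ≤ 2 * Real.log N := by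
    have h1 : (T : ℝ) ≤ (N : ℝ) ^ 2 := by exact_mod_cast hTN
    have h2 := Real.log_le_log hT0 h1
    rwa [Real.log_pow, Nat.cast_ofNat] at h2
  have hrt : K₁ * √(Real.log T / T) ≤ K₀ * ε := by
    have h1 : √(Real.log T / T) ≤ 2 * ε := by
      have h0 : 0 ≤ Real.log N := Real.log_natCast_nonneg N
      have e4 : √(4 * (Real.log N / T)) = 2 * ε := by
        rw [Real.sqrt_mul (by norm_num), show (4 : ℝ) = 2 ^ 2 by norm_num,
          Real.sqrt_sq (by norm_num)]
      rw [← e4]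
      apply Real.sqrt_le_sqrt
      rw [← mul_div_assoc]
      gcongr
      linarith
    calc K₁ * √(Real.log T / T) ≤ K₁ * (2 * ε) := by gcongr
      _ = _ := by rw [hK₀]; ring
  set A₁ : Set Ω := {ω | ∃ c c' : Fin N ⊕ Fin r, K₁ * √(T * Real.log T) ≤
      |∑ t : Fin T, (M.coord N c (time t) ω * M.coord N c' (time t) ω -
        ∫ ω', M.coord N c 1 ω' * M.coord N c' 1 ω' ∂μ)|} with hA₁
  set A₂ : Set Ω := {ω | (∃ (i : Fin N) (t : Fin T),
      B * Real.log T ^ (1 / r₁) < |M.u N (time t) ω i|) ∨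
      ∃ (k : Fin r) (t : Fin T), B * Real.log T ^ (1 / r₂) < |M.f (time t) ω k|} with hA₂
  have hNr : (N : ℝ) + r ≤ 2 * (T : ℝ) ^ 2 := by
    have h1 : (N : ℝ) ≤ (T : ℝ) ^ 2 := by exact_mod_cast hNT
    have h2 : (r : ℝ) ≤ T := by exact_mod_cast hTn.2.2
    nlinarith
  have hT4 : (T : ℝ) ^ (-(4 : ℝ)) = ((T : ℝ) ^ 4)⁻¹ := by
    rw [Real.rpow_neg hT0.le]; congr 1; exact_mod_cast Real.rpow_natCast (T : ℝ) 4
  have hT6 : (T : ℝ) ^ (-(6 : ℝ)) = ((T : ℝ) ^ 6)⁻¹ := by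
    rw [Real.rpow_neg hT0.le]; congr 1; exact_mod_cast Real.rpow_natCast (T : ℝ) 6
  have hP1 : μ.real A₁ ≤ 4 / T := by
    refine (hconc N T hTn.1.1).trans ?_
    rw [hT6]
    calc ((N : ℝ) + r) ^ 2 * ((T : ℝ) ^ 6)⁻¹ ≤ (2 * (T : ℝ) ^ 2) ^ 2 * ((T : ℝ) ^ 6)⁻¹ := by
          gcongr
      _ = (4 : ℝ) / T * (1 / T) := by field_simp; norm_num
      _ ≤ (4 : ℝ) / T * 1 := by gcongr; rw [div_le_one hT0]; exact hTone
      _ = _ := mul_one _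
  have hP2 : μ.real A₂ ≤ 2 / T := by
    refine (hmax N T hT1).trans ?_
    rw [hT4]
    calc ((N : ℝ) + r) * T * ((T : ℝ) ^ 4)⁻¹ ≤ (2 * (T : ℝ) ^ 2) * T * ((T : ℝ) ^ 4)⁻¹ := by
          gcongr
      _ = _ := by field_simp
  have hmono := measureReal_mono (μ := μ) (?_ : {ω | ¬ (SampleBounds K κ ε (M.Λ N) (M.F T ω)
      (M.idio N T ω) (M.covU μ N) ∧
      (∀ i t, |M.idio N T ω i t| ≤ B * Real.log T ^ (1 / r₁)) ∧
      ∀ t k, |M.F T ω t k| ≤ B * Real.log T ^ (1 / r₂))} ⊆ A₁ ∪ A₂) (measure_ne_top _ _)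
  · refine hmono.trans ((measureReal_union_le _ _).trans ((add_le_add hP1 hP2).trans_eq ?_))
    ring
  refine fun ω hbad => by_contra fun hω => hbad ?_
  simp only [hA₁, hA₂, Set.mem_union, Set.mem_ofPred_eq, not_or, not_exists, not_le, not_lt] at hω
  obtain ⟨h1, h2, h3⟩ := hω
  refine ⟨?_, fun i t => h2 i t, fun t k => h3 k t⟩
  have hmom : ∀ c c' : Fin N ⊕ Fin r, |(T : ℝ)⁻¹ *
      ∑ t : Fin T, M.coord N c (time t) ω * M.coord N c' (time t) ω -
        ∫ ω', M.coord N c 1 ω' * M.coord N c' 1 ω' ∂μ| ≤ K₀ * ε := fun c c' =>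
    (abs_inv_mul_sum_sub_le (by omega) (h1 c c').le).trans hrt
  refine sampleBounds_of_moments (G := M.momentF μ) (by omega) (by omega) hc₁ hc₂ hKG0
    (by positivity) hε0 (hε.trans (min_le_left _ _)) hκ₀ (hΛ N) (hN₀ N hNn.1.2) (covU_transpose N)
    (fun x => ?_) (hS1 N) hG (fun k l => hKG 0 (Sum.inr k) (Sum.inr l) 1 1) (fun i j => ?_)
    (fun i k => ?_) (fun k l => ?_) ?_
  · refine le_trans ?_ (hS0 N x)
    rw [← vnorm_sq_eq_dotProduct]; positivity
  · rw [h.covU_apply]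
    exact hmom (Sum.inl i) (Sum.inl j)
  · have h4 := hmom (Sum.inl i) (Sum.inr k)
    have h5 : ∫ ω', M.coord N (Sum.inl i) 1 ω' * M.coord N (Sum.inr k) 1 ω' ∂μ = 0 :=
      h.mean_uf N 1 i k
    rw [h5, sub_zero] at h4
    exact h4
  · exact hmom (Sum.inr k) (Sum.inr l)
  · have h4 : ε ≤ c₂ / 2 / (1 + √r * (√r * K₀)) := hε.trans (min_le_right _ _)
    have h5 : 0 ≤ √(r : ℝ) * (√r * K₀) := by positivity
    rw [le_div_iff₀ (by linarith)] at h4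
    have h6 : √(r : ℝ) * (√r * (K₀ * ε)) = ε * (√r * (√r * K₀)) := by ring
    linarith

/-- Markov's inequality for the sums over t and over (s, t) of δ-th powers. The event is uniform in
`L` and `Lf`, since the bounds on the maxima hold on a different event. -/
theorem Regular.exists_scoreBounds (h : M.Regular μ r₁ r₂) {δ KW Kδ e : ℝ} (hδ : 4 ≤ δ)
    (hKW : 0 ≤ KW) (hKδ : 0 ≤ Kδ) (he : 0 < e) : ∃ x : ℝ, 1 ≤ x ∧ ∀ N T : ℕ, 0 < N → 0 < T →
    (∀ i, ∑ j, |(M.covU μ N)⁻¹ i j| ≤ KW) →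
    (∀ s t : Fin T,
      ∫ ω, |(√(N : ℝ))⁻¹ * M.uWuc μ N (M.covU μ N)⁻¹ (time s) (time t) ω| ^ δ ∂μ ≤ Kδ ∧
      ∫ ω, vnorm ((√(N : ℝ))⁻¹ • (((M.Λ N)ᵀ * (M.covU μ N)⁻¹) *ᵥ M.u N (time t) ω)) ^ δ ∂μ ≤ Kδ) →
    μ.real {ω | ¬ ∀ L Lf : ℝ, 0 ≤ L → 0 ≤ Lf → (∀ i t, |M.idio N T ω i t| ≤ L) →
      (∀ t, vnorm (M.F T ω t) ≤ Lf) → ScoreBounds x ((T : ℝ) ^ (1 / δ)) L Lf (M.Λ N) (M.F T ω)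
        (M.idio N T ω) (M.covU μ N)⁻¹} ≤ e := by
  obtain ⟨C, c, r₃, hC, hc, hr₃, hcov⟩ := h.exists_cov_decay
  set B := 1 + 2 * Kδ / e with hB
  have hB0 : 0 < B := by positivity
  have hB1 : 1 ≤ B := by
    have : 0 ≤ 2 * Kδ / e := by positivity
    linarith
  have hKB : Kδ / B ≤ e / 2 := by
    rw [div_le_iff₀ hB0, hB]
    have : e / 2 * (1 + 2 * Kδ / e) = e / 2 + Kδ := by field_simp
    linarith
  have hS0 : 0 ≤ ∑' n, decay c r₃ n := tsum_nonneg fun n => (decay_pos _ _ _).le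
  refine ⟨1 + B + KW * C * (1 + 2 * ∑' n, decay c r₃ n), ?_, fun N T hN hT hW hmom => ?_⟩
  · have : 0 ≤ KW * C * (1 + 2 * ∑' n, decay c r₃ n) := by positivity
    linarith
  have hT0 : (0 : ℝ) < T := by exact_mod_cast hT
  set W := (M.covU μ N)⁻¹ with hWdef
  have hWs : Wᵀ = W := by rw [hWdef, transpose_nonsing_inv, covU_transpose]
  have hδ0 : 0 < δ := by linarith
  set X₁ : Fin T → Ω → ℝ := fun t ω =>
    vnorm ((√(N : ℝ))⁻¹ • (((M.Λ N)ᵀ * W) *ᵥ M.u N (time t) ω)) ^ δ with hX₁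
  set X₂ : Fin T × Fin T → Ω → ℝ := fun p ω =>
    |(√(N : ℝ))⁻¹ * M.uWuc μ N W (time p.1) (time p.2) ω| ^ δ with hX₂
  have hP1 := measureReal_sum_gt_le (μ := μ) (s := Finset.univ) (X := X₁) (K := Kδ) (B := B)
    (fun t _ => by
      have := MemLp.integrable_abs_rpow (fun n => h.memLp_score N ((M.Λ N)ᵀ * W) (√(N : ℝ))⁻¹
        (time t) n) hδ0
      simpa only [abs_of_nonneg (vnorm_nonneg _)] using this)
    (fun t _ ω => Real.rpow_nonneg (vnorm_nonneg _) _) (fun t _ => (hmom t t).2) hKδ hB0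
  have hP2 := measureReal_sum_gt_le (μ := μ) (s := Finset.univ) (X := X₂) (K := Kδ) (B := B)
    (fun p _ => MemLp.integrable_abs_rpow
      (fun n => (h.memLp_uWuc N W (time p.1) (time p.2) n).const_mul _) hδ0)
    (fun p _ ω => Real.rpow_nonneg (abs_nonneg _) _) (fun p _ => (hmom p.1 p.2).1) hKδ hB0
  simp only [Finset.card_univ, Fintype.card_prod, Fintype.card_fin] at hP1 hP2
  have hmono := measureReal_mono (μ := μ) (?_ : {ω | ¬ ∀ L Lf : ℝ, 0 ≤ L → 0 ≤ Lf →
      (∀ i t, |M.idio N T ω i t| ≤ L) →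
      (∀ t, vnorm (M.F T ω t) ≤ Lf) →
        ScoreBounds (1 + B + KW * C * (1 + 2 * ∑' n, decay c r₃ n)) ((T : ℝ) ^ (1 / δ)) L Lf
        (M.Λ N) (M.F T ω) (M.idio N T ω) W} ⊆
      {ω | T * B < ∑ t, X₁ t ω} ∪ {ω | ((T * T : ℕ) : ℝ) * B < ∑ p, X₂ p ω}) (measure_ne_top _ _)
  · refine hmono.trans ((measureReal_union_le _ _).trans ((add_le_add hP1 hP2).trans ?_))
    linarith
  refine fun ω hbad => by_contra fun hω => hbad ?_
  simp only [Set.mem_union, Set.mem_ofPred_eq, not_or, not_lt] at hω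
  obtain ⟨h1, h2⟩ := hω
  intro L Lf hL hLf hUL hFL
  have hdec : ∀ s t : ℤ, |∫ ω, M.u N s ω ⬝ᵥ (W *ᵥ M.u N t ω) ∂μ| ≤
      N * (KW * (C * decay c r₃ (s - t).natAbs)) := fun s t =>
    h.abs_integral_quadForm_le (mul_nonneg hC (decay_pos _ _ _).le) hW
      fun i j => hcov N i j s t
  refine scoreBounds_of_moments (E := Matrix.of fun t s : Fin T =>
      ∫ ω, M.u N (time t) ω ⬝ᵥ (W *ᵥ M.u N (time s) ω) ∂μ)
    (ψ := Matrix.of fun t s : Fin T => decay c r₃ (time t - time s).natAbs) (by linarith) hN hT hB1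
    hWs (mul_nonneg hKW hC) (fun t s => (decay_pos _ _ _).le) (fun t s => decay_le_one hc _)
    (fun t => ?_) h1 ?_ (fun t s => (hdec _ _).trans_eq ?_) hL hLf hUL hFL
  · exact sum_decay_le hc hr₃ Finset.univ (fun s : Fin T => time s)
      (fun s _ s' _ hss => by simp only [time] at hss; ext; omega) (time t)
  · rw [Fintype.sum_prod_type] at h2
    refine le_trans h2 (le_of_eq ?_)
    push_cast; ring
  · simp only [Matrix.of_apply]; ring

end GoodSamples

end FactorModel

/-! ### Consequences of the growth conditions -/

section Growth

/-- As q ≥ 0, the exponent 1/(2 - 2q) is at least 1/2, so √N log N = o(T). This yields both N ≤ T²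
and log N / T → 0. -/
theorem growth_of_isLittleO {N T : ℕ → ℕ} {q : ℝ} (hN : Tendsto N atTop atTop)
    (hq0 : 0 ≤ q) (hq : q < 1 / 2)
    (hNT : (fun n => (N n : ℝ) ^ (1 / (2 - 2 * q)) * Real.log (N n)) =o[atTop]
      (fun n => (T n : ℝ)))
    (hTN : (fun n => (T n : ℝ)) =o[atTop] (fun n => (N n : ℝ) ^ 2)) :
    (∀ᶠ n in atTop, N n ≤ T n ^ 2 ∧ T n ≤ N n ^ 2) ∧
      Tendsto (fun n => √(Real.log (N n) / T n)) atTop (𝓝 0) := by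
  have hNr : Tendsto (fun n => (N n : ℝ)) atTop atTop := tendsto_natCast_atTop_atTop.comp hN
  have hlog : ∀ᶠ n in atTop, 1 ≤ Real.log (N n) :=
    (Real.tendsto_log_atTop.comp hNr).eventually_ge_atTop 1
  have hpow : ∀ᶠ n in atTop, 1 ≤ √(N n : ℝ) ∧ √(N n : ℝ) ≤ (N n : ℝ) ^ (1 / (2 - 2 * q)) := by
    filter_upwards [hNr.eventually_ge_atTop 1] with n hn
    refine ⟨Real.one_le_sqrt.2 hn, ?_⟩
    rw [Real.sqrt_eq_rpow]
    refine Real.rpow_le_rpow_of_exponent_le hn ?_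
    exact one_div_le_one_div_of_le (by linarith) (by linarith)
  have key : ∀ c : ℝ, 0 < c → ∀ᶠ n in atTop, √(N n : ℝ) * Real.log (N n) ≤ c * T n := by
    intro c hc
    filter_upwards [hNT.bound hc, hlog, hpow] with n h1 h2 h3
    rw [Real.norm_of_nonneg (mul_nonneg (by positivity) (by linarith)),
      Real.norm_of_nonneg (by positivity)] at h1
    refine le_trans ?_ h1
    gcongr
    exact h3.2
  constructor
  · filter_upwards [key 1 one_pos, hlog, hpow, hTN.bound one_pos] with n h1 h2 h3 h4
    constructor
    · have h5 : √(N n : ℝ) ≤ T n := by nlinarith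
      have h6 : (N n : ℝ) ≤ (T n : ℝ) ^ 2 := by
        rwa [Real.sqrt_le_left (by positivity)] at h5
      exact_mod_cast h6
    · rw [Real.norm_of_nonneg (by positivity), Real.norm_of_nonneg (by positivity), one_mul] at h4
      exact_mod_cast h4
  · have h0 : Tendsto (fun n => Real.log (N n) / T n) atTop (𝓝 0) := by
      rw [Metric.tendsto_nhds]
      intro e he
      filter_upwards [key (e / 2) (by positivity), hlog, hpow] with n h1 h2 h3
      have hT : (0 : ℝ) < T n := by
        by_contra hT
        have : (T n : ℝ) = 0 := le_antisymm (not_lt.1 hT) (by positivity)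
        rw [this] at h1
        nlinarith
      rw [Real.dist_eq, sub_zero, abs_of_nonneg (by positivity), div_lt_iff₀ hT]
      nlinarith
    simpa using h0.sqrt

theorem tendsto_zero_of_sqrt_mul_sq {N : ℕ → ℕ} {ρ : ℕ → ℝ} (hN : Tendsto N atTop atTop)
    (h : (fun n => √(N n : ℝ) * ρ n ^ 2) =o[atTop] (fun _ => (1 : ℝ))) :
    Tendsto ρ atTop (𝓝 0) := by
  rw [Metric.tendsto_nhds]
  intro e he
  have hNr : Tendsto (fun n => (N n : ℝ)) atTop atTop := tendsto_natCast_atTop_atTop.comp hN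
  filter_upwards [h.bound (show 0 < e ^ 2 / 2 by positivity), hNr.eventually_ge_atTop 1]
    with n h1 h2
  rw [Real.norm_of_nonneg (by positivity), norm_one, mul_one] at h1
  have h3 : 1 ≤ √(N n : ℝ) := Real.one_le_sqrt.2 h2
  rw [Real.dist_eq, sub_zero]
  refine abs_lt_of_sq_lt_sq ?_ he.le
  have h4 : 0 < e ^ 2 := by positivity
  nlinarith [sq_nonneg (ρ n)]

end Growth

/-! ### Assembling the uniform rates -/

section Main

variable {Ω : Type*} [MeasurableSpace Ω] {μ : Measure Ω} {r : ℕ}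

theorem FactorModel.sum_sparsityTerm_le (M : FactorModel Ω r) (q : ℝ) (N : ℕ) (i : Fin N) :
    ∑ j, sparsityTerm q (M.covU μ N i j) ≤ M.m μ q N :=
  le_ciSup (f := fun i : Fin N => ∑ j, sparsityTerm q (M.covU μ N i j))
    (Set.finite_range _).bddAbove i

variable [IsProbabilityMeasure μ]

theorem eventually_measure_le_of_real_le {B : ℕ → Set Ω} {e : ℝ}
    (h : ∀ᶠ n in atTop, μ.real (B n) ≤ e) : ∀ᶠ n in atTop, μ (B n) ≤ ENNReal.ofReal e := by
  filter_upwards [h] with n hn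
  rw [← ofReal_measureReal]
  exact ENNReal.ofReal_le_ofReal hn

/-- Uniform bounds on the estimators with probability close to one. -/
theorem exists_uniform_rates {M : FactorModel Ω r} {r₁ r₂ δ q : ℝ}
    {N T : ℕ → ℕ} (hN : Tendsto N atTop atTop) (hT : Tendsto T atTop atTop)
    (hreg : M.Regular μ r₁ r₂) (hperv : M.Pervasive)
    (hrow : FactorModel.BoundedRowSums fun N => (M.covU μ N)⁻¹)
    (hmom : M.MomentBounds μ (fun N => (M.covU μ N)⁻¹) N T δ)
    (hq0 : 0 ≤ q) (hq : q < 1 / 2)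
    (hrate : (fun n => √(N n : ℝ) * M.m μ q (N n) ^ 2 * rate (N n) (T n) ^ (2 - 2 * q))
      =o[atTop] (fun _ => (1 : ℝ)))
    (hNT : (fun n => (N n : ℝ) ^ (1 / (2 - 2 * q)) * Real.log (N n)) =o[atTop]
      (fun n => (T n : ℝ)))
    (hTN : (fun n => (T n : ℝ)) =o[atTop] (fun n => (N n : ℝ) ^ 2)) :
    ∃ C₀ : ℝ, 0 < C₀ ∧ ∀ C : ℝ, C₀ ≤ C → ∀ e : ℝ, 0 < e → ∃ A : ℝ, 0 < A ∧
    ∀ (a b : ℝ) (s : (n : ℕ) → Fin (N n) → Fin (N n) → ℝ → ℝ → ℝ),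
      (∀ n i j, IsThresholding a b (s n i j)) → (∀ n i j, s n i j = s n j i) →
    ∀ (ν : (n : ℕ) → Ω → Fin r → ℝ) (Ξ : (n : ℕ) → Ω → Matrix (Fin (N n)) (Fin r) ℝ),
      (∀ᶠ n in atTop, ∀ ω,
        IsLeadingEigensystem (sampleCov (M.Y (N n) (T n) ω)) (ν n ω) (Ξ n ω)) →
    ∀ Shat : (n : ℕ) → Ω → Matrix (Fin (N n)) (Fin (N n)) ℝ,
      (∀ n ω, Shat n ω = thresholdCov C (rate (N n) (T n)) (s n)
        (residualCov (M.Y (N n) (T n) ω) (ν n ω) (Ξ n ω))) →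
    ∀ (v : (n : ℕ) → Ω → Fin r → ℝ) (Fhat : (n : ℕ) → Ω → Matrix (Fin (T n)) (Fin r) ℝ),
      (∀ᶠ n in atTop, ∀ ω,
        IsLeadingEigensystem ((M.Y (N n) (T n) ω)ᵀ * (Shat n ω)⁻¹ * M.Y (N n) (T n) ω) (v n ω)
          ((√(T n : ℝ))⁻¹ • Fhat n ω)) →
    ∀ H : (n : ℕ) → Ω → Matrix (Fin r) (Fin r) ℝ,
      (∀ n ω, H n ω = rotationMatrix (v n ω) (Fhat n ω) (M.F (T n) ω) (M.Λ (N n)) (Shat n ω)⁻¹) →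
    ∀ᶠ n in atTop, 0 ≤ M.m μ q (N n) ∧ μ.real {ω | ¬ (IsUnit (H n ω) ∧
      (∀ t : Fin (T n), vnorm (Fhat n ω t - H n ω *ᵥ M.f (time t) ω) ≤
        A * ((T n : ℝ) ^ (1 / δ) / √(N n : ℝ) +
        Real.log (T n) ^ max (1 / r₁) (1 / r₂) * M.m μ q (N n) * rate (N n) (T n) ^ (1 - q))) ∧
      ∀ j : Fin (N n), vnorm
        (loadingEst (M.Y (N n) (T n) ω) (Fhat n ω) j - ((H n ω)ᵀ)⁻¹ *ᵥ M.Λ (N n) j) ≤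
        A * (M.m μ q (N n) * rate (N n) (T n) ^ (1 - q)))} ≤ e := by
  obtain ⟨c₁, c₂, hc₁, hc₂, hS0, hS1, -, -⟩ := hreg.exists_population
  obtain ⟨K, κ, B, hK, hκ0, hκ1, hB, ε₀, hε₀, n₀, hgood⟩ := hreg.exists_sampleBounds hperv
  obtain ⟨K', hK', ω₀, hω₀, hres⟩ := residualCov_close r hK hκ0
  obtain ⟨KW', hKW'⟩ := hrow
  obtain ⟨Kδ', hKδ'⟩ := hmom.delta
  set K₁ := max 1 K' with hK₁
  set KW := max 0 KW' with hKW
  set Kδ := max 0 Kδ' with hKδ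
  have hK₁1 : 1 ≤ K₁ := le_max_left _ _
  -- This makes every threshold at least twice the entrywise error of `R`. The constant K₁ comes
  -- from `residualCov_close` and does not depend on the probability level `e`.
  refine ⟨4 * K₁ / c₂, by positivity, fun C hC e he => ?_⟩
  obtain ⟨x, hx, hscore⟩ := hreg.exists_scoreBounds (KW := KW) (Kδ := Kδ) (e := e / 2)
    hmom.four_le (le_max_left _ _) (le_max_left _ _) (by positivity)
  obtain ⟨A, ρ₀, hA, hρ₀, hdet⟩ := exists_estimator_bounds (r := r) hκ0 hκ1 hc₁ hc₂ hK
    (le_max_left 0 KW') hK₁1 hC hx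
  refine ⟨A * (1 + B + √r * B), by positivity, ?_⟩
  intro a b s hs hss ν Ξ hΞ Shat hShat v Fhat hv H hH
  obtain ⟨hNT2, hεlim⟩ := growth_of_isLittleO hN hq0 hq hNT hTN
  have hNr : Tendsto (fun n => (N n : ℝ)) atTop atTop := tendsto_natCast_atTop_atTop.comp hN
  have hTr : Tendsto (fun n => (T n : ℝ)) atTop atTop := tendsto_natCast_atTop_atTop.comp hT
  have hNlim : Tendsto (fun n => 1 / √(N n : ℝ)) atTop (𝓝 0) := by
    simp_rw [one_div]
    exact (Real.tendsto_sqrt_atTop.comp hNr).inv_tendsto_atTop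
  have hrlim : Tendsto (fun n => rate (N n) (T n)) atTop (𝓝 0) := by
    simpa [rate] using hεlim.add hNlim
  have hrate0 : ∀ n, 0 ≤ rate (N n) (T n) := fun n => by unfold rate; positivity
  have hρlim : Tendsto (fun n => M.m μ q (N n) * rate (N n) (T n) ^ (1 - q)) atTop (𝓝 0) := by
    -- In terms of ρ the growth condition reads √N ρ² = o(1).
    refine tendsto_zero_of_sqrt_mul_sq hN (hrate.congr_left fun n => ?_)
    rw [mul_pow, ← mul_assoc, ← Real.rpow_natCast (rate (N n) (T n) ^ (1 - q)),
      ← Real.rpow_mul (hrate0 n)]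
    congr 2
    push_cast; ring
  have hTinv : Tendsto (fun n => 6 / (T n : ℝ)) atTop (𝓝 0) := hTr.const_div_atTop 6
  filter_upwards [hNT2, hεlim.eventually_le_const hε₀, hrlim.eventually_le_const hω₀,
    hrlim.eventually_le_const hc₂, hρlim.eventually_le_const hρ₀,
    hTinv.eventually_le_const (half_pos he), hN.eventually_ge_atTop n₀, hT.eventually_ge_atTop n₀,
    hN.eventually_gt_atTop 0, hT.eventually_gt_atTop 0,
    (Real.tendsto_log_atTop.comp hNr).eventually_ge_atTop 1,
    (Real.tendsto_log_atTop.comp hTr).eventually_ge_atTop 1,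
    hN.eventually hKW', hKδ', hΞ, hv] with n gNT gε gω gc gρ gT gN0 gT0 gN gTp glN glT gW gδ gΞ gv
  simp only [Function.comp_apply] at glN glT
  have hN0 : (0 : ℝ) < N n := by exact_mod_cast gN
  have hT0 : (0 : ℝ) < T n := by exact_mod_cast gTp
  set w := rate (N n) (T n) with hw
  set ε := √(Real.log (N n) / T n) with hε
  have hwε : ε + 1 / √(N n : ℝ) = w := rfl
  have hw0 : 0 < w := by
    have : 0 < 1 / √(N n : ℝ) := by have := Real.sqrt_pos.2 hN0; positivity
    rw [← hwε]; positivity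
  set m := M.m μ q (N n) with hm
  set ρ := m * w ^ (1 - q) with hρ
  have hsum := M.sum_sparsityTerm_le (μ := μ) q (N n)
  have hm0 : 0 ≤ m := (Finset.sum_nonneg fun j _ => sparsityTerm_nonneg _ _).trans (hsum ⟨0, gN⟩)
  refine ⟨hm0, ?_⟩
  -- A diagonal entry of Σ_u is at least c₂ ≥ w, so it alone contributes w^q or more to m_N.
  have hwρ : w ≤ ρ := by
    set i : Fin (N n) := ⟨0, gN⟩
    have h1 := hS0 (N n) (Pi.single i 1)
    simp only [single_one_dotProduct, mulVec_single_one, Matrix.col_apply, Pi.single_eq_same,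
      mul_one] at h1
    have h2 : w ≤ |M.covU μ (N n) i i| := (gc.trans h1).trans (le_abs_self _)
    have h3 := le_rpow_mul_sparsityTerm hq0 hw0 h2
    have h4 : sparsityTerm q (M.covU μ (N n) i i) ≤ m :=
      (Finset.single_le_sum (f := fun j => sparsityTerm q (M.covU μ (N n) i j))
        (fun j _ => sparsityTerm_nonneg _ _) (Finset.mem_univ i)).trans (hsum i)
    calc w ≤ w ^ (1 - q) * sparsityTerm q (M.covU μ (N n) i i) := h3
      _ ≤ w ^ (1 - q) * m := by gcongr
      _ = ρ := mul_comm _ _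
  have hTε : 1 / √(T n : ℝ) ≤ ε := by
    have h1 : 1 / √(T n : ℝ) = √(1 / T n) := by rw [Real.sqrt_div zero_le_one, Real.sqrt_one]
    rw [h1]
    apply Real.sqrt_le_sqrt
    gcongr
  set L := B * Real.log (T n) ^ (1 / r₁) with hL
  set Lf := √r * (B * Real.log (T n) ^ (1 / r₂)) with hLf
  have hL0 : 0 ≤ L := by positivity
  have hLf0 : 0 ≤ Lf := by positivity
  have hLle : L + Lf + 1 ≤ (1 + B + √r * B) * Real.log (T n) ^ max (1 / r₁) (1 / r₂) := by
    have h1 : Real.log (T n) ^ (1 / r₁) ≤ Real.log (T n) ^ max (1 / r₁) (1 / r₂) :=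
      Real.rpow_le_rpow_of_exponent_le glT (le_max_left _ _)
    have h2 : Real.log (T n) ^ (1 / r₂) ≤ Real.log (T n) ^ max (1 / r₁) (1 / r₂) :=
      Real.rpow_le_rpow_of_exponent_le glT (le_max_right _ _)
    have h3 : 1 ≤ Real.log (T n) ^ max (1 / r₁) (1 / r₂) :=
      Real.one_le_rpow glT (le_max_of_le_left (one_div_nonneg.2 hreg.r₁_pos.le))
    have h4 : L ≤ B * Real.log (T n) ^ max (1 / r₁) (1 / r₂) := by rw [hL]; gcongr
    have h5 : Lf ≤ √r * (B * Real.log (T n) ^ max (1 / r₁) (1 / r₂)) := by rw [hLf]; gcongr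
    linarith
  have hP1 := hgood (N n) (T n) gN0 gT0 gNT.1 gNT.2 gε
  have hP2 := hscore (N n) (T n) gN gTp (fun i => (gW i).trans (le_max_right _ _)) fun i j =>
    ⟨(gδ i j).1.le.trans (le_max_right _ _), (gδ i j).2.le.trans (le_max_right _ _)⟩
  have hP := (measureReal_union_le (μ := μ) _ _).trans
    ((add_le_add (hP1.trans gT) hP2).trans_eq (add_halves e))
  refine le_trans (measureReal_mono ?_ (measure_ne_top _ _)) hP
  refine fun ω hbad => by_contra fun hω => hbad ?_
  simp only [Set.mem_union, Set.mem_ofPred_eq, not_or, not_not] at hω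
  obtain ⟨⟨hSB, hUL, hFL⟩, hSc⟩ := hω
  have hScB := hSc L Lf hL0 hLf0 hUL fun t => vnorm_le_of_abs_le (by positivity) (hFL t)
  have hY := M.Y_eq (N n) (T n) ω
  have gΞω := gΞ ω
  have gvω := gv ω
  have hSω := hShat n ω
  rw [hY] at gΞω gvω hSω
  have hR : ∀ i j, |residualCov (M.Λ (N n) * (M.F (T n) ω)ᵀ + M.idio (N n) (T n) ω) (ν n ω)
      (Ξ n ω) i j - M.covU μ (N n) i j| ≤ K₁ * w := fun i j =>
    (hres _ _ _ _ _ _ _ hSB gω _ _ gΞω i j).trans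
      (mul_le_mul_of_nonneg_right (le_max_right 1 K') hw0.le)
  obtain ⟨d1, d2, d3⟩ := hdet hSB hScB (FactorModel.covU_transpose _) (hS0 (N n)) (hS1 (N n))
    (fun i => (gW i).trans (le_max_right _ _)) hq0 (by linarith) hsum (hs n) (hss n) hR hSω gvω
    (hH n ω) hwρ hTε gρ
  have hbig : 1 ≤ 1 + B + √r * B := by
    have : 0 ≤ √(r : ℝ) * B := by positivity
    linarith
  have hρ0 : 0 ≤ ρ := hw0.le.trans hwρ
  refine ⟨d1, fun t => (d2 t).trans ?_, fun j => ?_⟩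
  · rw [mul_assoc A]
    refine mul_le_mul_of_nonneg_left ?_ hA.le
    have h1 : 0 ≤ (T n : ℝ) ^ (1 / δ) / √(N n : ℝ) := by positivity
    rw [mul_add]
    refine add_le_add (le_mul_of_one_le_left h1 hbig) ?_
    calc (L + Lf + 1) * ρ ≤ (1 + B + √r * B) * Real.log (T n) ^ max (1 / r₁) (1 / r₂) * ρ :=
          mul_le_mul_of_nonneg_right hLle hρ0
      _ = _ := by rw [hρ]; ring
  · rw [hY]
    refine (d3 j).trans ?_
    rw [mul_assoc A]
    exact mul_le_mul_of_nonneg_left (le_mul_of_one_le_left hρ0 hbig) hA.le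

end Main

end WPC

/-! ### The theorem -/

theorem theorem4p2 {Ω : Type*} [MeasurableSpace Ω] (μ : Measure Ω) [IsProbabilityMeasure μ]
    {r : ℕ} (M : FactorModel Ω r) (r₁ r₂ δ q : ℝ)
    -- the sample sizes `N` and `T`, which tend to infinity together
    (N T : ℕ → ℕ) (hN : Tendsto N atTop atTop) (hT : Tendsto T atTop atTop)
    -- the indices of the large entries of `Σ_u`
    (S : (n : ℕ) → Finset (Fin (N n) × Fin (N n)))
    -- the assumptions on the model, for the weight matrix `W = Σ_u⁻¹`
    (hreg : M.Regular μ r₁ r₂)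
    (hperv : M.Pervasive)
    (hrow : FactorModel.BoundedRowSums fun N => (M.covU μ N)⁻¹)
    (hmom : M.MomentBounds μ (fun N => (M.covU μ N)⁻¹) N T δ)
    (hlim : M.LoadingLimit μ fun N => (M.covU μ N)⁻¹)
    (hclt : M.CrossSectionalCLT μ fun N => (M.covU μ N)⁻¹)
    (hsparse : M.ConditionallySparse μ N T q S)
    (havg : M.WeightedAverages μ N T S)
    -- the growth conditions
    (hrate : (fun n => √(N n : ℝ) * M.m μ q (N n) ^ 2 * rate (N n) (T n) ^ (2 - 2 * q))
      =o[atTop] (fun _ => (1 : ℝ)))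
    (hNT : (fun n => (N n : ℝ) ^ (1 / (2 - 2 * q)) * Real.log (N n)) =o[atTop]
      (fun n => (T n : ℝ)))
    (hTN : (fun n => (T n : ℝ)) =o[atTop] (fun n => (N n : ℝ) ^ 2)) :
    -- for every large enough constant `C` in the threshold,
    ∃ C₀ : ℝ, 0 < C₀ ∧ ∀ C : ℝ, C₀ ≤ C →
    -- all thresholding functions,
    ∀ (a b : ℝ) (s : (n : ℕ) → Fin (N n) → Fin (N n) → ℝ → ℝ → ℝ), 0 < a → 1 < b →
      (∀ n i j, IsThresholding a b (s n i j)) → (∀ n i j, s n i j = s n j i) →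
    -- the leading eigenvalues and eigenvectors of the sample covariance matrix, any choice,
    ∀ (ν : (n : ℕ) → Ω → Fin r → ℝ) (Ξ : (n : ℕ) → Ω → Matrix (Fin (N n)) (Fin r) ℝ),
      (∀ᶠ n in atTop, ∀ ω,
        IsLeadingEigensystem (sampleCov (M.Y (N n) (T n) ω)) (ν n ω) (Ξ n ω)) →
    -- the estimator of `Σ_u`
    ∀ Shat : (n : ℕ) → Ω → Matrix (Fin (N n)) (Fin (N n)) ℝ,
      (∀ n ω, Shat n ω = thresholdCov C (rate (N n) (T n)) (s n)
        (residualCov (M.Y (N n) (T n) ω) (ν n ω) (Ξ n ω))) →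
    -- the estimated factors, from any choice of the leading eigenvectors of `Y' Σ̂_u⁻¹ Y`,
    ∀ (v : (n : ℕ) → Ω → Fin r → ℝ) (Fhat : (n : ℕ) → Ω → Matrix (Fin (T n)) (Fin r) ℝ),
      (∀ᶠ n in atTop, ∀ ω,
        IsLeadingEigensystem ((M.Y (N n) (T n) ω)ᵀ * (Shat n ω)⁻¹ * M.Y (N n) (T n) ω) (v n ω)
          ((√(T n : ℝ))⁻¹ • Fhat n ω)) →
    -- and the rotation matrix `H_e`
    ∀ H : (n : ℕ) → Ω → Matrix (Fin r) (Fin r) ℝ,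
      (∀ n ω, H n ω = rotationMatrix (v n ω) (Fhat n ω) (M.F (T n) ω) (M.Λ (N n)) (Shat n ω)⁻¹) →
    Tendsto (fun n => μ {ω | ¬ IsUnit (H n ω)}) atTop (𝓝 0) ∧
    IsBigOInProb μ
      (fun n ω => ⨆ t : Fin (T n), vnorm (Fhat n ω t - H n ω *ᵥ M.f (time t) ω))
      (fun n => (T n : ℝ) ^ (1 / δ) / √(N n : ℝ) +
        Real.log (T n) ^ max (1 / r₁) (1 / r₂) * M.m μ q (N n) *
          rate (N n) (T n) ^ (1 - q)) ∧
    IsBigOInProb μ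
      (fun n ω => ⨆ j : Fin (N n), vnorm
        (loadingEst (M.Y (N n) (T n) ω) (Fhat n ω) j - ((H n ω)ᵀ)⁻¹ *ᵥ M.Λ (N n) j))
      (fun n => M.m μ q (N n) * rate (N n) (T n) ^ (1 - q)) := by
  obtain ⟨C₀, hC₀, hmain⟩ := exists_uniform_rates hN hT hreg hperv hrow hmom hsparse.q_nonneg
    hsparse.q_lt hrate hNT hTN
  refine ⟨C₀, hC₀, fun C hC a b s _ _ hs hss ν Ξ hΞ Shat hShat v Fhat hv H hH => ⟨?_, ?_, ?_⟩⟩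
  · rw [ENNReal.tendsto_nhds_zero]
    intro e he
    obtain ⟨e', he', hee⟩ : ∃ e' : ℝ, 0 < e' ∧ ENNReal.ofReal e' ≤ e := by
      rcases eq_or_ne e ⊤ with rfl | htop
      · exact ⟨1, one_pos, le_top⟩
      · exact ⟨e.toReal, ENNReal.toReal_pos he.ne' htop, ENNReal.ofReal_toReal_le⟩
    obtain ⟨A, hA, hev⟩ := hmain C hC e' he'
    filter_upwards [eventually_measure_le_of_real_le ((hev a b s hs hss ν Ξ hΞ Shat hShat v Fhat
      hv H hH).mono fun n hn => hn.2)] with n hn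
    refine (measure_mono fun ω hω hgood => ?_).trans (hn.trans hee)
    rw [Set.mem_ofPred_eq] at hω
    exact hω hgood.1
  · intro e he
    obtain ⟨A, hA, hev⟩ := hmain C hC e he
    have hev' := hev a b s hs hss ν Ξ hΞ Shat hShat v Fhat hv H hH
    refine ⟨A, hA, ?_⟩
    filter_upwards [eventually_measure_le_of_real_le (hev'.mono fun n hn => hn.2), hev']
      with n hn hn'
    refine (measure_mono fun ω hω hgood => ?_).trans hn
    rw [Set.mem_ofPred_eq] at hω
    refine not_le.2 hω ?_
    have hm := hn'.1
    have hw : 0 ≤ rate (N n) (T n) := by unfold rate; positivity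
    have hl : 0 ≤ Real.log (T n) := Real.log_natCast_nonneg _
    -- The supremum of nonnegative terms is its own absolute value, and it is at most a common bound
    -- of the terms; nonnegativity of the bound also covers an empty index set, where the supremum
    -- is 0.
    rw [abs_of_nonneg (Real.iSup_nonneg fun t => vnorm_nonneg _)]
    exact Real.iSup_le hgood.2.1 (by positivity)
  · intro e he
    obtain ⟨A, hA, hev⟩ := hmain C hC e he
    have hev' := hev a b s hs hss ν Ξ hΞ Shat hShat v Fhat hv H hH
    refine ⟨A, hA, ?_⟩
    filter_upwards [eventually_measure_le_of_real_le (hev'.mono fun n hn => hn.2), hev']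
      with n hn hn'
    refine (measure_mono fun ω hω hgood => ?_).trans hn
    rw [Set.mem_ofPred_eq] at hω
    refine not_le.2 hω ?_
    have hm := hn'.1
    have hw : 0 ≤ rate (N n) (T n) := by unfold rate; positivity
    rw [abs_of_nonneg (Real.iSup_nonneg fun t => vnorm_nonneg _)]
    exact Real.iSup_le hgood.2.2 (by positivity)
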